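/- **Theorem 1 (barren plateau for shallow depth).** Consider one qubit and one bosonic mode with annihilation operator $m$. Put $D(\beta)=\exp(\beta m^\dagger-\beta^* m)$, $U_{\rm ECD}(\beta)=D(\beta)\otimes|1\rangle\langle 0|+D(-\beta)\otimes|0\rangle\langle 1|$ and $U_{\rm R}(\theta,\phi)=\exp[-\tfrac{i\theta}{2}(\cos\phi\,\sigma^x+\sin\phi\,\sigma^y)]$. For $L\ge 1$ let $$U=U_{\rm ECD}(\beta_L)U_{\rm R}(\theta_L,\phi_L)\cdots U_{\rm ECD}(\beta_1)U_{\rm R}(\theta_1,\phi_1)$$ be drawn from the energy-regularized ensemble $\mathcal U_{E,L,1}$: all parameters are independent, each $\beta_\ell$ is centred complex Gaussian with $\mathbb E|\beta_\ell|^2=E/L$ (real and imaginary parts independent of variance $E/2L$), and all $\theta_\ell,\phi_\ell$ are uniform on $[0,2\pi)$. The target $|\psi\rangle$ is either a pure Gaussian state $D(\gamma)R(\tau)S(\zeta)|0\rangle$ with $\gamma\in\mathbb C$, $\tau,\zeta\in\mathbb R$, $R(\tau)=\exp(-i\tau m^\dagger m)$, $S(\zeta)=\exp[\zeta(m^2-m^{\dagger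 2})/2]$, or a Fock state $|n\rangle$, $n\in\mathbb N$. The cost is $\mathcal C=\mathrm{Tr}[O\,U\rho_0U^\dagger]$ with $O=|0\rangle\langle 0|\otimes|\psi\rangle\langle\psi|$ and $\rho_0$ the projection on $|0\rangle\otimes|0\rangle$ (qubit state $|0\rangle$, mode vacuum). Let $|\alpha\rangle=D(\alpha)|0\rangle$ and $C_1=\mathbb E\,|\langle\psi|\alpha\rangle|^4$ for $\alpha$ centred complex Gaussian with $\mathbb E|\alpha|^2=E$. (a) For all $E>0$, $L\ge1$ and $1\le k\le L$, the gradient $\partial_{\theta_k}\mathcal C$ exists everywhere, is square integrable and has mean zero. (b) For all $E>0$, in the Gaussian case $$C_1=\frac{\mathrm{sech}^2(\zeta)\,e^{-R(E)/G_1(E)}}{\sqrt{G_1(E)}},\qquad G_1(x)=1+4x+4\,\mathrm{sech}^2(\zeta)\,x^2,$$ $$R(x)=2|\gamma|^2+4\,\mathrm{sech}^2(\zeta)|\gamma|^2x+2\tanh(\zeta)|\gamma|^2\cos(2(\arg\gamma+\tau)),$$ and in the Fock case $$C_1=\frac{(2n)!}{(2^n n!)^2}\,\frac{(1+1/(2E))^{-2n}}{1+2E}.$$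 (c) For every function $\ell_c(E)=O(\log E)$ (as $E\to\infty$) there are constants $A,E_0$, depending only on $\psi$ and $\ell_c$, such that for all $E\ge E_0$, all depths $1\le L\le\ell_c(E)$ and all $1\le k\le L$ $$\Bigl|\mathrm{Var}[\partial_{\theta_k}\mathcal C]-\tfrac16\bigl(\tfrac34\bigr)^{L}C_1\Bigr|\le\frac{A}{E^2}.$$ (d) In particular, for every fixed depth $L$ and every $1\le k\le L$, $\mathrm{Var}[\partial_{\theta_k}\mathcal C]\sim 1/E$ for large $E$: $E\cdot\mathrm{Var}[\partial_{\theta_k}\mathcal C]$ converges to a positive constant as $E\to\infty$. -/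

import Mathlib

open MeasureTheory ProbabilityTheory Filter Topology Asymptotics
open scoped ComplexConjugate

namespace ECDCircuit

noncomputable section

/-! ### The bosonic mode in the number basis

A vector of the mode is given by its amplitudes `n ↦ ⟨n|v⟩` in the Fock (number) basis, an operator
by its matrix in that basis.  All vectors occurring below are square summable and all series
below converge absolutely. -/

/-- Amplitudes of a vector of the mode in the number basis. -/
abbrev Ket : Type := ℕ → ℂ

/-- The inner product `⟨u|v⟩`, antilinear in `u`. -/
def braket (u v : Ket) : ℂ := ∑' n, conj (u n) * v n

/-- The number (Fock) state `|n⟩`. -/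
def fockKet (n : ℕ) : Ket := fun m => if m = n then 1 else 0

/-- The vacuum `|0⟩`. -/
def vacuum : Ket := fockKet 0

/-- The annihilation operator `m`, with `m|n+1⟩ = √(n+1) |n⟩`. -/
def annihilate (v : Ket) : Ket := fun n => (Real.sqrt (n + 1) : ℂ) * v (n + 1)

/-- The creation operator `m†`, with `m†|n⟩ = √(n+1) |n+1⟩`. -/
def create (v : Ket) : Ket
  | 0 => 0
  | n + 1 => (Real.sqrt (n + 1) : ℂ) * v n

/-- The matrix element `⟨m| exp(z m†) |j⟩`. -/
def expCreate (z : ℂ) (m j : ℕ) : ℂ :=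
  if j ≤ m then z ^ (m - j) / ((m - j).factorial : ℂ) *
    ((Real.sqrt m.factorial / Real.sqrt j.factorial : ℝ) : ℂ) else 0

/-- The matrix element `⟨j| exp(z m) |n⟩`. -/
def expAnnihilate (z : ℂ) (j n : ℕ) : ℂ := expCreate z n j

/-- The matrix element `⟨m| D(β) |n⟩` of the displacement operator
`D(β) = exp(β m† - β* m) = exp(-|β|²/2) exp(β m†) exp(-β* m)`.  The exponential of the generator
`β m† - β* m` is characterized below by `displacementEntry_zero`
and `hasDerivAt_displacementEntry`. -/
def displacementEntry (β : ℂ) (m n : ℕ) : ℂ :=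
  (Real.exp (-‖β‖ ^ 2 / 2) : ℂ) *
    ∑ j ∈ Finset.range (n + 1), expCreate β m j * expAnnihilate (-conj β) j n

/-- The displacement operator `D(β)`. -/
def displacement (β : ℂ) (v : Ket) : Ket := fun m => ∑' n, displacementEntry β m n * v n

/-- The coherent state `|α⟩ = D(α)|0⟩`. -/
def coherent (α : ℂ) : Ket := displacement α vacuum

/-- The phase rotation `R(τ) = exp(-i τ m† m)`. -/
def phaseRotation (τ : ℝ) (v : Ket) : Ket := fun n => Complex.exp (-Complex.I * τ * n) * v n

/-- The squeezed vacuum `S(ζ)|0⟩`, `S(ζ) = exp(ζ (m² - m†²) / 2)`, in the number basis: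
`(cosh ζ)^(-1/2) ∑ j, (-tanh ζ)^j √((2j)!) / (2^j j!) |2j⟩`.
That it is the exponential of the generator applied to the vacuum is
`squeezedVacuum_zero` and `hasDerivAt_squeezedVacuum`. -/
def squeezedVacuum (ζ : ℝ) : Ket := fun n =>
  if Even n then
    (((-Real.tanh ζ) ^ (n / 2) * Real.sqrt n.factorial /
      (2 ^ (n / 2) * (n / 2).factorial) / Real.sqrt (Real.cosh ζ) : ℝ) : ℂ)
  else 0

/-! ### The target states -/

/-- The targets: the pure one-mode Gaussian states `D(γ) R(τ) S(ζ) |0⟩` and the Fock states. -/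
inductive Target : Type
  | gaussian (γ : ℂ) (τ ζ : ℝ) : Target
  | fock (n : ℕ) : Target

/-- The target vector `|ψ⟩`. -/
def Target.ket : Target → Ket
  | .gaussian γ τ ζ => displacement γ (phaseRotation τ (squeezedVacuum ζ))
  | .fock n => fockKet n

/-- `sech ζ`. -/
def sech (ζ : ℝ) : ℝ := 1 / Real.cosh ζ

/-- `G₁(x) = 1 + 4 x + 4 sech²(ζ) x²`. -/
def G₁ (ζ x : ℝ) : ℝ := 1 + 4 * x + 4 * sech ζ ^ 2 * x ^ 2

/-- `R(x) = 2|γ|² + 4 sech²(ζ) |γ|² x + 2 tanh(ζ) |γ|² cos(2 (arg γ + τ))`. -/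
def Rfun (γ : ℂ) (τ ζ x : ℝ) : ℝ :=
  2 * ‖γ‖ ^ 2 + 4 * sech ζ ^ 2 * ‖γ‖ ^ 2 * x
    + 2 * Real.tanh ζ * ‖γ‖ ^ 2 * Real.cos (2 * (Complex.arg γ + τ))

/-- The closed form of the correlator `C₁` at energy `E`. -/
def Target.C₁ : Target → ℝ → ℝ
  | .gaussian γ τ ζ, E =>
      sech ζ ^ 2 * Real.exp (-(Rfun γ τ ζ E / G₁ ζ E)) / Real.sqrt (G₁ ζ E)
  | .fock n, E =>
      ((2 * n).factorial : ℝ) / (2 ^ n * (n.factorial : ℝ)) ^ 2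
        * (((1 + 1 / (2 * E)) ^ (2 * n))⁻¹ / (1 + 2 * E))

/-! ### The circuit -/

/-- A vector of qubit and mode: component `a` is the mode vector that goes with `|a⟩` of the
qubit. -/
abbrev QKet : Type := Fin 2 → Ket

/-- The Pauli operator `σˣ`. -/
def pauliX : Matrix (Fin 2) (Fin 2) ℂ := !![0, 1; 1, 0]

/-- The Pauli operator `σʸ`. -/
def pauliY : Matrix (Fin 2) (Fin 2) ℂ := !![0, -Complex.I; Complex.I, 0]

/-- The qubit rotation `U_R(θ, φ) = exp(-i θ/2 (cos φ σˣ + sin φ σʸ))`. -/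
def qubitRotation (θ φ : ℝ) : Matrix (Fin 2) (Fin 2) ℂ :=
  NormedSpace.exp
    ((-Complex.I * (θ / 2 : ℂ)) • ((Real.cos φ : ℂ) • pauliX + (Real.sin φ : ℂ) • pauliY))

/-- A qubit operator acting on qubit and mode. -/
def applyQubit (A : Matrix (Fin 2) (Fin 2) ℂ) (Ψ : QKet) : QKet :=
  fun a n => ∑ b, A a b * Ψ b n

/-- The gate `U_ECD(β) = D(β) ⊗ |1⟩⟨0| + D(-β) ⊗ |0⟩⟨1|`. -/
def ecd (β : ℂ) (Ψ : QKet) : QKet :=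
  ![displacement (-β) (Ψ 1), displacement β (Ψ 0)]

/-- The initial state `|0⟩_q |0⟩_m`. -/
def initialState : QKet := ![vacuum, 0]

/-- The state `U_ECD(β_L) U_R(θ_L, φ_L) ⋯ U_ECD(β_1) U_R(θ_1, φ_1) |0⟩_q |0⟩_m`; layer `ℓ` has
index `ℓ - 1` in `Fin L`. -/
def outputState : (L : ℕ) → (Fin L → ℂ) → (Fin L → ℝ) → (Fin L → ℝ) → QKet
  | 0, _, _, _ => initialState
  | L + 1, β, θ, φ =>
      ecd (β (Fin.last L)) (applyQubit (qubitRotation (θ (Fin.last L)) (φ (Fin.last L)))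
        (outputState L (fun i => β i.castSucc) (fun i => θ i.castSucc) (fun i => φ i.castSucc)))

/-- The parameters `(β, θ, φ)` of a circuit of depth `L`. -/
abbrev Params (L : ℕ) : Type := (Fin L → ℂ) × (Fin L → ℝ) × (Fin L → ℝ)

/-- The cost `Tr[O U ρ₀ U†]`, where `O = |0⟩⟨0|_q ⊗ |ψ⟩⟨ψ|_m` and
`ρ₀` is the projection on `|0⟩_q |0⟩_m`. -/
def cost (T : Target) {L : ℕ} (x : Params L) : ℝ :=
  ‖braket T.ket (outputState L x.1 x.2.1 x.2.2 0)‖ ^ 2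

/-- The cost as a function of the single angle `θ_k`, all other parameters being those of `x`. -/
def costAlong (T : Target) {L : ℕ} (k : Fin L) (x : Params L) (t : ℝ) : ℝ :=
  cost T (x.1, Function.update x.2.1 k t, x.2.2)

/-- The gradient `∂C/∂θ_k` at `x`. -/
def gradient (T : Target) {L : ℕ} (k : Fin L) (x : Params L) : ℝ :=
  deriv (costAlong T k x) (x.2.1 k)

/-! ### The random ensemble -/

/-- The centred complex Gaussian law with variance `v`: real and imaginary part are independent,
centred Gaussian with variance `v / 2`. -/
def complexGaussian (v : ℝ) : Measure ℂ :=
  ((gaussianReal 0 (v / 2).toNNReal).prod (gaussianReal 0 (v / 2).toNNReal)).map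
    (fun p : ℝ × ℝ => (⟨p.1, p.2⟩ : ℂ))

/-- The uniform law on `[0, 2π)`. -/
def uniformAngle : Measure ℝ := ProbabilityTheory.cond volume (Set.Ico 0 (2 * Real.pi))

/-- The energy-regularized ensemble of single-mode circuits of depth `L`: all parameters are
independent, `β_ℓ` is complex Gaussian with variance `E / L`, the angles are uniform. -/
def ensemble (E : ℝ) (L : ℕ) : Measure (Params L) :=
  (Measure.pi fun _ : Fin L => complexGaussian (E / L)).prod
    ((Measure.pi fun _ : Fin L => uniformAngle).prod (Measure.pi fun _ : Fin L => uniformAngle))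

/-! ### The displacement operator and the squeezed vacuum are the exponentials -/

theorem displacementEntry_zero (m n : ℕ) : displacementEntry 0 m n = fockKet n m := by
  unfold displacementEntry expAnnihilate
  rw [Finset.sum_eq_single n]
  · by_cases h : n ≤ m
    · rcases h.eq_or_lt with rfl | h'
      · have : (Real.sqrt (n.factorial : ℝ)) ≠ 0 := by positivity
        simp [expCreate, fockKet, this]
      · have : m - n ≠ 0 := by omega
        simp [expCreate, fockKet, h, this, h'.ne']
    · have : m ≠ n := by omega
      simp [expCreate, fockKet, h, this]
  · intro j hj hjn
    have h1 : j ≤ n := by have := Finset.mem_range.1 hj; omega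
    have : n - j ≠ 0 := by omega
    simp [expCreate, this]
  · intro h
    simp at h

theorem sqrt_factorial_succ (n : ℕ) :
    Real.sqrt ((n + 1).factorial : ℝ) = Real.sqrt (n + 1) * Real.sqrt n.factorial := by
  rw [Nat.factorial_succ, Nat.cast_mul, Real.sqrt_mul (by positivity)]
  push_cast
  rfl

theorem expCreate_succ_zero (z : ℂ) (m : ℕ) :
    (Real.sqrt (m + 1) : ℂ) * expCreate z (m + 1) 0 = z * expCreate z m 0 := by
  simp only [expCreate, Nat.zero_le, if_true, Nat.sub_zero, sqrt_factorial_succ]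
  have h2 : ((m + 1 : ℕ).factorial : ℂ) = (m + 1) * m.factorial := by
    rw [Nat.factorial_succ]; push_cast; ring
  have h3 : (Real.sqrt (m + 1) : ℂ) * (Real.sqrt (m + 1) : ℂ) = m + 1 := by
    rw [← Complex.ofReal_mul, Real.mul_self_sqrt (by positivity)]; push_cast; ring
  have h4 : (m : ℂ) + 1 ≠ 0 := by exact_mod_cast Nat.succ_ne_zero m
  have h5 : (m.factorial : ℂ) ≠ 0 := by exact_mod_cast m.factorial_ne_zero
  rw [h2]
  push_cast
  simp only [Nat.factorial_zero, Nat.cast_one, Real.sqrt_one, Complex.ofReal_one, div_one]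
  field_simp
  linear_combination (z ^ (m + 1) * (Real.sqrt m.factorial : ℂ)) * h3

/-- `m exp(z m†) = exp(z m†) (m + z)`, in matrix elements. -/
theorem expCreate_succ_succ (z : ℂ) (m j : ℕ) :
    (Real.sqrt (m + 1) : ℂ) * expCreate z (m + 1) (j + 1)
      = (Real.sqrt (j + 1) : ℂ) * expCreate z m j + z * expCreate z m (j + 1) := by
  have hs : ∀ k : ℕ, (Real.sqrt (k + 1) : ℂ) ≠ 0 := fun k => by
    have : Real.sqrt ((k : ℝ) + 1) ≠ 0 := by positivity
    exact_mod_cast this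
  have hq : ∀ k : ℕ, (Real.sqrt (k + 1) : ℂ) * (Real.sqrt (k + 1) : ℂ) = k + 1 := fun k => by
    rw [← Complex.ofReal_mul, Real.mul_self_sqrt (by positivity)]; push_cast; ring
  have hf : ∀ k : ℕ, (Real.sqrt k.factorial : ℂ) ≠ 0 := fun k => by
    have : Real.sqrt (k.factorial : ℝ) ≠ 0 := by positivity
    exact_mod_cast this
  rcases lt_trichotomy j m with h | rfl | h
  · obtain ⟨d, rfl⟩ := Nat.exists_eq_add_of_lt h
    have e1 : j + 1 ≤ j + d + 1 + 1 := by omega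
    have e2 : j ≤ j + d + 1 := by omega
    have e3 : j + 1 ≤ j + d + 1 := by omega
    simp only [expCreate, e1, e2, e3, if_true]
    have d1 : j + d + 1 + 1 - (j + 1) = d + 1 := by omega
    have d2 : j + d + 1 - j = d + 1 := by omega
    have d3 : j + d + 1 - (j + 1) = d := by omega
    rw [d1, d2, d3, sqrt_factorial_succ (j + d + 1), sqrt_factorial_succ j]
    have h2 : ((d + 1 : ℕ).factorial : ℂ) = (d + 1) * d.factorial := by
      rw [Nat.factorial_succ]; push_cast; ring
    have h4 : (d : ℂ) + 1 ≠ 0 := by exact_mod_cast Nat.succ_ne_zero d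
    have h5 : (d.factorial : ℂ) ≠ 0 := by exact_mod_cast d.factorial_ne_zero
    have q1 := hq (j + d + 1)
    have q2 := hq j
    have s2 := hs j
    have f2 := hf j
    rw [h2]
    push_cast at q1 q2 ⊢
    generalize (Real.sqrt ((j : ℝ) + d + 1 + 1) : ℂ) = A at *
    generalize (Real.sqrt ((j : ℝ) + 1) : ℂ) = B at *
    generalize (Real.sqrt ((j + d + 1).factorial : ℝ) : ℂ) = C at *
    generalize (Real.sqrt (j.factorial : ℝ) : ℂ) = F at *
    field_simp
    linear_combination (z ^ (d + 1) * C) * (q1 - q2)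
  · have e1 : ¬ j + 1 ≤ j := by omega
    simp only [expCreate, le_refl, e1, if_true, if_false, Nat.sub_self, pow_zero,
      Nat.factorial_zero, Nat.cast_one, div_one, one_mul, mul_zero, add_zero]
    have f1 : Real.sqrt ((j + 1).factorial : ℝ) ≠ 0 := by positivity
    have f2 : Real.sqrt (j.factorial : ℝ) ≠ 0 := by positivity
    rw [div_self f1, div_self f2]
  · have e1 : ¬ j + 1 ≤ m + 1 := by omega
    have e2 : ¬ j ≤ m := by omega
    have e3 : ¬ j + 1 ≤ m := by omega
    simp [expCreate, e1, e2, e3]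

/-- `d/dt exp(tβ m†) = β m† exp(tβ m†)`, in matrix elements. -/
theorem hasDerivAt_expCreate (β : ℂ) (m j : ℕ) (t : ℝ) :
    HasDerivAt (fun s : ℝ => expCreate (s * β) m j)
      (β * create (fun i => expCreate (t * β) i j) m) t := by
  have hlin : HasDerivAt (fun s : ℝ => (s : ℂ) * β) β t := by
    simpa using (Complex.ofRealCLM.hasDerivAt (x := t)).mul_const β
  have hs : (Real.sqrt j.factorial : ℂ) ≠ 0 := by
    have : Real.sqrt (j.factorial : ℝ) ≠ 0 := by positivity
    exact_mod_cast this
  by_cases h : j ≤ m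
  · have key := ((hlin.pow (m - j)).div_const ((m - j).factorial : ℂ)).mul_const
      ((Real.sqrt m.factorial / Real.sqrt j.factorial : ℝ) : ℂ)
    have e : (fun s : ℝ => expCreate (s * β) m j) = fun s : ℝ =>
        ((s : ℂ) * β) ^ (m - j) / ((m - j).factorial : ℂ) *
          ((Real.sqrt m.factorial / Real.sqrt j.factorial : ℝ) : ℂ) := by
      funext s; simp [expCreate, h]
    rw [e]
    refine key.congr_deriv ?_
    rcases h.eq_or_lt with rfl | h'
    · cases j with
      | zero => simp [create]
      | succ i => simp [create, expCreate]
    · obtain ⟨d, rfl⟩ := Nat.exists_eq_add_of_lt h'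
      have d1 : j + d + 1 - j = d + 1 := by omega
      have d2 : j + d - j = d := by omega
      have e2 : j ≤ j + d := by omega
      simp only [create, expCreate, e2, if_true, d1, d2, sqrt_factorial_succ (j + d)]
      have h2 : ((d + 1 : ℕ).factorial : ℂ) = (d + 1) * d.factorial := by
        rw [Nat.factorial_succ]; push_cast; ring
      have h4 : (d : ℂ) + 1 ≠ 0 := by exact_mod_cast Nat.succ_ne_zero d
      have h5 : (d.factorial : ℂ) ≠ 0 := by exact_mod_cast d.factorial_ne_zero
      rw [h2]
      push_cast
      field_simp
      try ring_nf
  · have e : (fun s : ℝ => expCreate (s * β) m j) = fun _ => 0 := by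
      funext s; simp [expCreate, h]
    rw [e]
    refine (hasDerivAt_const t (0 : ℂ)).congr_deriv ?_
    cases m with
    | zero => simp [create]
    | succ i =>
      have : ¬ j ≤ i := by omega
      simp [create, expCreate, this]

/-- `m†` commutes with `exp(z m†)`, in matrix elements. -/
theorem expCreate_comm (z : ℂ) (n j : ℕ) :
    (Real.sqrt (j + 1) : ℂ) * expCreate z (n + 1) (j + 1)
      = (Real.sqrt (n + 1) : ℂ) * expCreate z n j := by
  by_cases h : j ≤ n
  · have h' : j + 1 ≤ n + 1 := by omega
    have h1 : n + 1 - (j + 1) = n - j := by omega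
    have hs : (Real.sqrt (j + 1) : ℂ) ≠ 0 := by
      have : Real.sqrt ((j : ℝ) + 1) ≠ 0 := by positivity
      exact_mod_cast this
    simp only [expCreate, h, h', if_true, h1, sqrt_factorial_succ]
    push_cast
    field_simp
  · have h' : ¬ j + 1 ≤ n + 1 := by omega
    simp [expCreate, h]

/-- `d/dt D(tβ)|n⟩ = (β m† - β* m) D(tβ)|n⟩`. -/
theorem hasDerivAt_displacementEntry (β : ℂ) (m n : ℕ) (t : ℝ) :
    HasDerivAt (fun s : ℝ => displacementEntry (s * β) m n)
      (β * create (fun i => displacementEntry (t * β) i n) m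
        - conj β * annihilate (fun i => displacementEntry (t * β) i n) m) t := by
  set c : ℂ := -conj β with hc
  have hcj : ∀ s : ℝ, -conj ((s : ℂ) * β) = s * c := fun s => by simp [hc]
  have hexp : HasDerivAt (fun s : ℝ => (Real.exp (-‖(s : ℂ) * β‖ ^ 2 / 2) : ℂ))
      ((Real.exp (-‖(t : ℂ) * β‖ ^ 2 / 2) : ℂ) * (t * β * c)) t := by
    have h1 : HasDerivAt (fun s : ℝ => Real.exp (-(s ^ 2 * ‖β‖ ^ 2) / 2))
        (Real.exp (-(t ^ 2 * ‖β‖ ^ 2) / 2) * (-(2 * t * ‖β‖ ^ 2) / 2)) t := by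
      have h0 : HasDerivAt (fun s : ℝ => -(s ^ 2 * ‖β‖ ^ 2) / 2) (-(2 * t * ‖β‖ ^ 2) / 2) t := by
        simpa using (((hasDerivAt_pow 2 t).mul_const (‖β‖ ^ 2)).neg).div_const 2
      exact h0.exp
    have e : ∀ s : ℝ, ‖(s : ℂ) * β‖ ^ 2 = s ^ 2 * ‖β‖ ^ 2 := fun s => by
      rw [norm_mul, mul_pow, Complex.norm_real, Real.norm_eq_abs, sq_abs]
    simp only [e]
    refine h1.ofReal_comp.congr_deriv ?_
    have : (β * c : ℂ) = -((‖β‖ ^ 2 : ℝ) : ℂ) := by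
      rw [hc, mul_neg, Complex.mul_conj, Complex.normSq_eq_norm_sq]
    push_cast at this ⊢
    linear_combination (-(t : ℂ) * Complex.exp (-(t ^ 2 * ‖β‖ ^ 2) / 2)) * this
  have hsum := HasDerivAt.fun_sum (u := Finset.range (n + 1)) (x := t)
    (fun j _ => (hasDerivAt_expCreate β m j t).mul (hasDerivAt_expCreate c n j t))
  have key := hexp.mul hsum
  have e : (fun s : ℝ => displacementEntry (s * β) m n) = fun s : ℝ =>
      (Real.exp (-‖(s : ℂ) * β‖ ^ 2 / 2) : ℂ) *
        ∑ j ∈ Finset.range (n + 1), expCreate (s * β) m j * expCreate (s * c) n j := by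
    funext s; simp only [displacementEntry, expAnnihilate, hcj]
  rw [e]
  refine key.congr_deriv ?_
  simp only [displacementEntry, expAnnihilate, hcj, annihilate, Pi.mul_apply]
  have hcc : conj β = -c := by simp [hc]
  rw [hcc]
  generalize (Real.exp (-‖(t : ℂ) * β‖ ^ 2 / 2) : ℂ) = X
  have hcr : ∀ (f : ℕ → ℕ → ℂ), create (fun i => X * ∑ j ∈ Finset.range (n + 1), f i j) m
      = X * ∑ j ∈ Finset.range (n + 1), create (fun i => f i j) m := fun f => by
    cases m with
    | zero => simp [create]
    | succ i => simp only [create, Finset.mul_sum]; refine Finset.sum_congr rfl fun j _ => by ring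
  have hcm : ∀ (f : ℕ → ℂ) (a : ℂ), create (fun i => f i * a) m = create f m * a := fun f a => by
    cases m with
    | zero => simp [create]
    | succ i => simp only [create]; ring
  rw [hcr]
  simp only [hcm]
  have hA : (Real.sqrt (m + 1) : ℂ) * ∑ j ∈ Finset.range (n + 1),
        expCreate (t * β) (m + 1) j * expCreate (t * c) n j
      = t * β * ∑ j ∈ Finset.range (n + 1), expCreate (t * β) m j * expCreate (t * c) n j
        + ∑ j ∈ Finset.range (n + 1),
          expCreate (t * β) m j * create (fun i => expCreate (t * c) i j) n := by
    cases n with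
    | zero =>
      simp only [zero_add, Finset.sum_range_one, create, mul_zero, add_zero]
      rw [← mul_assoc, expCreate_succ_zero, mul_assoc]
    | succ n =>
      have htop : expCreate (t * c) n (n + 1) = 0 := by simp [expCreate]
      simp only [create]
      rw [Finset.sum_range_succ (fun j => expCreate (t * β) m j *
          ((Real.sqrt (n + 1) : ℂ) * expCreate (t * c) n j)), htop, mul_zero, mul_zero, add_zero,
        Finset.sum_range_succ', Finset.sum_range_succ' (fun j => expCreate (t * β) m j *
          expCreate (t * c) (n + 1) j), mul_add, mul_add, ← mul_assoc (Real.sqrt (m + 1) : ℂ)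
          (expCreate (t * β) (m + 1) 0), expCreate_succ_zero, Finset.mul_sum, Finset.mul_sum]
      have : ∀ j ∈ Finset.range (n + 1), (Real.sqrt (m + 1) : ℂ) *
          (expCreate (t * β) (m + 1) (j + 1) * expCreate (t * c) (n + 1) (j + 1))
          = t * β * (expCreate (t * β) m (j + 1) * expCreate (t * c) (n + 1) (j + 1))
            + expCreate (t * β) m j * ((Real.sqrt (n + 1) : ℂ) * expCreate (t * c) n j) :=
        fun j _ => by
          rw [← mul_assoc, expCreate_succ_succ, ← expCreate_comm]
          ring
      rw [Finset.sum_congr rfl this, Finset.sum_add_distrib]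
      ring
  rw [mul_left_comm (Real.sqrt (m + 1) : ℂ), hA, Finset.sum_add_distrib]
  have hB : ∑ j ∈ Finset.range (n + 1),
        β * create (fun i => expCreate (t * β) i j) m * expCreate (t * c) n j
      = β * ∑ j ∈ Finset.range (n + 1),
        create (fun i => expCreate (t * β) i j) m * expCreate (t * c) n j := by
    rw [Finset.mul_sum]
    exact Finset.sum_congr rfl fun j _ => by ring
  have hC : ∑ j ∈ Finset.range (n + 1),
        expCreate (t * β) m j * (c * create (fun i => expCreate (t * c) i j) n)
      = c * ∑ j ∈ Finset.range (n + 1),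
        expCreate (t * β) m j * create (fun i => expCreate (t * c) i j) n := by
    rw [Finset.mul_sum]
    exact Finset.sum_congr rfl fun j _ => by ring
  rw [hB, hC]
  ring

theorem squeezedVacuum_zero : squeezedVacuum 0 = vacuum := by
  funext n
  rcases Nat.even_or_odd n with h | h
  · obtain ⟨j, rfl⟩ := h
    rcases Nat.eq_zero_or_pos j with rfl | hj
    · simp [squeezedVacuum, vacuum, fockKet]
    · have : (j + j) / 2 ≠ 0 := by omega
      simp [squeezedVacuum, vacuum, fockKet, this, hj.ne']
  · have h0 : n ≠ 0 := by rintro rfl; simp at h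
    simp [squeezedVacuum, vacuum, fockKet, Nat.not_even_iff_odd.2 h, h0]

theorem hasDerivAt_tanh_pow_div_sqrt_cosh (j : ℕ) (x : ℝ) :
    HasDerivAt (fun s : ℝ => (-Real.tanh s) ^ j / Real.sqrt (Real.cosh s))
      ((-(1 / 2) * Real.tanh x * (-Real.tanh x) ^ j
        - j * (1 - Real.tanh x ^ 2) * (-Real.tanh x) ^ (j - 1)) / Real.sqrt (Real.cosh x)) x := by
  have hc : 0 < Real.cosh x := Real.cosh_pos x
  have ht : HasDerivAt Real.tanh (1 - Real.tanh x ^ 2) x := by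
    have := (Real.hasDerivAt_sinh x).div (Real.hasDerivAt_cosh x) hc.ne'
    have e : Real.tanh = fun y => Real.sinh y / Real.cosh y := by
      funext y; exact Real.tanh_eq_sinh_div_cosh y
    rw [Real.tanh_eq_sinh_div_cosh x]
    rw [e]
    refine this.congr_deriv ?_
    field_simp
  have hq := (Real.hasDerivAt_cosh x).sqrt hc.ne'
  have hs : Real.sqrt (Real.cosh x) ≠ 0 := by positivity
  have hss : Real.sqrt (Real.cosh x) ^ 2 = Real.cosh x := Real.sq_sqrt hc.le
  have hsh : Real.sinh x = Real.tanh x * Real.sqrt (Real.cosh x) ^ 2 := by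
    rw [hss, Real.tanh_eq_sinh_div_cosh]; field_simp
  refine ((ht.neg.pow j).div hq hs).congr_deriv ?_
  rw [hsh]
  simp only [Pi.neg_apply, Pi.pow_apply]
  field_simp
  ring

theorem squeezedVacuum_two_mul (ζ : ℝ) (j : ℕ) :
    squeezedVacuum ζ (2 * j) = (((-Real.tanh ζ) ^ j / Real.sqrt (Real.cosh ζ)
      * (Real.sqrt (2 * j).factorial / (2 ^ j * j.factorial)) : ℝ) : ℂ) := by
  have h : 2 * j / 2 = j := by omega
  simp only [squeezedVacuum, even_two_mul, if_true, h]
  congr 1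
  ring

/-- `d/dζ S(ζ)|0⟩ = (m² - m†²)/2 S(ζ)|0⟩`. -/
theorem hasDerivAt_squeezedVacuum (ζ : ℝ) (n : ℕ) :
    HasDerivAt (fun s : ℝ => squeezedVacuum s n)
      ((annihilate (annihilate (squeezedVacuum ζ)) n
        - create (create (squeezedVacuum ζ)) n) / 2) ζ := by
  rcases Nat.even_or_odd n with h | h
  · obtain ⟨j, rfl⟩ := h.two_dvd
    have hw : ∀ i : ℕ, Real.sqrt (2 * i + 1) * Real.sqrt (2 * i + 2)
        * (Real.sqrt (2 * (i + 1)).factorial / (2 ^ (i + 1) * (i + 1).factorial))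
        = (2 * i + 1) * (Real.sqrt (2 * i).factorial / (2 ^ i * i.factorial)) := fun i => by
      have e1 : 2 * (i + 1) = 2 * i + 1 + 1 := by ring
      have q1 : Real.sqrt (2 * i + 1) ^ 2 = 2 * i + 1 := Real.sq_sqrt (by positivity)
      have q2 : Real.sqrt (2 * i + 2) ^ 2 = 2 * i + 2 := Real.sq_sqrt (by positivity)
      have e2 : ((2 * i + 1 : ℕ) : ℝ) + 1 = 2 * i + 2 := by push_cast; ring
      rw [e1, sqrt_factorial_succ, sqrt_factorial_succ, e2, Nat.factorial_succ i]
      push_cast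
      have p2 : (2 : ℝ) ^ (i + 1) = 2 * 2 ^ i := by ring
      rw [p2]
      generalize Real.sqrt (2 * (i : ℝ) + 1) = A at *
      generalize Real.sqrt (2 * (i : ℝ) + 2) = B at *
      generalize Real.sqrt ((2 * i).factorial : ℝ) = C at *
      field_simp
      rw [q1, q2]
      ring
    have hw' : ∀ i : ℕ, Real.sqrt (2 * i + 1) * Real.sqrt (2 * i + 2)
        * (Real.sqrt (2 * i).factorial / (2 ^ i * i.factorial))
        = 2 * (i + 1) * (Real.sqrt (2 * (i + 1)).factorial / (2 ^ (i + 1) * (i + 1).factorial)) :=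
      fun i => by
        have e1 : 2 * (i + 1) = 2 * i + 1 + 1 := by ring
        have e2 : ((2 * i + 1 : ℕ) : ℝ) + 1 = 2 * i + 2 := by push_cast; ring
        rw [e1, sqrt_factorial_succ, sqrt_factorial_succ, e2, Nat.factorial_succ i]
        push_cast
        field_simp
        ring
    have e : (fun s : ℝ => squeezedVacuum s (2 * j)) = fun s : ℝ =>
        (((-Real.tanh s) ^ j / Real.sqrt (Real.cosh s)
          * (Real.sqrt (2 * j).factorial / (2 ^ j * j.factorial)) : ℝ) : ℂ) :=
      funext fun s => squeezedVacuum_two_mul s j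
    rw [e]
    refine (((hasDerivAt_tanh_pow_div_sqrt_cosh j ζ).mul_const
      (Real.sqrt (2 * j).factorial / (2 ^ j * j.factorial))).ofReal_comp).congr_deriv ?_
    have hup : annihilate (annihilate (squeezedVacuum ζ)) (2 * j)
        = (((-Real.tanh ζ) ^ (j + 1) / Real.sqrt (Real.cosh ζ) * ((2 * j + 1) *
          (Real.sqrt (2 * j).factorial / (2 ^ j * j.factorial))) : ℝ) : ℂ) := by
      have h2 : 2 * j + 1 + 1 = 2 * (j + 1) := by ring
      have e2 : ((2 * j : ℕ) : ℝ) + 1 = 2 * j + 1 := by push_cast; ring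
      have e3 : ((2 * j + 1 : ℕ) : ℝ) + 1 = 2 * j + 2 := by push_cast; ring
      simp only [annihilate]
      rw [h2, squeezedVacuum_two_mul, e2, e3, ← hw j, ← Complex.ofReal_mul, ← Complex.ofReal_mul]
      congr 1
      ring
    rw [hup]
    rcases j with _ | i
    · simp [create]
      ring
    · have hdn : create (create (squeezedVacuum ζ)) (2 * (i + 1))
          = (((-Real.tanh ζ) ^ i / Real.sqrt (Real.cosh ζ) * (2 * (i + 1) *
            (Real.sqrt (2 * (i + 1)).factorial / (2 ^ (i + 1) * (i + 1).factorial))) : ℝ) : ℂ) := by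
        have h2 : 2 * (i + 1) = 2 * i + 1 + 1 := by ring
        have e2 : ((2 * i : ℕ) : ℝ) + 1 = 2 * i + 1 := by push_cast; ring
        have e3 : ((2 * i + 1 : ℕ) : ℝ) + 1 = 2 * i + 2 := by push_cast; ring
        rw [← hw' i]
        rw [h2]
        simp only [create]
        rw [squeezedVacuum_two_mul, e2, e3, ← Complex.ofReal_mul, ← Complex.ofReal_mul]
        congr 1
        ring
      rw [hdn, ← Complex.ofReal_sub, ← Complex.ofReal_ofNat, ← Complex.ofReal_div]
      congr 1
      push_cast
      ring_nf
  · have hn : ¬ Even n := Nat.not_even_iff_odd.2 h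
    have h2 : ¬ Even (n + 1 + 1) := by
      rw [add_assoc, Nat.even_add]; simp [hn]
    have e : (fun s : ℝ => squeezedVacuum s n) = fun _ => 0 := by
      funext s; simp [squeezedVacuum, hn]
    rw [e]
    refine (hasDerivAt_const ζ (0 : ℂ)).congr_deriv ?_
    rcases n with _ | _ | n
    · simp at hn
    · simp [create, annihilate, squeezedVacuum, h2]
    · have h3 : ¬ Even n := by
        rw [add_assoc, Nat.even_add] at hn; simpa using hn
      simp [create, annihilate, squeezedVacuum, h2, h3]

end

end ECDCircuit

/-! The cost is a trigonometric polynomial of degree one in each `θ_k`, so its derivative is half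
the difference of the costs with `θ_k` shifted by `±π/2` (`hasDerivAt_costAlong`). The mean cost
does not depend on such shifts (`integral_ampW_shiftAngles_eq`), which gives mean zero, and the
variance becomes a combination of second moments of two copies of the circuit whose angles are
shifted by `ε` and `ε'`.

Displacements compose up to a phase, so the amplitudes `⟨ψ|D(g)|Ψ_a⟩` obey a recursion in the depth
(`amp`). Averaging the angles of a layer acts linearly on three contractions of the two copies: M
(`corrM`, same qubit state), A (`corrA`, different states) and B (`corrB`, coherences). In M both
copies are displaced together, so averaging over a Gaussian `g` of variance `v` closes the
recursion: with `κ` the cosine of the difference of the two shifts, M at variance `v` and depth `L +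
1` is `(1 + κ/2)/2` times M at variance `v + s` and depth `L`, plus multiples of A and B
(`ampMean_corrM_succ`). If A and B were absent, `L` layers would give a product of such factors
times the fourth moment of the overlap at total variance `L s = E`, that is `C₁`. The factor is 3/4
for equal shifts and 1/4 for shifts differing by `π`; since the cost is one half of M, this yields
`(1/4)(1/2)(1 - 2/3 + 1) = 1/6`.

It remains to bound A, because B is dominated by A (`norm_ampMean_corrB_le`). The displacements of
the two copies in A are opposite, so the amplitude recursion does not close, and the argument moves
to phase space: the projection on `ψ` is `π⁻¹ ∫ χ(ξ) D(ξ)` (`IsOverlap.integral_chi_mul_weylInner`),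
and contractions of amplitudes become integrals over `(ξ, η)` of contractions of the characteristic
functions `charW` (`IsOverlap.ampMean_eq`). There a layer damps M by `exp(-s|ξ + η|²)` and A by
`exp(-s|ξ - η|²)`, while the coherences are sampled at randomly translated points and are at most
`1/(2s)`, by conservation of the `L²` norm of `charW` (`integrable_sumSq_charW`,
`norm_charCorr_corrB_le`). The outer average damps `ξ + η` and the last layer damps `ξ - η`, so the
integral is `O(1/s²)`; the earlier layers improve this by `1/(L + 1)²`, up to an error `(L + 1)/s³`
from the coherences (`IsOverlap.exists_norm_ampMean_corrA_le`).

Finally `s = E/L`. The errors of the layers are summed with weights `(3/4)^(L-1-i)`, which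
concentrate on `i` near `L`, where `L²/(i+1)²` is bounded. The total is `O(1/E² + L⁵/E³)`, hence
`O(1/E²)` for `L = O(log E)`, whereas `C₁` is of order `1/E` (`exists_tendsto_mul_C₁`). -/

namespace ECDCircuit

noncomputable section

/-! ### The complex Gaussian law -/

theorem measurable_complex_mk : Measurable (fun p : ℝ × ℝ => (⟨p.1, p.2⟩ : ℂ)) :=
  Complex.measurableEquivRealProd.symm.measurable

instance isProbabilityMeasure_complexGaussian (v : ℝ) :
    IsProbabilityMeasure (complexGaussian v) :=
  Measure.isProbabilityMeasure_map measurable_complex_mk.aemeasurable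

theorem charFun_complexGaussian {v : ℝ} (hv : 0 ≤ v) (t : ℂ) :
    charFun (complexGaussian v) t = Complex.exp (-(v / 4 * ‖t‖ ^ 2 : ℝ)) := by
  have key : ∀ u : ℝ, ∫ x, Complex.exp (u * x * Complex.I) ∂gaussianReal 0 (v / 2).toNNReal
      = Complex.exp (-(v / 4 * u ^ 2 : ℝ)) := fun u => by
    rw [← charFun_apply_real, charFun_gaussianReal, Real.coe_toNNReal _ (by positivity)]
    congr 1
    push_cast
    ring
  rw [charFun_apply, complexGaussian, integral_map measurable_complex_mk.aemeasurable (by fun_prop)]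
  have : ∀ p : ℝ × ℝ, Complex.exp ((inner ℝ (⟨p.1, p.2⟩ : ℂ) t : ℝ) * Complex.I)
      = Complex.exp (t.re * p.1 * Complex.I) * Complex.exp (t.im * p.2 * Complex.I) := fun p => by
    rw [← Complex.exp_add, Complex.inner]
    congr 1
    simp
    ring
  simp_rw [this]
  rw [integral_prod_mul (fun x : ℝ => Complex.exp (t.re * x * Complex.I))
    (fun x : ℝ => Complex.exp (t.im * x * Complex.I)), key, key, ← Complex.exp_add,
    ← Complex.normSq_eq_norm_sq, Complex.normSq_apply]
  congr 1
  push_cast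
  ring

/-- The phase is the one that conjugation by `D(β)` produces on `D(ζ)`. Its average is the source of
all Gaussian damping in phase space below. -/
theorem integral_cexp_complexGaussian {v : ℝ} (hv : 0 ≤ v) (ζ : ℂ) :
    ∫ β, Complex.exp (Complex.I * (2 * (ζ * conj β).im : ℝ)) ∂complexGaussian v
      = (Real.exp (-(v * ‖ζ‖ ^ 2)) : ℂ) := by
  have h := charFun_complexGaussian hv (-2 * Complex.I * ζ)
  rw [charFun_apply] at h
  have e : ∀ β : ℂ, (inner ℝ β (-2 * Complex.I * ζ) : ℝ) = 2 * (ζ * conj β).im := fun β => by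
    rw [Complex.inner]; simp; ring
  simp_rw [e, mul_comm _ Complex.I] at h
  rw [h, norm_mul, norm_mul]
  simp
  ring_nf

/-- Independent displacements add their variances, which is how `L` layers of variance `E / L` end
up at the energy `E`. -/
theorem complexGaussian_conv {v w : ℝ} (hv : 0 ≤ v) (hw : 0 ≤ w) :
    (complexGaussian v).conv (complexGaussian w) = complexGaussian (v + w) := by
  refine Measure.ext_of_charFun ?_
  ext t
  rw [charFun_conv, charFun_complexGaussian hv, charFun_complexGaussian hw,
    charFun_complexGaussian (add_nonneg hv hw), ← Complex.exp_add]
  congr 1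
  push_cast
  ring

theorem complexGaussian_map_neg {v : ℝ} (hv : 0 ≤ v) :
    (complexGaussian v).map (fun z => -z) = complexGaussian v := by
  refine Measure.ext_of_charFun ?_
  ext t
  rw [charFun_complexGaussian hv, charFun_apply, integral_map (by fun_prop) (by fun_prop)]
  have := charFun_complexGaussian hv (-t)
  rw [charFun_apply] at this
  simpa using this

theorem integral_complexGaussian_neg {v : ℝ} (hv : 0 ≤ v) (F : ℂ → ℂ) :
    ∫ z, F (-z) ∂complexGaussian v = ∫ z, F z ∂complexGaussian v := by
  conv_rhs => rw [← complexGaussian_map_neg hv]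
  exact ((MeasurableEquiv.neg ℂ).measurableEmbedding.integral_map F).symm

theorem integral_complexGaussian_add {v w : ℝ} (hv : 0 ≤ v) (hw : 0 ≤ w) {F : ℂ → ℂ}
    (hF : Continuous F) {B : ℝ} (hB : ∀ z, ‖F z‖ ≤ B) :
    ∫ g, ∫ β, F (g + β) ∂complexGaussian w ∂complexGaussian v
      = ∫ z, F z ∂complexGaussian (v + w) := by
  rw [← complexGaussian_conv hv hw, integral_conv]
  exact Integrable.of_bound hF.aestronglyMeasurable B (ae_of_all _ hB)

theorem integral_complexGaussian_sub {v w : ℝ} (hv : 0 ≤ v) (hw : 0 ≤ w) {F : ℂ → ℂ}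
    (hF : Continuous F) {B : ℝ} (hB : ∀ z, ‖F z‖ ≤ B) :
    ∫ g, ∫ β, F (g - β) ∂complexGaussian w ∂complexGaussian v
      = ∫ z, F z ∂complexGaussian (v + w) := by
  rw [← integral_complexGaussian_add hv hw hF hB]
  refine integral_congr_ae (ae_of_all _ fun g => ?_)
  simpa [sub_eq_add_neg] using integral_complexGaussian_neg hw (fun β => F (g + β))

theorem complexGaussian_eq_withDensity {v : ℝ} (hv : 0 < v) :
    complexGaussian v = (volume : Measure ℂ).withDensity
      (fun z => ENNReal.ofReal ((Real.pi * v)⁻¹ * Real.exp (-‖z‖ ^ 2 / v))) := by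
  have hv2 : (v / 2).toNNReal ≠ 0 := by
    rw [ne_eq, Real.toNNReal_eq_zero]; linarith
  have hv3 : ((v / 2).toNNReal : ℝ) = v / 2 := Real.coe_toNNReal _ (by positivity)
  refine Measure.ext_of_lintegral _ fun F hF => ?_
  rw [complexGaussian, lintegral_map hF measurable_complex_mk,
    gaussianReal_of_var_ne_zero _ hv2, prod_withDensity (measurable_gaussianPDF _ _)
      (measurable_gaussianPDF _ _), lintegral_withDensity_eq_lintegral_mul _
      (by have := measurable_gaussianPDF 0 (v / 2).toNNReal
          fun_prop) (g := fun p : ℝ × ℝ => F ⟨p.1, p.2⟩) (hF.comp measurable_complex_mk),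
    lintegral_withDensity_eq_lintegral_mul _ (by fun_prop) hF,
    ← (Complex.volume_preserving_equiv_real_prod.symm).lintegral_comp (by fun_prop)]
  refine lintegral_congr fun p => ?_
  simp only [Pi.mul_apply, Complex.measurableEquivRealProd_symm_apply]
  congr 1
  rw [gaussianPDF, gaussianPDF, ← ENNReal.ofReal_mul (gaussianPDFReal_nonneg _ _ _)]
  congr 1
  simp only [gaussianPDFReal, hv3]
  have e : ‖(⟨p.1, p.2⟩ : ℂ)‖ ^ 2 = p.1 ^ 2 + p.2 ^ 2 := by
    rw [← Complex.normSq_eq_norm_sq, Complex.normSq_apply]; ring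
  have e2 : 2 * Real.pi * (v / 2) = Real.pi * v := by ring
  rw [e, e2, mul_mul_mul_comm, ← mul_inv, Real.mul_self_sqrt (by positivity), ← Real.exp_add]
  congr 2
  field_simp
  ring

theorem integral_complexGaussian {v : ℝ} (hv : 0 < v) (F : ℂ → ℝ) :
    ∫ z, F z ∂complexGaussian v
      = ∫ z, (Real.pi * v)⁻¹ * Real.exp (-‖z‖ ^ 2 / v) * F z := by
  rw [complexGaussian_eq_withDensity hv, integral_withDensity_eq_integral_toReal_smul
    (by fun_prop) (ae_of_all _ fun _ => ENNReal.ofReal_lt_top)]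
  refine integral_congr_ae (ae_of_all _ fun z => ?_)
  simp only [smul_eq_mul]
  rw [ENNReal.toReal_ofReal (by positivity)]

/-- The density never exceeds `1/(πv)`, so an integrable function has mean `O(1/v)`. The bound on
the coherences rests on this. -/
theorem integral_complexGaussian_le {v : ℝ} (hv : 0 < v) {F : ℂ → ℝ} (h0 : ∀ z, 0 ≤ F z)
    (hF : Integrable F) :
    ∫ z, F z ∂complexGaussian v ≤ (Real.pi * v)⁻¹ * ∫ z, F z := by
  rw [integral_complexGaussian hv, ← integral_const_mul]
  refine integral_mono_of_nonneg (ae_of_all _ fun z => ?_) (hF.const_mul _)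
    (ae_of_all _ fun z => ?_)
  · have := h0 z
    simp only [Pi.zero_apply]
    positivity
  · have h1 : Real.exp (-‖z‖ ^ 2 / v) ≤ 1 := by
      rw [Real.exp_le_one_iff]
      exact div_nonpos_of_nonpos_of_nonneg (by nlinarith [sq_nonneg ‖z‖]) hv.le
    have h2 : (0 : ℝ) ≤ (Real.pi * v)⁻¹ := by positivity
    have := h0 z
    show _ * _ * _ ≤ _ * _
    calc (Real.pi * v)⁻¹ * Real.exp (-‖z‖ ^ 2 / v) * F z ≤ (Real.pi * v)⁻¹ * 1 * F z := by gcongr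
      _ = _ := by ring

/-! ### The uniform law of the angles -/

instance isProbabilityMeasure_uniformAngle : IsProbabilityMeasure uniformAngle := by
  refine cond_isProbabilityMeasure_of_finite ?_ ?_
  · simp [Real.pi_pos]
  · rw [Real.volume_Ico]; exact ENNReal.ofReal_ne_top

theorem integral_uniformAngle (F : ℝ → ℂ) :
    ∫ t, F t ∂uniformAngle = ((2 * Real.pi)⁻¹ : ℝ) * ∫ t in (0 : ℝ)..(2 * Real.pi), F t := by
  rw [uniformAngle, ProbabilityTheory.cond, integral_smul_measure,
    intervalIntegral.integral_of_le (by positivity), integral_Ico_eq_integral_Ioc]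
  simp only [Real.volume_Ico, sub_zero, ENNReal.toReal_inv]
  rw [ENNReal.toReal_ofReal (by positivity), Complex.real_smul]

theorem integral_uniformAngle_cexp {k : ℤ} (hk : k ≠ 0) :
    ∫ t : ℝ, Complex.exp (k * Complex.I * t) ∂uniformAngle = 0 := by
  have hk' : (k * Complex.I : ℂ) ≠ 0 := by simp [hk]
  rw [integral_uniformAngle, integral_exp_mul_complex hk']
  have : Complex.exp (k * Complex.I * ((2 * Real.pi : ℝ) : ℂ)) = 1 := by
    rw [← Complex.exp_int_mul_two_pi_mul_I k]
    congr 1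
    push_cast
    ring
  rw [this]
  simp

theorem integrable_uniformAngle {F : ℝ → ℂ} (hF : Continuous F) : Integrable F uniformAngle := by
  have h : IntegrableOn F (Set.Ico 0 (2 * Real.pi)) volume :=
    (hF.continuousOn.integrableOn_Icc (a := 0) (b := 2 * Real.pi)).mono_set Set.Ico_subset_Icc_self
  exact Integrable.smul_measure h (by simp [Real.pi_pos])

/-! ### Coherent states in the number basis -/

theorem coherent_apply (α : ℂ) (n : ℕ) :
    coherent α n = (Real.exp (-‖α‖ ^ 2 / 2) : ℂ) * (α ^ n / (Real.sqrt n.factorial : ℂ)) := by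
  have hs : (Real.sqrt n.factorial : ℂ) ≠ 0 := by
    have : Real.sqrt (n.factorial : ℝ) ≠ 0 := by positivity
    exact_mod_cast this
  have hq : (Real.sqrt n.factorial : ℂ) * (Real.sqrt n.factorial : ℂ) = n.factorial := by
    rw [← Complex.ofReal_mul, Real.mul_self_sqrt (by positivity)]; push_cast; rfl
  have hf : (n.factorial : ℂ) ≠ 0 := by exact_mod_cast n.factorial_ne_zero
  rw [coherent, displacement, tsum_eq_single 0]
  · simp only [displacementEntry, vacuum, fockKet, expAnnihilate, expCreate]
    simp
    field_simp
    rw [pow_two, hq]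
  · intro k hk
    simp [vacuum, fockKet, hk]

theorem sqrt_factorial_ne_zero (n : ℕ) : (Real.sqrt n.factorial : ℂ) ≠ 0 := by
  have : Real.sqrt (n.factorial : ℝ) ≠ 0 := by positivity
  exact_mod_cast this

theorem sqrt_factorial_mul_self (n : ℕ) :
    (Real.sqrt n.factorial : ℂ) * (Real.sqrt n.factorial : ℂ) = n.factorial := by
  rw [← Complex.ofReal_mul, Real.mul_self_sqrt (by positivity)]; push_cast; rfl

theorem summable_pow_div_sqrt_factorial (r : ℝ) (hr : 0 ≤ r) :
    Summable (fun n : ℕ => r ^ n / Real.sqrt n.factorial) := by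
  refine Summable.of_nonneg_of_le (fun n => by positivity) (fun n => ?_)
    ((summable_geometric_of_lt_one (r := (1 / 2 : ℝ)) (by norm_num) (by norm_num)).mul_left
      (Real.exp (2 * r ^ 2)))
  -- The factor 4 produces `4 ^ n`, whose square root is the geometric gain `2 ^ n`.
  have h := Real.pow_div_factorial_le_exp (4 * r ^ 2) (by positivity) n
  have h2 : r ^ n / Real.sqrt n.factorial * 2 ^ n ≤ Real.exp (2 * r ^ 2) := by
    refine abs_le_of_sq_le_sq' ?_ (by positivity) |>.2
    rw [mul_pow, div_pow, Real.sq_sqrt (by positivity), ← Real.exp_nat_mul]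
    refine le_trans (le_of_eq ?_) (h.trans (le_of_eq ?_))
    · rw [mul_pow, ← pow_mul, ← pow_mul, ← pow_mul, show (4 : ℝ) = 2 ^ 2 by norm_num, ← pow_mul,
        mul_comm n 2]
      ring
    · congr 1; push_cast; ring
  rw [one_div, inv_pow, ← div_eq_mul_inv]
  rwa [le_div_iff₀ (by positivity)]

/-- `∑ n, ⟨n| exp(z m†) |j⟩ αⁿ / √n!`. -/
theorem hasSum_expCreate_mul (z α : ℂ) (j : ℕ) :
    HasSum (fun n => expCreate z n j * (α ^ n / (Real.sqrt n.factorial : ℂ)))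
      (α ^ j / (Real.sqrt j.factorial : ℂ) * Complex.exp (z * α)) := by
  have h := NormedSpace.expSeries_div_hasSum_exp (z * α)
  rw [← Complex.exp_eq_exp_ℂ] at h
  have h2 := h.mul_left (α ^ j / (Real.sqrt j.factorial : ℂ))
  have h3 : HasSum (fun n => expCreate z (n + j) j *
      (α ^ (n + j) / (Real.sqrt (n + j).factorial : ℂ)))
      (α ^ j / (Real.sqrt j.factorial : ℂ) * Complex.exp (z * α)) := by
    refine h2.congr_fun fun n => ?_
    have hs := sqrt_factorial_ne_zero (n + j)
    have hj := sqrt_factorial_ne_zero j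
    have hf : (n.factorial : ℂ) ≠ 0 := by exact_mod_cast n.factorial_ne_zero
    have e : j ≤ n + j := by omega
    simp only [expCreate, e, if_true, Nat.add_sub_cancel]
    push_cast
    field_simp
    ring
  rw [← hasSum_nat_add_iff' j]
  have : ∑ i ∈ Finset.range j, expCreate z i j * (α ^ i / (Real.sqrt i.factorial : ℂ)) = 0 := by
    refine Finset.sum_eq_zero fun i hi => ?_
    have : ¬ j ≤ i := by have := Finset.mem_range.1 hi; omega
    simp [expCreate, this]
  rwa [this, sub_zero]

theorem sum_expCreate_mul (z α : ℂ) (m : ℕ) :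
    ∑ j ∈ Finset.range (m + 1), expCreate z m j * (α ^ j / (Real.sqrt j.factorial : ℂ))
      = (α + z) ^ m / (Real.sqrt m.factorial : ℂ) := by
  rw [add_pow, Finset.sum_div]
  refine Finset.sum_congr rfl fun j hj => ?_
  have hjm : j ≤ m := by have := Finset.mem_range.1 hj; omega
  have hs := sqrt_factorial_ne_zero m
  have hj := sqrt_factorial_ne_zero j
  have qm := sqrt_factorial_mul_self m
  have qj := sqrt_factorial_mul_self j
  have hc : ((m.choose j : ℕ) : ℂ) * (j.factorial : ℂ) * ((m - j).factorial : ℂ) = m.factorial := by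
    exact_mod_cast Nat.choose_mul_factorial_mul_factorial hjm
  have hf : ((m - j).factorial : ℂ) ≠ 0 := by exact_mod_cast (m - j).factorial_ne_zero
  simp only [expCreate, hjm, if_true]
  push_cast
  field_simp
  rw [pow_two, pow_two, qm, qj, ← hc]
  ring

/-- The matrix element `⟨m| exp(b m†) exp(c m) |n⟩`. -/
def normalOrdered (b c : ℂ) (m n : ℕ) : ℂ :=
  ∑ j ∈ Finset.range (m + 1), expCreate b m j * expCreate c n j

theorem normalOrdered_comm (b c : ℂ) (m n : ℕ) : normalOrdered b c m n = normalOrdered c b n m := by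
  have key : ∀ (b c : ℂ) (m n : ℕ), normalOrdered b c m n
      = ∑ j ∈ Finset.range (m + n + 1), expCreate b m j * expCreate c n j := fun b c m n => by
    refine Finset.sum_subset (fun j hj => ?_) fun j _ hj => ?_
    · simp only [Finset.mem_range] at hj ⊢; omega
    · have : ¬ j ≤ m := by simp only [Finset.mem_range] at hj; omega
      simp [expCreate, this]
  rw [key, key, add_comm m n]
  exact Finset.sum_congr rfl fun j _ => mul_comm _ _

theorem displacementEntry_eq (β : ℂ) (m n : ℕ) :
    displacementEntry β m n
      = (Real.exp (-‖β‖ ^ 2 / 2) : ℂ) * normalOrdered β (-conj β) m n := by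
  rw [normalOrdered_comm, displacementEntry, normalOrdered]
  congr 1
  exact Finset.sum_congr rfl fun j _ => mul_comm _ _

theorem conj_expCreate (z : ℂ) (m j : ℕ) : conj (expCreate z m j) = expCreate (conj z) m j := by
  unfold expCreate
  split_ifs <;> simp

theorem conj_displacementEntry (β : ℂ) (m n : ℕ) :
    conj (displacementEntry β m n) = displacementEntry (-β) n m := by
  rw [displacementEntry_eq, displacementEntry_eq, normalOrdered_comm (-β), map_mul,
    Complex.conj_ofReal, norm_neg, normalOrdered, normalOrdered, map_sum]
  simp [conj_expCreate]

/-- A coherent vector is an eigenvector of `exp(c m)` with eigenvalue `exp(c α)`, and `exp(b m†)`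
shifts its parameter by `b` through the binomial theorem. -/
theorem hasSum_normalOrdered_mul (b c α : ℂ) (m : ℕ) :
    HasSum (fun n => normalOrdered b c m n * (α ^ n / (Real.sqrt n.factorial : ℂ)))
      ((α + b) ^ m / (Real.sqrt m.factorial : ℂ) * Complex.exp (c * α)) := by
  have h := hasSum_sum (s := Finset.range (m + 1)) fun j _ =>
    (hasSum_expCreate_mul c α j).mul_left (expCreate b m j)
  simp_rw [← mul_assoc] at h
  rw [← Finset.sum_mul, sum_expCreate_mul] at h
  simpa only [normalOrdered, Finset.sum_mul] using h

theorem norm_expCreate (z : ℂ) (m j : ℕ) : (‖expCreate z m j‖ : ℂ) = expCreate (‖z‖ : ℂ) m j := by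
  unfold expCreate
  split_ifs
  · simp only [norm_mul, norm_div, norm_pow, Complex.norm_natCast, Complex.norm_real]
    rw [Real.norm_of_nonneg (Real.sqrt_nonneg _), Real.norm_of_nonneg (Real.sqrt_nonneg _)]
    push_cast
    rfl
  · simp

/-- Replacing the parameters by their moduli gives a majorant of the same form, so the generating
function above also sums absolute values. This justifies the interchange of series for displaced
targets. -/
theorem norm_normalOrdered_le (b c : ℂ) (m n : ℕ) :
    ‖normalOrdered b c m n‖ ≤ (normalOrdered (‖b‖ : ℂ) (‖c‖ : ℂ) m n).re := by
  have : normalOrdered (‖b‖ : ℂ) (‖c‖ : ℂ) m n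
      = ((∑ j ∈ Finset.range (m + 1), ‖expCreate b m j‖ * ‖expCreate c n j‖ : ℝ) : ℂ) := by
    push_cast
    simp only [normalOrdered, norm_expCreate]
  rw [this, Complex.ofReal_re, normalOrdered]
  refine (norm_sum_le _ _).trans (le_of_eq ?_)
  simp

theorem hasSum_norm_normalOrdered (b c : ℂ) (r : ℝ) (m : ℕ) :
    HasSum (fun n => (normalOrdered (‖b‖ : ℂ) (‖c‖ : ℂ) m n).re * (r ^ n / Real.sqrt n.factorial))
      ((r + ‖b‖) ^ m / Real.sqrt m.factorial * Real.exp (‖c‖ * r)) := by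
  have h := Complex.hasSum_re (hasSum_normalOrdered_mul (‖b‖ : ℂ) (‖c‖ : ℂ) (r : ℂ) m)
  have e1 : ∀ n, (normalOrdered (‖b‖ : ℂ) (‖c‖ : ℂ) m n * ((r : ℂ) ^ n / (Real.sqrt n.factorial : ℂ))).re
      = (normalOrdered (‖b‖ : ℂ) (‖c‖ : ℂ) m n).re * (r ^ n / Real.sqrt n.factorial) := fun n => by
    rw [← Complex.ofReal_pow, ← Complex.ofReal_div, Complex.re_mul_ofReal]
  have e2 : (((r : ℂ) + ‖b‖) ^ m / (Real.sqrt m.factorial : ℂ) * Complex.exp (‖c‖ * r)).re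
      = (r + ‖b‖) ^ m / Real.sqrt m.factorial * Real.exp (‖c‖ * r) := by
    rw [← Complex.ofReal_add, ← Complex.ofReal_pow, ← Complex.ofReal_div, ← Complex.ofReal_mul,
      ← Complex.ofReal_exp, ← Complex.ofReal_mul, Complex.ofReal_re]
  simpa only [e1, e2] using h

/-- `D(β)|α⟩ = exp(i Im(β α*)) |α + β⟩`. -/
theorem hasSum_displacementEntry_coherent (α β : ℂ) (m : ℕ) :
    HasSum (fun n => displacementEntry β m n * coherent α n)
      (Complex.exp (Complex.I * (β * conj α).im) * coherent (α + β) m) := by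
  have h := (hasSum_normalOrdered_mul β (-conj β) α m).mul_left
    ((Real.exp (-‖β‖ ^ 2 / 2) : ℂ) * (Real.exp (-‖α‖ ^ 2 / 2) : ℂ))
  convert! h using 1
  · funext n
    rw [displacementEntry_eq, coherent_apply]
    ring
  · have e : Complex.exp (Complex.I * (β * conj α).im) * (Real.exp (-‖α + β‖ ^ 2 / 2) : ℂ)
        = (Real.exp (-‖β‖ ^ 2 / 2) : ℂ) * (Real.exp (-‖α‖ ^ 2 / 2) : ℂ)
          * Complex.exp (-conj β * α) := by
      push_cast
      rw [← Complex.exp_add, ← Complex.exp_add, ← Complex.exp_add]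
      congr 1
      have hn : ∀ z : ℂ, ((‖z‖ : ℝ) : ℂ) ^ 2 = z * conj z := fun z => (Complex.mul_conj' z).symm
      have him : ((β * conj α).im : ℂ) = (β * conj α - conj β * α) / (2 * Complex.I) := by
        rw [Complex.im_eq_sub_conj]; simp
      rw [hn, hn, hn, him, map_add]
      field_simp
      ring
    rw [coherent_apply, ← mul_assoc, e]
    ring

theorem displacement_coherent (α β : ℂ) :
    displacement β (coherent α)
      = fun m => Complex.exp (Complex.I * (β * conj α).im) * coherent (α + β) m :=
  funext fun m => (hasSum_displacementEntry_coherent α β m).tsum_eq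

theorem coherent_zero : coherent 0 = vacuum := by
  funext n
  rw [coherent_apply]
  rcases n with _ | n <;> simp [vacuum, fockKet]

/-! ### Finite superpositions of coherent states -/

/-- The finite superpositions of coherent states. -/
def coherentSpan : Submodule ℂ Ket := Submodule.span ℂ (Set.range coherent)

theorem coherent_mem (α : ℂ) : coherent α ∈ coherentSpan := Submodule.subset_span ⟨α, rfl⟩

/-- Amplitudes are bare sequences, so linearity of the operators needs convergence. The span of the
coherent states contains every state of the circuit, and identities on it reduce to coherent states,
where all sums are explicit. -/
theorem summable_displacementEntry_mul {v : Ket} (hv : v ∈ coherentSpan) (β : ℂ) (m : ℕ) :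
    Summable (fun n => displacementEntry β m n * v n) := by
  induction hv using Submodule.span_induction with
  | mem v h => obtain ⟨α, rfl⟩ := h; exact (hasSum_displacementEntry_coherent α β m).summable
  | zero => simp
  | add u v _ _ hu hv => simpa [mul_add] using hu.add hv
  | smul c v _ hv => simpa [mul_left_comm] using hv.mul_left c

theorem displacement_add {u v : Ket} (hu : u ∈ coherentSpan) (hv : v ∈ coherentSpan) (β : ℂ) :
    displacement β (u + v) = displacement β u + displacement β v := by
  funext m
  simp only [displacement, Pi.add_apply, mul_add]
  exact (summable_displacementEntry_mul hu β m).tsum_add (summable_displacementEntry_mul hv β m)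

theorem displacement_smul (c : ℂ) (v : Ket) (β : ℂ) :
    displacement β (c • v) = c • displacement β v := by
  funext m
  simp only [displacement, Pi.smul_apply, smul_eq_mul, mul_left_comm _ c, tsum_mul_left]

theorem displacement_zero_right (β : ℂ) : displacement β 0 = 0 := by
  funext m
  simp [displacement]

theorem displacement_coherent_eq (α β : ℂ) :
    displacement β (coherent α)
      = Complex.exp (Complex.I * (β * conj α).im) • coherent (α + β) :=
  displacement_coherent α β

theorem displacement_mem {v : Ket} (hv : v ∈ coherentSpan) (β : ℂ) :
    displacement β v ∈ coherentSpan := by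
  induction hv using Submodule.span_induction with
  | mem v h =>
    obtain ⟨α, rfl⟩ := h
    rw [displacement_coherent_eq]
    exact Submodule.smul_mem _ _ (coherent_mem _)
  | zero => rw [displacement_zero_right]; exact Submodule.zero_mem _
  | add u v hu hv h1 h2 => rw [displacement_add hu hv]; exact Submodule.add_mem _ h1 h2
  | smul c v _ hv => rw [displacement_smul]; exact Submodule.smul_mem _ _ hv

/-- `D(g) D(β) = exp(i Im(g β*)) D(g + β)`. -/
theorem displacement_displacement {v : Ket} (hv : v ∈ coherentSpan) (g β : ℂ) :
    displacement g (displacement β v)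
      = Complex.exp (Complex.I * (g * conj β).im) • displacement (g + β) v := by
  induction hv using Submodule.span_induction with
  | mem v h =>
    obtain ⟨α, rfl⟩ := h
    rw [displacement_coherent_eq, displacement_smul, displacement_coherent_eq,
      displacement_coherent_eq, smul_smul, smul_smul, ← Complex.exp_add, ← Complex.exp_add]
    congr 1
    · congr 1
      rw [← mul_add, ← mul_add]
      congr 1
      norm_cast
      simp
      ring
    · congr 1; ring
  | zero => simp [displacement_zero_right]
  | add u v hu hv h1 h2 =>
    rw [displacement_add hu hv, displacement_add (displacement_mem hu β) (displacement_mem hv β),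
      displacement_add hu hv, h1, h2, smul_add]
  | smul c v _ hv => rw [displacement_smul, displacement_smul, displacement_smul, hv, smul_comm]

/-! ### The overlaps of the targets with the coherent states -/

/-- The overlap `⟨ψ|α⟩` of the target with the coherent state `|α⟩`. -/
def overlap : Target → ℂ → ℂ
  | .gaussian γ τ ζ, α =>
      Complex.exp (Complex.I * (-γ * conj α).im) * ((Real.exp (-‖α - γ‖ ^ 2 / 2) : ℂ) *
        (Complex.exp (-(Real.tanh ζ / 2) * Complex.exp (2 * Complex.I * τ) * (α - γ) ^ 2)
          / (Real.sqrt (Real.cosh ζ) : ℂ)))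
  | .fock n, α => (Real.exp (-‖α‖ ^ 2 / 2) : ℂ) * (α ^ n / (Real.sqrt n.factorial : ℂ))

theorem abs_tanh_lt_one (x : ℝ) : |Real.tanh x| < 1 :=
  abs_lt.2 ⟨Real.neg_one_lt_tanh x, Real.tanh_lt_one x⟩

/-- A crude bound suffices for `hasSum_conj_displacement_mul_coherent`. The inequality `(2j)! ≤ (2^j
j!)²` is the bound `4^j` on the central binomial coefficient. -/
theorem norm_squeezedVacuum_le (ζ : ℝ) (n : ℕ) : ‖squeezedVacuum ζ n‖ ≤ 1 := by
  rcases Nat.even_or_odd n with h | h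
  · obtain ⟨j, rfl⟩ := h.two_dvd
    rw [squeezedVacuum_two_mul, Complex.norm_real, norm_mul, norm_div, norm_pow, norm_neg]
    have h1 : ‖Real.tanh ζ‖ ^ j ≤ 1 := pow_le_one₀ (norm_nonneg _) (abs_tanh_lt_one ζ).le
    have h2 : 1 ≤ Real.sqrt (Real.cosh ζ) := Real.one_le_sqrt.2 (Real.one_le_cosh ζ)
    have h3 : Real.sqrt (2 * j).factorial ≤ 2 ^ j * j.factorial := by
      refine Real.sqrt_le_iff.2 ⟨by positivity, ?_⟩
      have h4 : (2 * j).factorial ≤ (2 ^ j * j.factorial) ^ 2 := by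
        have e : (2 * j).factorial = j.centralBinom * (j.factorial * j.factorial) := by
          have := Nat.choose_mul_factorial_mul_factorial (show j ≤ 2 * j by omega)
          rw [show 2 * j - j = j by omega] at this
          rw [← this, Nat.centralBinom]
          ring
        have h5 : j.centralBinom ≤ 4 ^ j := by
          have := Nat.choose_le_two_pow (2 * j) j
          rwa [pow_mul] at this
        rw [e]
        calc _ ≤ 4 ^ j * (j.factorial * j.factorial) := Nat.mul_le_mul_right _ h5
          _ = _ := by rw [show 4 = 2 ^ 2 by norm_num, ← pow_mul]; ring
      exact_mod_cast h4
    have h6 : ‖Real.sqrt (2 * j).factorial / (2 ^ j * j.factorial)‖ ≤ 1 := by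
      rw [Real.norm_of_nonneg (by positivity)]
      exact div_le_one_of_le₀ h3 (by positivity)
    rw [Real.norm_of_nonneg (Real.sqrt_nonneg _)]
    refine mul_le_one₀ (div_le_one_of_le₀ (h1.trans h2) (by positivity)) (norm_nonneg _) h6
  · simp [squeezedVacuum, Nat.not_even_iff_odd.2 h]

theorem norm_phaseRotation (τ : ℝ) (v : Ket) (n : ℕ) : ‖phaseRotation τ v n‖ = ‖v n‖ := by
  have : -Complex.I * τ * n = ((-(τ * n) : ℝ) : ℂ) * Complex.I := by push_cast; ring
  rw [phaseRotation, norm_mul, this, Complex.norm_exp_ofReal_mul_I, one_mul]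

/-- Only even amplitudes survive; the square roots of `(2j)!` cancel and an exponential series in
`w²` remains. -/
theorem hasSum_phaseRotation_squeezedVacuum (τ ζ : ℝ) (w : ℂ) :
    HasSum (fun n => conj (phaseRotation τ (squeezedVacuum ζ) n) * coherent w n)
      ((Real.exp (-‖w‖ ^ 2 / 2) : ℂ) *
        (Complex.exp (-(Real.tanh ζ / 2) * Complex.exp (2 * Complex.I * τ) * w ^ 2)
          / (Real.sqrt (Real.cosh ζ) : ℂ))) := by
  have hinj : Function.Injective (fun j : ℕ => 2 * j) := fun a b h => by
    simp only at h; omega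
  rw [← hinj.hasSum_iff]
  · have h := NormedSpace.expSeries_div_hasSum_exp
      (-(Real.tanh ζ / 2) * Complex.exp (2 * Complex.I * τ) * w ^ 2)
    rw [← Complex.exp_eq_exp_ℂ] at h
    have h2 := h.mul_left ((Real.exp (-‖w‖ ^ 2 / 2) : ℂ) / (Real.sqrt (Real.cosh ζ) : ℂ))
    convert! h2 using 1
    · funext j
      have hs := sqrt_factorial_ne_zero (2 * j)
      have hf : (j.factorial : ℂ) ≠ 0 := by exact_mod_cast j.factorial_ne_zero
      have hc : (Real.sqrt (Real.cosh ζ) : ℂ) ≠ 0 := by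
        have : Real.sqrt (Real.cosh ζ) ≠ 0 := (Real.sqrt_pos.2 (Real.cosh_pos ζ)).ne'
        exact_mod_cast this
      have he : conj (Complex.exp (-Complex.I * τ * ((2 * j : ℕ) : ℂ)))
          = Complex.exp (2 * Complex.I * τ) ^ j := by
        rw [← Complex.exp_conj, ← Complex.exp_nat_mul]
        congr 1
        have h2 : conj (2 : ℂ) = 2 := map_ofNat _ 2
        simp [h2]
        ring
      simp only [Function.comp, phaseRotation, squeezedVacuum_two_mul, coherent_apply, map_mul, he,
        Complex.conj_ofReal]
      push_cast
      have e2 : (-((Complex.tanh ζ : ℂ) / 2) * Complex.exp (2 * Complex.I * τ) * w ^ 2) ^ j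
          = (-Complex.tanh ζ) ^ j * Complex.exp (2 * Complex.I * τ) ^ j * w ^ (2 * j) / 2 ^ j := by
        rw [pow_mul w, ← mul_pow, ← mul_pow, ← div_pow]
        congr 1
        ring
      rw [e2]
      field_simp
    · ring
  · intro n hn
    have : ¬ Even n := fun h => hn (by obtain ⟨j, rfl⟩ := h.two_dvd; exact ⟨j, rfl⟩)
    simp [phaseRotation, squeezedVacuum, this]

/-- A displaced vector with bounded amplitudes, paired with a coherent state. -/
theorem hasSum_conj_displacement_mul_coherent {χ : Ket} (hχ : ∀ n, ‖χ n‖ ≤ 1) (γ α s : ℂ)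
    (hs : HasSum (fun n => conj (χ n) * coherent (α - γ) n) s) :
    HasSum (fun m => conj (displacement γ χ m) * coherent α m)
      (Complex.exp (Complex.I * (-γ * conj α).im) * s) := by
  -- An absolutely convergent double series summed in both orders. Summing over the second index
  -- first lets `D(-γ)` act on the coherent state; the other order lets its adjoint `D(γ)` act on
  -- `χ`.
  set F : ℕ × ℕ → ℂ := fun p => conj (χ p.1) * (displacementEntry (-γ) p.1 p.2 * coherent α p.2)
  have hcoh : ∀ n, ‖coherent α n‖ ≤ ‖α‖ ^ n / Real.sqrt n.factorial := fun n => by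
    rw [coherent_apply, norm_mul, norm_div, norm_pow, Complex.norm_real, Complex.norm_real,
      Real.norm_of_nonneg (Real.exp_nonneg _), Real.norm_of_nonneg (Real.sqrt_nonneg _)]
    refine mul_le_of_le_one_left (by positivity) ?_
    rw [Real.exp_le_one_iff]
    nlinarith [sq_nonneg ‖α‖]
  have hD : ∀ m n, ‖displacementEntry (-γ) m n‖ ≤ (normalOrdered (‖γ‖ : ℂ) (‖γ‖ : ℂ) m n).re :=
    fun m n => by
      rw [displacementEntry_eq, norm_mul, Complex.norm_real, Real.norm_of_nonneg (Real.exp_nonneg _)]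
      have h1 : Real.exp (-‖-γ‖ ^ 2 / 2) ≤ 1 := by
        rw [Real.exp_le_one_iff]
        nlinarith [sq_nonneg ‖-γ‖]
      have h2 := norm_normalOrdered_le (-γ) (-conj (-γ)) m n
      have e : ‖-conj (-γ)‖ = ‖γ‖ := by simp
      rw [e, norm_neg] at h2
      exact (mul_le_of_le_one_left (norm_nonneg _) h1).trans h2
  have hF : Summable F := by
    refine Summable.of_norm_bounded (g := fun p : ℕ × ℕ =>
      (normalOrdered (‖γ‖ : ℂ) (‖γ‖ : ℂ) p.1 p.2).re * (‖α‖ ^ p.2 / Real.sqrt p.2.factorial)) ?_ ?_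
    · rw [summable_prod_of_nonneg]
      · refine ⟨fun m => (hasSum_norm_normalOrdered γ γ ‖α‖ m).summable, ?_⟩
        simp_rw [fun m => (hasSum_norm_normalOrdered γ γ ‖α‖ m).tsum_eq]
        exact (summable_pow_div_sqrt_factorial _ (by positivity)).mul_right _
      · intro p
        have := (norm_nonneg _).trans (hD p.1 p.2)
        have h2 : 0 ≤ ‖α‖ ^ p.2 / Real.sqrt p.2.factorial := by positivity
        exact mul_nonneg this h2
    · intro p
      simp only [F, norm_mul, RCLike.norm_conj]
      calc ‖χ p.1‖ * (‖displacementEntry (-γ) p.1 p.2‖ * ‖coherent α p.2‖)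
          ≤ 1 * (‖displacementEntry (-γ) p.1 p.2‖ * ‖coherent α p.2‖) := by
            gcongr; exact hχ _
        _ ≤ _ := by
          rw [one_mul]
          exact mul_le_mul (hD _ _) (hcoh _) (norm_nonneg _) ((norm_nonneg _).trans (hD p.1 p.2))
  obtain ⟨S, hS⟩ := hF
  have h1 : HasSum (fun n => conj (χ n) * (Complex.exp (Complex.I * (-γ * conj α).im)
      * coherent (α + -γ) n)) S :=
    hS.prod_fiberwise fun n => (hasSum_displacementEntry_coherent α (-γ) n).mul_left _
  have hSs : S = Complex.exp (Complex.I * (-γ * conj α).im) * s := by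
    refine h1.unique ?_
    convert! hs.mul_left (Complex.exp (Complex.I * (-γ * conj α).im)) using 1
    funext n
    rw [← sub_eq_add_neg]
    ring
  rw [← hSs]
  have hS' : HasSum (F ∘ Prod.swap) S := (Equiv.prodComm ℕ ℕ).hasSum_iff.2 hS
  refine hS'.prod_fiberwise fun m => ?_
  have h3 : Summable fun n => (F ∘ Prod.swap) (m, n) := hS'.summable.prod_factor m
  have h4 : ∑' n, (F ∘ Prod.swap) (m, n) = conj (displacement γ χ m) * coherent α m := by
    rw [displacement, Complex.conj_tsum, ← tsum_mul_right]
    refine tsum_congr fun n => ?_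
    simp only [F, Function.comp, Prod.swap, map_mul, conj_displacementEntry]
    ring
  rw [← h4]
  exact h3.hasSum

theorem hasSum_overlap (T : Target) (α : ℂ) :
    HasSum (fun n => conj (T.ket n) * coherent α n) (overlap T α) := by
  cases T with
  | gaussian γ τ ζ =>
    refine hasSum_conj_displacement_mul_coherent (fun n => ?_) γ α _
      (hasSum_phaseRotation_squeezedVacuum τ ζ (α - γ))
    rw [norm_phaseRotation]
    exact norm_squeezedVacuum_le ζ n
  | fock n =>
    have h := hasSum_ite_eq n (coherent α n)
    rw [overlap, ← coherent_apply]
    convert! h using 1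
    funext m
    by_cases hm : m = n <;> simp [Target.ket, fockKet, hm]

theorem braket_coherent (T : Target) (α : ℂ) : braket T.ket (coherent α) = overlap T α :=
  (hasSum_overlap T α).tsum_eq

theorem summable_braket (T : Target) {v : Ket} (hv : v ∈ coherentSpan) :
    Summable (fun n => conj (T.ket n) * v n) := by
  induction hv using Submodule.span_induction with
  | mem v h => obtain ⟨α, rfl⟩ := h; exact (hasSum_overlap T α).summable
  | zero => simp
  | add u v _ _ hu hv => simpa [mul_add] using hu.add hv
  | smul c v _ hv => simpa [mul_left_comm] using hv.mul_left c

theorem braket_add (T : Target) {u v : Ket} (hu : u ∈ coherentSpan) (hv : v ∈ coherentSpan) :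
    braket T.ket (u + v) = braket T.ket u + braket T.ket v := by
  simp only [braket, Pi.add_apply, mul_add]
  exact (summable_braket T hu).tsum_add (summable_braket T hv)

theorem braket_smul (T : Target) (c : ℂ) (v : Ket) :
    braket T.ket (c • v) = c * braket T.ket v := by
  simp only [braket, Pi.smul_apply, smul_eq_mul, mul_left_comm _ c, tsum_mul_left]

/-! ### The circuit in amplitudes -/

/-- The matrix of the qubit rotation. -/
def rot (θ φ : ℝ) : Matrix (Fin 2) (Fin 2) ℂ :=
  !![(Real.cos (θ / 2) : ℂ), -Complex.I * Real.sin (θ / 2) * Complex.exp (-Complex.I * φ);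
    -Complex.I * Real.sin (θ / 2) * Complex.exp (Complex.I * φ), (Real.cos (θ / 2) : ℂ)]

theorem qubitRotation_eq (θ φ : ℝ) : qubitRotation θ φ = rot θ φ := by
  set e : ℂ := Complex.exp (Complex.I * φ) with he
  set e' : ℂ := Complex.exp (-Complex.I * φ) with he'
  have hee : e * e' = 1 := by
    rw [he, he', ← Complex.exp_add]; simp
  have hcos : (Real.cos φ : ℂ) = (e + e') / 2 := by
    rw [Complex.ofReal_cos, Complex.cos, he, he']
    ring_nf
  have hsin : (Real.sin φ : ℂ) = (e' - e) * Complex.I / 2 := by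
    rw [Complex.ofReal_sin, Complex.sin, he, he']
    ring_nf
  -- The columns `(1, ±e^{iφ})` are the eigenvectors of the generator, with eigenvalues `∓iθ/2`.
  set U : Matrix (Fin 2) (Fin 2) ℂ := !![1, 1; e, -e]
  set V : Matrix (Fin 2) (Fin 2) ℂ := !![1 / 2, e' / 2; 1 / 2, -e' / 2]
  have hUV : U * V = 1 := by
    ext i j
    fin_cases i <;> fin_cases j <;> simp [U, V, Matrix.mul_apply]
    · norm_num
    · ring
    · linear_combination hee
  have hUinv : U⁻¹ = V := Matrix.inv_eq_right_inv hUV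
  have hU : IsUnit U := IsUnit.of_mul_eq_one V hUV
  set d : Fin 2 → ℂ := ![-Complex.I * (θ / 2), Complex.I * (θ / 2)]
  have hdiag : ∀ u : Fin 2 → ℂ, Matrix.diagonal u = !![u 0, 0; 0, u 1] := fun u => by
    ext i j
    fin_cases i <;> fin_cases j <;> simp
  have hgen : (-Complex.I * (θ / 2 : ℂ)) • ((Real.cos φ : ℂ) • pauliX + (Real.sin φ : ℂ) • pauliY)
      = U * Matrix.diagonal d * U⁻¹ := by
    rw [hUinv, hcos, hsin, hdiag]
    have hI := Complex.I_mul_I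
    ext i j
    fin_cases i <;> fin_cases j <;>
      simp [U, V, d, Matrix.mul_apply, pauliX, pauliY]
    · linear_combination (Complex.I * θ * (e' - e) / 4) * hI
    · linear_combination (Complex.I * θ * (e - e') / 4) * hI
    · ring
  rw [qubitRotation, hgen, Matrix.exp_conj _ _ hU, Matrix.exp_diagonal, hUinv, hdiag]
  have hc : (Real.cos (θ / 2) : ℂ)
      = (Complex.exp (Complex.I * (θ / 2)) + Complex.exp (-Complex.I * (θ / 2))) / 2 := by
    rw [Complex.ofReal_cos, Complex.cos]
    push_cast
    ring_nf
  have hs : -Complex.I * (Real.sin (θ / 2) : ℂ)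
      = (Complex.exp (-Complex.I * (θ / 2)) - Complex.exp (Complex.I * (θ / 2))) / 2 := by
    rw [Complex.ofReal_sin, Complex.sin]
    push_cast
    ring_nf
    rw [Complex.I_sq]
    ring
  have hexp : ∀ i, NormedSpace.exp d i = Complex.exp (d i) := fun i => by
    rw [Pi.coe_exp, Complex.exp_eq_exp_ℂ]
  rw [rot, hs, hc, hexp, hexp, ← he, ← he']
  ext i j
  fin_cases i <;> fin_cases j <;>
    simp [U, V, Matrix.mul_apply, d]
  · ring
  · ring
  · ring
  · linear_combination ((Complex.exp (Complex.I * (θ / 2))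
      + Complex.exp (-(Complex.I * (θ / 2)))) / 2) * hee

theorem norm_rot_le (θ φ : ℝ) (a b : Fin 2) : ‖rot θ φ a b‖ ≤ 1 := by
  have h1 : ‖(Real.cos (θ / 2) : ℂ)‖ ≤ 1 := by
    rw [Complex.norm_real]; exact Real.abs_cos_le_one _
  have h2 : ‖(Real.sin (θ / 2) : ℂ)‖ ≤ 1 := by
    rw [Complex.norm_real]; exact Real.abs_sin_le_one _
  have h3 : ‖Complex.exp (-Complex.I * φ)‖ = 1 := by
    have : -Complex.I * φ = ((-φ : ℝ) : ℂ) * Complex.I := by push_cast; ring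
    rw [this, Complex.norm_exp_ofReal_mul_I]
  have h4 : ‖Complex.exp (Complex.I * φ)‖ = 1 := by
    rw [mul_comm, Complex.norm_exp_ofReal_mul_I]
  have h5 : ‖-Complex.I * (Real.sin (θ / 2) : ℂ) * Complex.exp (-Complex.I * φ)‖ ≤ 1 := by
    rw [norm_mul, norm_mul, h3]; simpa using h2
  have h6 : ‖-Complex.I * (Real.sin (θ / 2) : ℂ) * Complex.exp (Complex.I * φ)‖ ≤ 1 := by
    rw [norm_mul, norm_mul, h4]; simpa using h2
  fin_cases a <;> fin_cases b
  · exact h1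
  · exact h5
  · exact h6
  · exact h1

theorem continuous_rot (a b : Fin 2) : Continuous (fun p : ℝ × ℝ => rot p.1 p.2 a b) := by
  fin_cases a <;> fin_cases b <;> simp [rot] <;> fun_prop

/-- The parameters of all layers but the last. -/
def initParams {L : ℕ} (x : Params (L + 1)) : Params L :=
  (fun i => x.1 i.castSucc, fun i => x.2.1 i.castSucc, fun i => x.2.2 i.castSucc)

/-- The rotation of a pair of amplitudes. -/
def rotAmp (θ φ : ℝ) (q : Fin 2 → ℂ) (a : Fin 2) : ℂ := rot θ φ a 0 * q 0 + rot θ φ a 1 * q 1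

/-- The amplitudes `⟨ψ| D(g) |Ψ_a⟩` of the output state `Ψ` of a circuit, where `f α = ⟨ψ|α⟩`. -/
def amp (f : ℂ → ℂ) : (L : ℕ) → Params L → ℂ → Fin 2 → ℂ
  | 0, _, g => ![f g, 0]
  | L + 1, x, g =>
      ![Complex.exp (-(Complex.I * (g * conj (x.1 (Fin.last L))).im)) *
          rotAmp (x.2.1 (Fin.last L)) (x.2.2 (Fin.last L))
            (amp f L (initParams x) (g - x.1 (Fin.last L))) 1,
        Complex.exp (Complex.I * (g * conj (x.1 (Fin.last L))).im) *
          rotAmp (x.2.1 (Fin.last L)) (x.2.2 (Fin.last L))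
            (amp f L (initParams x) (g + x.1 (Fin.last L))) 0]

theorem applyQubit_eq (A : Matrix (Fin 2) (Fin 2) ℂ) (Ψ : QKet) (a : Fin 2) :
    applyQubit A Ψ a = A a 0 • Ψ 0 + A a 1 • Ψ 1 := by
  funext n
  simp [applyQubit]

theorem outputState_mem (L : ℕ) (β : Fin L → ℂ) (θ φ : Fin L → ℝ) (a : Fin 2) :
    outputState L β θ φ a ∈ coherentSpan := by
  induction L generalizing a with
  | zero =>
    fin_cases a
    · simp only [outputState, initialState]
      exact coherent_zero ▸ coherent_mem 0
    · exact Submodule.zero_mem _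
  | succ L ih =>
    have h : ∀ b, applyQubit (qubitRotation (θ (Fin.last L)) (φ (Fin.last L)))
        (outputState L (fun i => β i.castSucc) (fun i => θ i.castSucc) (fun i => φ i.castSucc)) b
          ∈ coherentSpan := fun b => by
      rw [applyQubit_eq]
      exact Submodule.add_mem _ (Submodule.smul_mem _ _ (ih _ _ _ _))
        (Submodule.smul_mem _ _ (ih _ _ _ _))
    fin_cases a
    · exact displacement_mem (h 1) _
    · exact displacement_mem (h 0) _

/-- The gate's displacement is absorbed into `D(g)` up to a phase. Carrying the free displacement
`g` is what makes the amplitudes satisfy a closed recursion. -/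
theorem braket_displacement_outputState (T : Target) (L : ℕ) (x : Params L) (g : ℂ) (a : Fin 2) :
    braket T.ket (displacement g (outputState L x.1 x.2.1 x.2.2 a))
      = amp (overlap T) L x g a := by
  induction L generalizing g a with
  | zero =>
    fin_cases a
    · exact braket_coherent T g
    · simp [outputState, initialState, displacement_zero_right, amp, braket]
  | succ L ih =>
    set Ψ := outputState L (fun i => x.1 i.castSucc) (fun i => x.2.1 i.castSucc)
      (fun i => x.2.2 i.castSucc) with hΨ
    set θ := x.2.1 (Fin.last L)
    set φ := x.2.2 (Fin.last L)
    have hm : ∀ b, Ψ b ∈ coherentSpan := fun b => outputState_mem _ _ _ _ _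
    have h : ∀ b, applyQubit (qubitRotation θ φ) Ψ b ∈ coherentSpan := fun b => by
      rw [applyQubit_eq]
      exact Submodule.add_mem _ (Submodule.smul_mem _ _ (hm 0)) (Submodule.smul_mem _ _ (hm 1))
    have hr : ∀ (z : ℂ) (b : Fin 2),
        braket T.ket (displacement z (applyQubit (qubitRotation θ φ) Ψ b))
          = rotAmp θ φ (amp (overlap T) L (initParams x) z) b := fun z b => by
      rw [applyQubit_eq, displacement_add (Submodule.smul_mem _ _ (hm 0))
        (Submodule.smul_mem _ _ (hm 1)), displacement_smul, displacement_smul,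
        braket_add T (Submodule.smul_mem _ _ (displacement_mem (hm 0) z))
          (Submodule.smul_mem _ _ (displacement_mem (hm 1) z)), braket_smul, braket_smul,
        qubitRotation_eq, rotAmp]
      exact congrArg₂ (· + ·) (congrArg _ (ih (initParams x) z 0))
        (congrArg _ (ih (initParams x) z 1))
    fin_cases a
    · change braket T.ket (displacement g (displacement (-x.1 (Fin.last L))
        (applyQubit (qubitRotation θ φ) Ψ 1))) = _
      have e : Complex.exp (Complex.I * (g * conj (-x.1 (Fin.last L))).im)
          = Complex.exp (-(Complex.I * (g * conj (x.1 (Fin.last L))).im)) := by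
        rw [map_neg, mul_neg, Complex.neg_im, Complex.ofReal_neg, mul_neg]
      rw [displacement_displacement (h 1), braket_smul, ← sub_eq_add_neg, hr, e]
      rfl
    · change braket T.ket (displacement g (displacement (x.1 (Fin.last L))
        (applyQubit (qubitRotation θ φ) Ψ 0))) = _
      rw [displacement_displacement (h 0), braket_smul, hr]
      rfl

theorem displacement_zero_left (v : Ket) : displacement 0 v = v := by
  funext m
  rw [displacement, tsum_eq_single m]
  · simp [displacementEntry_zero, fockKet]
  · intro n hn
    simp [displacementEntry_zero, fockKet, hn.symm]

theorem cost_eq (T : Target) {L : ℕ} (x : Params L) :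
    cost T x = ‖amp (overlap T) L x 0 0‖ ^ 2 := by
  rw [cost, ← braket_displacement_outputState, displacement_zero_left]

theorem continuous_rotAmp {X : Type*} [TopologicalSpace X] {θ φ : X → ℝ} {q : X → Fin 2 → ℂ}
    (hθ : Continuous θ) (hφ : Continuous φ) (hq : ∀ b, Continuous fun x => q x b) (a : Fin 2) :
    Continuous fun x => rotAmp (θ x) (φ x) (q x) a := by
  unfold rotAmp
  exact (((continuous_rot a 0).comp (hθ.prodMk hφ)).mul (hq 0)).add
    (((continuous_rot a 1).comp (hθ.prodMk hφ)).mul (hq 1))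

theorem continuous_initParams {L : ℕ} : Continuous (initParams (L := L)) := by
  unfold initParams
  fun_prop

theorem continuous_amp {f : ℂ → ℂ} (hf : Continuous f) (L : ℕ) (a : Fin 2) :
    Continuous fun p : Params L × ℂ => amp f L p.1 p.2 a := by
  induction L generalizing a with
  | zero =>
    fin_cases a
    · exact hf.comp continuous_snd
    · exact continuous_const
  | succ L ih =>
    have hm : ∀ b, Continuous fun p : Params (L + 1) × ℂ =>
        amp f L (initParams p.1) (p.2 - p.1.1 (Fin.last L)) b := fun b =>
      (ih b).comp ((continuous_initParams.comp continuous_fst).prodMk (by fun_prop))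
    have hp : ∀ b, Continuous fun p : Params (L + 1) × ℂ =>
        amp f L (initParams p.1) (p.2 + p.1.1 (Fin.last L)) b := fun b =>
      (ih b).comp ((continuous_initParams.comp continuous_fst).prodMk (by fun_prop))
    fin_cases a
    · simp only [amp]
      exact Continuous.mul (by fun_prop)
        (continuous_rotAmp (by fun_prop) (by fun_prop) hm 1)
    · simp only [amp]
      exact Continuous.mul (by fun_prop)
        (continuous_rotAmp (by fun_prop) (by fun_prop) hp 0)

theorem norm_rotAmp_le (θ φ : ℝ) {q : Fin 2 → ℂ} {B : ℝ} (hq : ∀ b, ‖q b‖ ≤ B) (a : Fin 2) :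
    ‖rotAmp θ φ q a‖ ≤ 2 * B := by
  have h : ∀ b, ‖rot θ φ a b * q b‖ ≤ B := fun b => by
    rw [norm_mul]
    exact (mul_le_of_le_one_left (norm_nonneg _) (norm_rot_le _ _ _ _)).trans (hq b)
  calc _ ≤ ‖rot θ φ a 0 * q 0‖ + ‖rot θ φ a 1 * q 1‖ := norm_add_le _ _
    _ ≤ B + B := add_le_add (h 0) (h 1)
    _ = _ := by ring

theorem norm_cexp_I_mul (r : ℝ) : ‖Complex.exp (Complex.I * r)‖ = 1 := by
  rw [mul_comm, Complex.norm_exp_ofReal_mul_I]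

theorem norm_cexp_neg_I_mul (r : ℝ) : ‖Complex.exp (-(Complex.I * r))‖ = 1 := by
  have : -(Complex.I * r) = Complex.I * ((-r : ℝ) : ℂ) := by push_cast; ring
  rw [this, norm_cexp_I_mul]

theorem norm_amp_le {f : ℂ → ℂ} {B : ℝ} (hf : ∀ z, ‖f z‖ ≤ B) (L : ℕ) (x : Params L) (g : ℂ)
    (a : Fin 2) : ‖amp f L x g a‖ ≤ 2 ^ L * B := by
  induction L generalizing g a with
  | zero =>
    have h0 : 0 ≤ B := (norm_nonneg _).trans (hf 0)
    fin_cases a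
    · simpa [amp] using hf g
    · simpa [amp] using h0
  | succ L ih =>
    rw [pow_succ', mul_assoc]
    fin_cases a
    · simp only [amp, Fin.zero_eta, Matrix.cons_val_zero]
      rw [norm_mul, norm_cexp_neg_I_mul, one_mul]
      exact norm_rotAmp_le _ _ (fun b => ih _ _ b) 1
    · simp only [amp, Fin.mk_one, Matrix.cons_val_one, Matrix.cons_val_zero]
      rw [norm_mul, norm_cexp_I_mul, one_mul]
      exact norm_rotAmp_le _ _ (fun b => ih _ _ b) 0

/-! ### The parameter-shift rule -/

/-- All `θ`-angles shifted. -/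
def shiftAngles (ε : ℕ → ℝ) {L : ℕ} (x : Params L) : Params L :=
  (x.1, fun i => x.2.1 i + ε i, x.2.2)

theorem initParams_shiftAngles (ε : ℕ → ℝ) {L : ℕ} (x : Params (L + 1)) :
    initParams (shiftAngles ε x) = shiftAngles ε (initParams x) := rfl

theorem continuous_shiftAngles (ε : ℕ → ℝ) {L : ℕ} :
    Continuous (shiftAngles ε (L := L)) := by
  unfold shiftAngles
  fun_prop

/-- The amplitude is linear in the rotation of layer `k`, whose entries are multiples of `cos(t/2)`
and `sin(t/2)`; the later layers act linearly and do not involve `t`. -/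
theorem exists_amp_update (f : ℂ → ℂ) (L : ℕ) (k : Fin L) (x : Params L) :
    ∃ A B : ℂ → Fin 2 → ℂ, ∀ (t : ℝ) (g : ℂ) (a : Fin 2),
      amp f L (x.1, Function.update x.2.1 k t, x.2.2) g a
        = (Real.cos (t / 2) : ℂ) * A g a + (Real.sin (t / 2) : ℂ) * B g a := by
  induction L with
  | zero => exact k.elim0
  | succ L ih =>
    induction k using Fin.lastCases with
    | last =>
      have hi : ∀ t : ℝ, initParams (x.1, Function.update x.2.1 (Fin.last L) t, x.2.2)
          = initParams x := fun t => by
        simp [initParams, Fin.castSucc_ne_last]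
      set β := x.1 (Fin.last L) with hβ
      set φ := x.2.2 (Fin.last L) with hφ
      set q := amp f L (initParams x) with hq
      refine ⟨fun g => ![Complex.exp (-(Complex.I * (g * conj β).im)) * q (g - β) 1,
          Complex.exp (Complex.I * (g * conj β).im) * q (g + β) 0],
        fun g => ![Complex.exp (-(Complex.I * (g * conj β).im)) *
            (-Complex.I * Complex.exp (Complex.I * φ) * q (g - β) 0),
          Complex.exp (Complex.I * (g * conj β).im) *
            (-Complex.I * Complex.exp (-Complex.I * φ) * q (g + β) 1)], fun t g a => ?_⟩
      fin_cases a
      · simp only [amp, hi, rotAmp, rot, Function.update_self, ← hβ, ← hφ, ← hq]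
        simp
        ring
      · simp only [amp, hi, rotAmp, rot, Function.update_self, ← hβ, ← hφ, ← hq]
        simp
        ring
    | cast k =>
      obtain ⟨A, B, h⟩ := ih k (initParams x)
      have hi : ∀ t : ℝ, initParams (x.1, Function.update x.2.1 k.castSucc t, x.2.2)
          = ((initParams x).1, Function.update (initParams x).2.1 k t, (initParams x).2.2) :=
        fun t => by
          have := Function.update_comp_eq_of_injective x.2.1 (Fin.castSucc_injective L) k t
          exact congrArg (fun u => ((fun i => x.1 i.castSucc, u, fun i => x.2.2 i.castSucc) : Params L)) this
      set β := x.1 (Fin.last L) with hβ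
      set φ := x.2.2 (Fin.last L) with hφ
      set θ := x.2.1 (Fin.last L) with hθ
      have hl : ∀ t : ℝ, Function.update x.2.1 k.castSucc t (Fin.last L) = θ := fun t =>
        Function.update_of_ne (Fin.castSucc_ne_last k).symm _ _
      refine ⟨fun g => ![Complex.exp (-(Complex.I * (g * conj β).im)) * rotAmp θ φ (A (g - β)) 1,
          Complex.exp (Complex.I * (g * conj β).im) * rotAmp θ φ (A (g + β)) 0],
        fun g => ![Complex.exp (-(Complex.I * (g * conj β).im)) * rotAmp θ φ (B (g - β)) 1,
          Complex.exp (Complex.I * (g * conj β).im) * rotAmp θ φ (B (g + β)) 0],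
        fun t g a => ?_⟩
      fin_cases a
      · simp only [amp, hi, rotAmp, hl, h, ← hβ, ← hφ]
        simp
        ring
      · simp only [amp, hi, rotAmp, hl, h, ← hβ, ← hφ]
        simp
        ring

/-- The squared modulus turns half angles into whole ones: a trigonometric polynomial of degree one,
exactly the class on which the shift rule by `±π/2` is an identity. -/
theorem exists_costAlong (T : Target) {L : ℕ} (k : Fin L) (x : Params L) :
    ∃ a b c : ℝ, ∀ t, costAlong T k x t = a + b * Real.cos t + c * Real.sin t := by
  obtain ⟨A, B, h⟩ := exists_amp_update (overlap T) L k x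
  refine ⟨(‖A 0 0‖ ^ 2 + ‖B 0 0‖ ^ 2) / 2, (‖A 0 0‖ ^ 2 - ‖B 0 0‖ ^ 2) / 2,
    (A 0 0 * conj (B 0 0)).re, fun t => ?_⟩
  have h1 : Real.cos t = 2 * Real.cos (t / 2) ^ 2 - 1 := by
    rw [← Real.cos_two_mul]; congr 1; ring
  have h2 : Real.sin t = 2 * Real.sin (t / 2) * Real.cos (t / 2) := by
    rw [← Real.sin_two_mul]; congr 1; ring
  have h3 := Real.sin_sq_add_cos_sq (t / 2)
  have h4 : Real.sin (t / 2) ^ 2 = 1 - Real.cos (t / 2) ^ 2 := by linarith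
  rw [costAlong, cost_eq, h, h1, h2, ← Complex.normSq_eq_norm_sq, ← Complex.normSq_eq_norm_sq,
    ← Complex.normSq_eq_norm_sq]
  simp only [Complex.normSq_apply, Complex.add_re, Complex.add_im, Complex.re_ofReal_mul,
    Complex.im_ofReal_mul, Complex.mul_re (A 0 0), Complex.conj_re, Complex.conj_im]
  linear_combination ((B 0 0).re ^ 2 + (B 0 0).im ^ 2) * h4

theorem hasDerivAt_costAlong (T : Target) {L : ℕ} (k : Fin L) (x : Params L) (t : ℝ) :
    HasDerivAt (costAlong T k x)
      ((costAlong T k x (t + Real.pi / 2) - costAlong T k x (t - Real.pi / 2)) / 2) t := by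
  obtain ⟨a, b, c, h⟩ := exists_costAlong T k x
  have e : costAlong T k x = fun t => a + b * Real.cos t + c * Real.sin t := funext h
  rw [e]
  refine ((((Real.hasDerivAt_cos t).const_mul b).const_add a).add
    ((Real.hasDerivAt_sin t).const_mul c)).congr_deriv ?_
  simp only [Real.cos_add_pi_div_two, Real.sin_add_pi_div_two, Real.cos_sub_pi_div_two,
    Real.sin_sub_pi_div_two]
  ring

theorem costAlong_add (T : Target) {L : ℕ} (k : Fin L) (x : Params L) (δ : ℝ) :
    costAlong T k x (x.2.1 k + δ) = cost T (shiftAngles (Pi.single (k : ℕ) δ) x) := by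
  have : Function.update x.2.1 k (x.2.1 k + δ)
      = fun i => x.2.1 i + (Pi.single (k : ℕ) δ : ℕ → ℝ) i := by
    funext i
    by_cases hi : i = k
    · subst hi; simp
    · have : (i : ℕ) ≠ k := fun h => hi (Fin.ext h)
      simp [hi, this]
  rw [costAlong, this]
  rfl

theorem gradient_eq (T : Target) {L : ℕ} (k : Fin L) (x : Params L) :
    gradient T k x = (cost T (shiftAngles (Pi.single (k : ℕ) (Real.pi / 2)) x)
      - cost T (shiftAngles (Pi.single (k : ℕ) (-(Real.pi / 2))) x)) / 2 := by
  rw [gradient, (hasDerivAt_costAlong T k x _).deriv, ← costAlong_add, ← costAlong_add,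
    sub_eq_add_neg (x.2.1 k)]

/-! ### Regularity of the overlaps -/

theorem integrable_exp_neg_mul_norm_sq {c : ℝ} (hc : 0 < c) :
    Integrable (fun z : ℂ => Real.exp (-(c * ‖z‖ ^ 2))) := by
  have h := (GaussianFourier.integrable_cexp_neg_mul_sq_norm_add (V := ℂ) (b := (c : ℂ))
    (by simpa using hc) 0 0).norm
  refine h.congr (ae_of_all _ fun z => ?_)
  simp only [zero_mul, add_zero, Complex.norm_exp]
  congr 1
  rw [← Complex.ofReal_pow, ← Complex.ofReal_neg, ← Complex.ofReal_mul, Complex.ofReal_re]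
  ring

theorem integral_exp_neg_mul_norm_sq {c : ℝ} (hc : 0 < c) :
    ∫ z : ℂ, Real.exp (-(c * ‖z‖ ^ 2)) = Real.pi / c := by
  have h := GaussianFourier.integral_rexp_neg_mul_sq_norm (V := ℂ) hc
  simp only [Complex.finrank_real_complex, neg_mul] at h
  rw [h]
  norm_num

/-- The functions `α ↦ ⟨ψ|α⟩` of the vectors `ψ` considered: an entire function times
`exp(-|α|²/2)`, with Gaussian decay. -/
structure IsOverlap (f : ℂ → ℂ) : Prop where
  exists_entire : ∃ h : ℂ → ℂ, Differentiable ℂ h ∧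
    ∀ z, f z = (Real.exp (-‖z‖ ^ 2 / 2) : ℂ) * h z
  exists_bound : ∃ (C c : ℝ) (w : ℂ), 0 < c ∧
    ∀ z, ‖f z‖ ≤ C * Real.exp (-(c * ‖z - w‖ ^ 2))

theorem IsOverlap.continuous {f : ℂ → ℂ} (hf : IsOverlap f) : Continuous f := by
  obtain ⟨h, hd, he⟩ := hf.exists_entire
  have := hd.continuous
  rw [funext he]
  fun_prop

theorem IsOverlap.exists_norm_le {f : ℂ → ℂ} (hf : IsOverlap f) : ∃ B, ∀ z, ‖f z‖ ≤ B := by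
  obtain ⟨C, c, w, hc, h⟩ := hf.exists_bound
  refine ⟨|C|, fun z => (h z).trans ?_⟩
  have h1 : Real.exp (-(c * ‖z - w‖ ^ 2)) ≤ 1 := by
    rw [Real.exp_le_one_iff]
    have : 0 ≤ c * ‖z - w‖ ^ 2 := by positivity
    linarith
  calc C * Real.exp (-(c * ‖z - w‖ ^ 2)) ≤ |C| * Real.exp (-(c * ‖z - w‖ ^ 2)) := by
        gcongr; exact le_abs_self C
    _ ≤ |C| * 1 := by gcongr
    _ = _ := mul_one _

theorem IsOverlap.integrable {f : ℂ → ℂ} (hf : IsOverlap f) : Integrable f := by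
  obtain ⟨C, c, w, hc, h⟩ := hf.exists_bound
  exact (((integrable_exp_neg_mul_norm_sq hc).comp_sub_right w).const_mul C).mono'
    hf.continuous.aestronglyMeasurable (ae_of_all _ h)

theorem overlap_gaussian_eq (γ : ℂ) (τ ζ : ℝ) (α : ℂ) :
    overlap (.gaussian γ τ ζ) α = (Real.exp (-‖α‖ ^ 2 / 2) : ℂ) *
      ((Real.exp (-‖γ‖ ^ 2 / 2) : ℂ) * Complex.exp (conj γ * α) *
        (Complex.exp (-(Real.tanh ζ / 2) * Complex.exp (2 * Complex.I * τ) * (α - γ) ^ 2)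
          / (Real.sqrt (Real.cosh ζ) : ℂ))) := by
  have e : Complex.exp (Complex.I * (-γ * conj α).im) * (Real.exp (-‖α - γ‖ ^ 2 / 2) : ℂ)
      = (Real.exp (-‖α‖ ^ 2 / 2) : ℂ) * ((Real.exp (-‖γ‖ ^ 2 / 2) : ℂ)
        * Complex.exp (conj γ * α)) := by
    push_cast
    rw [← Complex.exp_add, ← Complex.exp_add, ← Complex.exp_add]
    congr 1
    have hn : ∀ z : ℂ, ((‖z‖ : ℝ) : ℂ) ^ 2 = z * conj z := fun z => (Complex.mul_conj' z).symm
    have him : ((-γ * conj α).im : ℂ) = (-γ * conj α + conj γ * α) / (2 * Complex.I) := by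
      rw [Complex.im_eq_sub_conj]; simp
    rw [hn, hn, hn, him, map_sub]
    field_simp
    ring
  rw [overlap, ← mul_assoc, e]
  ring

theorem norm_overlap_gaussian (γ : ℂ) (τ ζ : ℝ) (α : ℂ) :
    ‖overlap (.gaussian γ τ ζ) α‖ = Real.exp (-‖α - γ‖ ^ 2 / 2) *
      (Real.exp (-(Real.tanh ζ / 2) * ((Complex.exp (Complex.I * τ) * (α - γ)) ^ 2).re)
        / Real.sqrt (Real.cosh ζ)) := by
  rw [overlap, norm_mul, norm_cexp_I_mul, one_mul, norm_mul, norm_div, Complex.norm_real,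
    Complex.norm_real, Real.norm_of_nonneg (Real.exp_nonneg _),
    Real.norm_of_nonneg (Real.sqrt_nonneg _), Complex.norm_exp]
  have : (-((Real.tanh ζ : ℂ) / 2) * Complex.exp (2 * Complex.I * τ) * (α - γ) ^ 2)
      = ((-(Real.tanh ζ / 2) : ℝ) : ℂ) * (Complex.exp (Complex.I * τ) * (α - γ)) ^ 2 := by
    rw [mul_pow, ← Complex.exp_nat_mul]
    push_cast
    ring_nf
  rw [this, Complex.re_ofReal_mul]

/-- Squeezing cannot destroy the decay because `|tanh ζ| < 1`: the quadratic exponent keeps the rate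
`(1 - |tanh ζ|)/2`. For Fock states the power `‖z‖ ^ n` is absorbed by giving up `1/8` of the rate
`1/2`, whence `3/8`. -/
theorem isOverlap_overlap (T : Target) : IsOverlap (overlap T) := by
  cases T with
  | gaussian γ τ ζ =>
    refine ⟨⟨_, ?_, overlap_gaussian_eq γ τ ζ⟩,
      ⟨1, (1 - |Real.tanh ζ|) / 2, γ, by linarith [abs_tanh_lt_one ζ], fun z => ?_⟩⟩
    · fun_prop
    · have h2 : 1 ≤ Real.sqrt (Real.cosh ζ) := Real.one_le_sqrt.2 (Real.one_le_cosh ζ)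
      have h3 : |((Complex.exp (Complex.I * τ) * (z - γ)) ^ 2).re| ≤ ‖z - γ‖ ^ 2 := by
        refine (Complex.abs_re_le_norm _).trans (le_of_eq ?_)
        rw [norm_pow, norm_mul, norm_cexp_I_mul, one_mul]
      rw [norm_overlap_gaussian, one_mul]
      calc _ ≤ Real.exp (-‖z - γ‖ ^ 2 / 2) *
            Real.exp (-(Real.tanh ζ / 2) * ((Complex.exp (Complex.I * τ) * (z - γ)) ^ 2).re) := by
            gcongr
            exact div_le_self (Real.exp_nonneg _) h2
        _ ≤ _ := by
            rw [← Real.exp_add]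
            gcongr
            have h4 := mul_le_mul_of_nonneg_left h3 (abs_nonneg (Real.tanh ζ))
            rw [← abs_mul] at h4
            have h5 := neg_abs_le (Real.tanh ζ * ((Complex.exp (Complex.I * τ) * (z - γ)) ^ 2).re)
            linarith
  | fock n =>
    refine ⟨⟨fun z => z ^ n / (Real.sqrt n.factorial : ℂ), by fun_prop, fun z => rfl⟩,
      ⟨2 ^ n, 3 / 8, 0, by norm_num, fun z => ?_⟩⟩
    have h := Real.pow_div_factorial_le_exp (‖z‖ ^ 2 / 4) (by positivity) n
    have h2 : ‖z‖ ^ n / Real.sqrt n.factorial ≤ 2 ^ n * Real.exp (‖z‖ ^ 2 / 8) := by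
      refine abs_le_of_sq_le_sq' ?_ (by positivity) |>.2
      rw [div_pow, Real.sq_sqrt (by positivity), mul_pow, ← Real.exp_nat_mul]
      have e : ((2 : ℕ) : ℝ) * (‖z‖ ^ 2 / 8) = ‖z‖ ^ 2 / 4 := by push_cast; ring
      rw [e]
      calc (‖z‖ ^ n) ^ 2 / n.factorial
          = (2 ^ n) ^ 2 * ((‖z‖ ^ 2 / 4) ^ n / n.factorial) := by
            rw [div_pow, ← pow_mul, ← pow_mul, ← pow_mul, show (4 : ℝ) = 2 ^ 2 by norm_num,
              ← pow_mul, mul_comm n 2]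
            field_simp
        _ ≤ _ := by gcongr
    rw [overlap, norm_mul, norm_div, norm_pow, Complex.norm_real, Complex.norm_real,
      Real.norm_of_nonneg (Real.exp_nonneg _), Real.norm_of_nonneg (Real.sqrt_nonneg _), sub_zero]
    calc _ ≤ Real.exp (-‖z‖ ^ 2 / 2) * (2 ^ n * Real.exp (‖z‖ ^ 2 / 8)) := by gcongr
      _ = 2 ^ n * (Real.exp (-‖z‖ ^ 2 / 2) * Real.exp (‖z‖ ^ 2 / 8)) := by ring
      _ = _ := by rw [← Real.exp_add]; congr 2; ring

/-! ### The closed form of the correlator -/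

theorem integral_exp_neg_sq_gaussianReal {v c : ℝ} (hv : 0 < v) (hc : 0 < c) (g : ℝ) :
    ∫ x, Real.exp (-(c * (x - g) ^ 2)) ∂gaussianReal 0 v.toNNReal
      = (Real.sqrt (1 + 2 * c * v))⁻¹ * Real.exp (-(c * g ^ 2 / (1 + 2 * c * v))) := by
  have hv' : v.toNNReal ≠ 0 := by rw [ne_eq, Real.toNNReal_eq_zero]; linarith
  have hD : 0 < 1 + 2 * c * v := by positivity
  rw [integral_gaussianReal_eq_integral_smul hv']
  simp only [gaussianPDFReal, Real.coe_toNNReal _ hv.le, smul_eq_mul, sub_zero]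
  -- Completing the square in `x`.
  have e : ∀ x : ℝ, (Real.sqrt (2 * Real.pi * v))⁻¹ * Real.exp (-x ^ 2 / (2 * v))
        * Real.exp (-(c * (x - g) ^ 2))
      = (Real.sqrt (2 * Real.pi * v))⁻¹ * Real.exp (-(c * g ^ 2 / (1 + 2 * c * v)))
        * Real.exp (-((1 + 2 * c * v) / (2 * v)) * (x - 2 * c * v * g / (1 + 2 * c * v)) ^ 2) :=
    fun x => by
      rw [mul_assoc _ (Real.exp _) (Real.exp _), mul_assoc _ (Real.exp _) (Real.exp _),
        ← Real.exp_add, ← Real.exp_add]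
      congr 2
      field_simp
      ring
  simp_rw [e]
  rw [integral_const_mul, integral_sub_right_eq_self (fun x => Real.exp
    (-((1 + 2 * c * v) / (2 * v)) * x ^ 2)), integral_gaussian]
  have e2 : Real.pi / ((1 + 2 * c * v) / (2 * v)) = (2 * Real.pi * v) / (1 + 2 * c * v) := by
    field_simp
  have hs : Real.sqrt (2 * Real.pi * v) ≠ 0 := by positivity
  have hs' : Real.sqrt (1 + 2 * c * v) ≠ 0 := by positivity
  rw [e2, Real.sqrt_div (by positivity)]
  field_simp

/-- Rotation invariance serves twice: it removes the angle `τ` from the Gaussian correlator, and it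
lets the mean value property be applied to Gaussian averages of entire functions. -/
theorem complexGaussian_map_mul {v : ℝ} (hv : 0 ≤ v) {u : ℂ} (hu : ‖u‖ = 1) :
    (complexGaussian v).map (fun z => u * z) = complexGaussian v := by
  refine Measure.ext_of_charFun ?_
  ext t
  have := charFun_complexGaussian hv (conj u * t)
  rw [norm_mul, RCLike.norm_conj, hu, one_mul, charFun_apply] at this
  rw [charFun_complexGaussian hv, ← this, charFun_apply, integral_map (by fun_prop) (by fun_prop)]
  refine integral_congr_ae (ae_of_all _ fun z => ?_)
  simp only [Complex.inner, map_mul, mul_assoc]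
  ring_nf

theorem integral_complexGaussian_mul {v : ℝ} (hv : 0 ≤ v) {u : ℂ} (hu : ‖u‖ = 1) {F : ℂ → ℝ}
    (hF : Continuous F) :
    ∫ z, F (u * z) ∂complexGaussian v = ∫ z, F z ∂complexGaussian v := by
  conv_rhs => rw [← complexGaussian_map_mul hv hu]
  rw [integral_map (by fun_prop) hF.aestronglyMeasurable]

/-- After rotating by `e^{iτ}` the squeezing axes are the coordinate axes, and the fourth power of
the overlap is a product of real Gaussians with rates `2(1 ± tanh ζ)`. The two one-dimensional
denominators `1 + 2(1 ± tanh ζ)E` multiply to `G₁`. -/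
theorem C₁_gaussian_eq (γ : ℂ) (τ ζ : ℝ) {E : ℝ} (hE : 0 < E) :
    (Target.gaussian γ τ ζ).C₁ E
      = ∫ α, ‖overlap (.gaussian γ τ ζ) α‖ ^ 4 ∂complexGaussian E := by
  set t := Real.tanh ζ with ht
  have ht1 := abs_lt.1 (abs_tanh_lt_one ζ)
  have hp : 0 < 1 + t := by linarith
  have hm : 0 < 1 - t := by linarith
  have hc : 0 < Real.cosh ζ := Real.cosh_pos ζ
  have hsech : sech ζ ^ 2 = 1 - t ^ 2 := by
    rw [sech, ht, Real.tanh_eq_sinh_div_cosh]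
    have := Real.cosh_sq ζ
    field_simp
    linarith
  set u := Complex.exp (Complex.I * τ) with hu
  have hu1 : ‖u‖ = 1 := norm_cexp_I_mul τ
  set δ := u * γ with hδ
  have e1 : ∀ α, ‖overlap (.gaussian γ τ ζ) α‖ ^ 4
      = sech ζ ^ 2 * (Real.exp (-(2 * (1 + t) * ((u * α).re - δ.re) ^ 2))
        * Real.exp (-(2 * (1 - t) * ((u * α).im - δ.im) ^ 2))) := fun α => by
    have e2 : ‖α - γ‖ ^ 2 = ((u * α).re - δ.re) ^ 2 + ((u * α).im - δ.im) ^ 2 := by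
      have : ‖α - γ‖ = ‖u * α - δ‖ := by rw [hδ, ← mul_sub, norm_mul, hu1, one_mul]
      rw [this, ← Complex.normSq_eq_norm_sq, Complex.normSq_apply, Complex.sub_re, Complex.sub_im]
      ring
    have e3 : ((u * (α - γ)) ^ 2).re = ((u * α).re - δ.re) ^ 2 - ((u * α).im - δ.im) ^ 2 := by
      rw [mul_sub, ← hδ, pow_two, Complex.mul_re, Complex.sub_re, Complex.sub_im]
      ring
    have e4 : (Real.sqrt (Real.cosh ζ)) ^ 4 = Real.cosh ζ ^ 2 := by
      rw [show 4 = 2 * 2 by norm_num, pow_mul, Real.sq_sqrt hc.le]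
    rw [norm_overlap_gaussian, ← hu, e3, mul_pow, div_pow, e4, ← Real.exp_nat_mul,
      ← Real.exp_nat_mul, e2, sech, ← Real.exp_add, mul_div_assoc', ← Real.exp_add, one_div,
      inv_pow, inv_mul_eq_div]
    congr 2
    push_cast
    ring
  simp_rw [e1]
  rw [integral_const_mul, integral_complexGaussian_mul hE.le hu1 (F := fun z =>
      Real.exp (-(2 * (1 + t) * (z.re - δ.re) ^ 2)) * Real.exp (-(2 * (1 - t) * (z.im - δ.im) ^ 2)))
      (by fun_prop), complexGaussian, integral_map measurable_complex_mk.aemeasurable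
      (by fun_prop)]
  rw [integral_prod_mul (fun x : ℝ => Real.exp (-(2 * (1 + t) * (x - δ.re) ^ 2)))
      (fun y : ℝ => Real.exp (-(2 * (1 - t) * (y - δ.im) ^ 2))),
    integral_exp_neg_sq_gaussianReal (by positivity) (by positivity),
    integral_exp_neg_sq_gaussianReal (by positivity) (by positivity)]
  have f1 : 1 + 2 * (2 * (1 + t)) * (E / 2) = 1 + 2 * (1 + t) * E := by ring
  have f2 : 1 + 2 * (2 * (1 - t)) * (E / 2) = 1 + 2 * (1 - t) * E := by ring
  have g1 : 0 < 1 + 2 * (1 + t) * E := by positivity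
  have g2 : 0 < 1 + 2 * (1 - t) * E := by positivity
  have hG : G₁ ζ E = (1 + 2 * (1 + t) * E) * (1 + 2 * (1 - t) * E) := by
    rw [G₁, hsech]; ring
  have hδre : δ.re = ‖γ‖ * Real.cos (Complex.arg γ + τ) := by
    rw [hδ, hu, mul_comm Complex.I]
    conv_lhs => rw [← Complex.norm_mul_exp_arg_mul_I γ]
    rw [mul_left_comm, ← Complex.exp_add, Complex.re_ofReal_mul, ← add_mul, ← Complex.ofReal_add,
      Complex.exp_ofReal_mul_I_re, add_comm]
  have hδim : δ.im = ‖γ‖ * Real.sin (Complex.arg γ + τ) := by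
    rw [hδ, hu, mul_comm Complex.I]
    conv_lhs => rw [← Complex.norm_mul_exp_arg_mul_I γ]
    rw [mul_left_comm, ← Complex.exp_add, Complex.im_ofReal_mul, ← add_mul, ← Complex.ofReal_add,
      Complex.exp_ofReal_mul_I_im, add_comm]
  have hR : Rfun γ τ ζ E = 2 * (1 + t) * δ.re ^ 2 * (1 + 2 * (1 - t) * E)
      + 2 * (1 - t) * δ.im ^ 2 * (1 + 2 * (1 + t) * E) := by
    have hsc := Real.sin_sq_add_cos_sq (Complex.arg γ + τ)
    rw [Rfun, hsech, hδre, hδim, Real.cos_two_mul, ← ht]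
    have hs : Real.sin (Complex.arg γ + τ) ^ 2 = 1 - Real.cos (Complex.arg γ + τ) ^ 2 := by linarith
    rw [mul_pow ‖γ‖ (Real.sin _), hs]
    ring
  rw [f1, f2, Target.C₁, hG, hR, Real.sqrt_mul g1.le]
  have hs1 : Real.sqrt (1 + 2 * (1 + t) * E) ≠ 0 := by positivity
  have hs2 : Real.sqrt (1 + 2 * (1 - t) * E) ≠ 0 := by positivity
  have hexp : Real.exp (-((2 * (1 + t) * δ.re ^ 2 * (1 + 2 * (1 - t) * E)
      + 2 * (1 - t) * δ.im ^ 2 * (1 + 2 * (1 + t) * E))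
        / ((1 + 2 * (1 + t) * E) * (1 + 2 * (1 - t) * E))))
      = Real.exp (-(2 * (1 + t) * δ.re ^ 2 / (1 + 2 * (1 + t) * E)))
        * Real.exp (-(2 * (1 - t) * δ.im ^ 2 / (1 + 2 * (1 - t) * E))) := by
    rw [← Real.exp_add]
    congr 1
    field_simp
    ring
  rw [hexp]
  field_simp

/-- The integrand is radial, and the radial integral is the Gamma function at `2n + 1`. -/
theorem C₁_fock_eq (n : ℕ) {E : ℝ} (hE : 0 < E) :
    (Target.fock n).C₁ E = ∫ α, ‖overlap (.fock n) α‖ ^ 4 ∂complexGaussian E := by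
  rw [integral_complexGaussian hE]
  have hf : (Real.sqrt n.factorial) ^ 4 = (n.factorial : ℝ) ^ 2 := by
    rw [show 4 = 2 * 2 by norm_num, pow_mul, Real.sq_sqrt (by positivity)]
  have e : ∀ z : ℂ, (Real.pi * E)⁻¹ * Real.exp (-‖z‖ ^ 2 / E) * ‖overlap (.fock n) z‖ ^ 4
      = (Real.pi * E)⁻¹ * ((n.factorial : ℝ) ^ 2)⁻¹
        * (‖z‖ ^ ((4 * n : ℕ) : ℝ) * Real.exp (-(2 + 1 / E) * ‖z‖ ^ (2 : ℝ))) := fun z => by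
    rw [overlap, norm_mul, norm_div, norm_pow, Complex.norm_real, Complex.norm_real,
      Real.norm_of_nonneg (Real.exp_nonneg _), Real.norm_of_nonneg (Real.sqrt_nonneg _), mul_pow,
      div_pow, hf, ← Real.exp_nat_mul, Real.rpow_natCast, ← pow_mul, mul_comm n 4,
      ← Real.rpow_natCast ‖z‖ 2]
    have : Real.exp (-(2 + 1 / E) * ‖z‖ ^ (2 : ℝ))
        = Real.exp (-‖z‖ ^ ((2 : ℕ) : ℝ) / E)
          * Real.exp (((4 : ℕ) : ℝ) * (-‖z‖ ^ ((2 : ℕ) : ℝ) / 2)) := by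
      rw [← Real.exp_add]
      congr 1
      push_cast
      ring
    rw [this]
    ring
  simp_rw [e]
  rw [integral_const_mul, Complex.integral_rpow_mul_exp_neg_mul_rpow (by norm_num)
    (by have : (0 : ℝ) ≤ ((4 * n : ℕ) : ℝ) := by positivity
        linarith) (by positivity)]
  have e1 : (((4 * n : ℕ) : ℝ) + 2) / 2 = ((2 * n : ℕ) : ℝ) + 1 := by push_cast; ring
  have e2 : -(((4 * n : ℕ) : ℝ) + 2) / 2 = -((2 * n + 1 : ℕ) : ℝ) := by push_cast; ring
  rw [e1, e2, Real.Gamma_nat_eq_factorial, Real.rpow_neg (by positivity), Real.rpow_natCast,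
    Target.C₁]
  have e3 : (2 + 1 / E) = 2 * (1 + 1 / (2 * E)) := by field_simp
  have e4 : 1 + 2 * E = 2 * E * (1 + 1 / (2 * E)) := by field_simp; ring
  have hpos : 0 < 1 + 1 / (2 * E) := by positivity
  rw [e3, e4]
  generalize 1 + 1 / (2 * E) = q at hpos
  have e5 : (2 * q) ^ (2 * n + 1) = 2 * (2 ^ n) ^ 2 * q ^ (2 * n) * q := by
    rw [mul_pow, pow_succ (2 : ℝ), mul_comm 2 n, pow_mul, pow_succ q]; ring
  rw [e5]
  have : Real.pi ≠ 0 := Real.pi_ne_zero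
  field_simp

theorem C₁_eq_integral (T : Target) {E : ℝ} (hE : 0 < E) :
    T.C₁ E = ∫ α, ‖overlap T α‖ ^ 4 ∂complexGaussian E := by
  cases T with
  | gaussian γ τ ζ => exact C₁_gaussian_eq γ τ ζ hE
  | fock n => exact C₁_fock_eq n hE

theorem integrable_norm_overlap_pow (T : Target) (E : ℝ) :
    Integrable (fun α => ‖overlap T α‖ ^ 4) (complexGaussian E) := by
  obtain ⟨B, hB⟩ := (isOverlap_overlap T).exists_norm_le
  have := (isOverlap_overlap T).continuous
  refine Integrable.of_bound (by fun_prop) (B ^ 4) (ae_of_all _ fun z => ?_)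
  rw [norm_pow, norm_norm]
  exact pow_le_pow_left₀ (norm_nonneg _) (hB z) 4

/-! ### The Weyl representation of the projection on the target -/

theorem integral_complexGaussian_complex {v : ℝ} (hv : 0 < v) (F : ℂ → ℂ) :
    ∫ z, F z ∂complexGaussian v
      = ∫ z, (((Real.pi * v)⁻¹ * Real.exp (-‖z‖ ^ 2 / v) : ℝ) : ℂ) * F z := by
  rw [complexGaussian_eq_withDensity hv, integral_withDensity_eq_integral_toReal_smul
    (by fun_prop) (ae_of_all _ fun _ => ENNReal.ofReal_lt_top)]
  refine integral_congr_ae (ae_of_all _ fun z => ?_)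
  simp only
  rw [ENNReal.toReal_ofReal (by positivity), Complex.real_smul]

theorem integrable_complexGaussian_iff {v : ℝ} (hv : 0 < v) (F : ℂ → ℂ) :
    Integrable F (complexGaussian v) ↔
      Integrable fun z => (((Real.pi * v)⁻¹ * Real.exp (-‖z‖ ^ 2 / v) : ℝ) : ℂ) * F z := by
  rw [complexGaussian_eq_withDensity hv, integrable_withDensity_iff_integrable_smul'
    (by fun_prop) (ae_of_all _ fun _ => ENNReal.ofReal_lt_top)]
  refine integrable_congr (ae_of_all _ fun z => ?_)
  simp only
  rw [ENNReal.toReal_ofReal (by positivity), Complex.real_smul]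

/-- The mean value property. -/
theorem integral_uniformAngle_cexp_mul {G : ℂ → ℂ} (hG : Differentiable ℂ G) (y : ℂ) :
    ∫ t : ℝ, G (Complex.exp (Complex.I * t) * y) ∂uniformAngle = G 0 := by
  have h : DiffContOnCl ℂ (fun w => G (w * y)) (Metric.ball 0 |1|) :=
    (hG.comp (differentiable_id.mul_const y)).diffContOnCl
  have h2 := h.circleAverage
  rw [Real.circleAverage, Complex.real_smul, zero_mul] at h2
  rw [integral_uniformAngle, ← h2]
  congr 1
  refine intervalIntegral.integral_congr fun t _ => ?_
  simp [circleMap, mul_comm]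

/-- The law is unchanged by a random phase. Averaging over that phase first replaces `G` by `G 0`,
by the mean value property. -/
theorem integral_complexGaussian_of_differentiable {v : ℝ} (hv : 0 ≤ v) {G : ℂ → ℂ}
    (hG : Differentiable ℂ G) (hi : Integrable G (complexGaussian v)) :
    ∫ z, G z ∂complexGaussian v = G 0 := by
  have hc := hG.continuous
  have hrot : ∀ t : ℝ, (complexGaussian v).map (fun z => Complex.exp (Complex.I * t) * z)
      = complexGaussian v := fun t => complexGaussian_map_mul hv (norm_cexp_I_mul t)
  have hmul : ∀ t : ℝ, Measurable fun z : ℂ => Complex.exp (Complex.I * t) * z := fun t => by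
    fun_prop
  have h1 : ∀ t : ℝ, ∫ z, G (Complex.exp (Complex.I * t) * z) ∂complexGaussian v
      = ∫ z, G z ∂complexGaussian v := fun t => by
    conv_rhs => rw [← hrot t]
    rw [integral_map (hmul t).aemeasurable hc.aestronglyMeasurable]
  have h2 : ∀ t : ℝ, ∫ z, ‖G (Complex.exp (Complex.I * t) * z)‖ ∂complexGaussian v
      = ∫ z, ‖G z‖ ∂complexGaussian v := fun t => by
    conv_rhs => rw [← hrot t]
    rw [integral_map (hmul t).aemeasurable hc.norm.aestronglyMeasurable]
  have h3 : ∀ t : ℝ, Integrable (fun z => G (Complex.exp (Complex.I * t) * z))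
      (complexGaussian v) := fun t => by
    have := hi
    rw [← hrot t] at this
    exact this.comp_measurable (hmul t)
  have h4 : Integrable (Function.uncurry fun (t : ℝ) (z : ℂ) =>
      G (Complex.exp (Complex.I * t) * z)) (uniformAngle.prod (complexGaussian v)) := by
    rw [integrable_prod_iff]
    · refine ⟨ae_of_all _ h3, ?_⟩
      simp only [Function.uncurry, h2]
      exact integrable_const _
    · have : Continuous (Function.uncurry fun (t : ℝ) (z : ℂ) =>
          G (Complex.exp (Complex.I * t) * z)) := by
        unfold Function.uncurry
        fun_prop
      exact this.aestronglyMeasurable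
  have h5 := integral_integral_swap h4
  simp only [h1, integral_uniformAngle_cexp_mul hG, integral_const, probReal_univ, one_smul] at h5
  exact h5

/-! ### Matrix elements of displacements between coherent states -/

/-- The inner product `⟨x|y⟩` of coherent states. -/
def cohInner (x y : ℂ) : ℂ := Complex.exp (-(‖x‖ : ℂ) ^ 2 / 2 - (‖y‖ : ℂ) ^ 2 / 2 + conj x * y)

/-- The matrix element `⟨x| D(ξ) |y⟩` between coherent states. -/
def weylInner (ξ x y : ℂ) : ℂ :=
  Complex.exp (-(‖ξ‖ : ℂ) ^ 2 / 2 + ξ * conj x - conj ξ * y) * cohInner x y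

theorem norm_sq_eq_mul_conj (z : ℂ) : ((‖z‖ : ℝ) : ℂ) ^ 2 = z * conj z := (Complex.mul_conj' z).symm

theorem weylInner_eq (ξ x y : ℂ) :
    weylInner ξ x y = Complex.exp (Complex.I * ((ξ * (conj x + conj y)).im - (x * conj y).im : ℝ))
      * (Real.exp (-‖ξ + y - x‖ ^ 2 / 2) : ℂ) := by
  rw [weylInner, cohInner, Complex.ofReal_exp, ← Complex.exp_add, ← Complex.exp_add]
  congr 1
  push_cast
  have him : ∀ z : ℂ, Complex.I * (z.im : ℂ) = (z - conj z) / 2 := fun z => by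
    rw [Complex.im_eq_sub_conj]
    field_simp
  rw [mul_sub, him, him]
  simp only [norm_sq_eq_mul_conj, map_add, map_sub, map_mul, Complex.conj_conj]
  ring

theorem norm_weylInner (ξ x y : ℂ) : ‖weylInner ξ x y‖ = Real.exp (-‖ξ + y - x‖ ^ 2 / 2) := by
  rw [weylInner_eq, norm_mul, norm_cexp_I_mul, one_mul, Complex.norm_real,
    Real.norm_of_nonneg (Real.exp_nonneg _)]

theorem conj_cohInner (x y : ℂ) : conj (cohInner x y) = cohInner y x := by
  have h2 : conj (2 : ℂ) = 2 := map_ofNat _ 2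
  rw [cohInner, cohInner, ← Complex.exp_conj]
  congr 1
  simp [h2]
  ring

theorem weylInner_zero (x y : ℂ) : weylInner 0 x y = cohInner x y := by
  simp [weylInner]

theorem norm_cohInner_le (x y : ℂ) : ‖cohInner x y‖ ≤ 1 := by
  rw [← weylInner_zero, norm_weylInner, Real.exp_le_one_iff]
  nlinarith [sq_nonneg ‖0 + y - x‖]

theorem continuous_cohInner : Continuous fun p : ℂ × ℂ => cohInner p.1 p.2 := by
  unfold cohInner
  fun_prop

theorem integral_cexp_linear_complexGaussian (a b : ℂ) :
    ∫ z, Complex.exp (a * z + b * conj z) ∂complexGaussian 1 = Complex.exp (a * b) := by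
  have key : ∀ w : ℂ, ∫ x : ℝ, Complex.exp (w * x) ∂gaussianReal 0 ((1 : ℝ) / 2).toNNReal
      = Complex.exp (w ^ 2 / 4) := fun w => by
    have h := complexMGF_id_gaussianReal (μ := 0) (v := ((1 : ℝ) / 2).toNNReal) w
    rw [complexMGF] at h
    simp only [id] at h
    rw [h]
    congr 1
    rw [Real.coe_toNNReal _ (by norm_num)]
    push_cast
    ring
  rw [complexGaussian, integral_map measurable_complex_mk.aemeasurable (by fun_prop)]
  have : ∀ p : ℝ × ℝ, Complex.exp (a * (⟨p.1, p.2⟩ : ℂ) + b * conj (⟨p.1, p.2⟩ : ℂ))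
      = Complex.exp ((a + b) * p.1) * Complex.exp (((a - b) * Complex.I) * p.2) := fun p => by
    rw [← Complex.exp_add, Complex.mk_eq_add_mul_I]
    congr 1
    simp
    ring
  simp_rw [this]
  rw [integral_prod_mul (fun x : ℝ => Complex.exp ((a + b) * x))
    (fun x : ℝ => Complex.exp (((a - b) * Complex.I) * x)), key, key, ← Complex.exp_add]
  congr 1
  rw [mul_pow, Complex.I_sq]
  ring

/-- Orthogonality of the displacement operators between coherent states. -/
theorem integral_weylInner_mul_weylInner (u v x y : ℂ) :
    ∫ ξ, weylInner (-ξ) u v * weylInner ξ x y = Real.pi * (cohInner u y * cohInner x v) := by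
  have h := integral_complexGaussian_complex one_pos
    fun ξ => Complex.exp ((conj x - conj u) * ξ + (v - y) * conj ξ)
  rw [integral_cexp_linear_complexGaussian] at h
  -- The two factors `exp(-|ξ|²/2)` combine to `π` times the density of `complexGaussian 1`, so what
  -- remains is the mean of an exponential of a linear form.
  have e : ∀ ξ : ℂ, weylInner (-ξ) u v * weylInner ξ x y
      = Real.pi * (cohInner u v * cohInner x y) * ((((Real.pi * 1)⁻¹ *
        Real.exp (-‖ξ‖ ^ 2 / 1) : ℝ) : ℂ) *
          Complex.exp ((conj x - conj u) * ξ + (v - y) * conj ξ)) := fun ξ => by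
    have hpi : (Real.pi : ℂ) ≠ 0 := by exact_mod_cast Real.pi_ne_zero
    have e2 : Complex.exp (-(‖-ξ‖ : ℂ) ^ 2 / 2 + -ξ * conj u - conj (-ξ) * v)
        * Complex.exp (-(‖ξ‖ : ℂ) ^ 2 / 2 + ξ * conj x - conj ξ * y)
        = Complex.exp (-(‖ξ‖ : ℂ) ^ 2 / 1)
          * Complex.exp ((conj x - conj u) * ξ + (v - y) * conj ξ) := by
      rw [← Complex.exp_add, ← Complex.exp_add, norm_neg, map_neg]
      congr 1
      ring
    rw [weylInner, weylInner, mul_mul_mul_comm, e2]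
    push_cast
    field_simp
  simp_rw [e]
  rw [integral_const_mul, ← h]
  simp only [cohInner]
  rw [mul_assoc]
  congr 1
  rw [← Complex.exp_add, ← Complex.exp_add, ← Complex.exp_add]
  congr 1
  ring

/-- The reproducing property of the overlaps. -/
theorem IsOverlap.integral_mul_cohInner {f : ℂ → ℂ} (hf : IsOverlap f) (a : ℂ) :
    ∫ u, f u * cohInner u a = Real.pi * f a := by
  have hint : Integrable fun u => f u * cohInner u a := by
    refine hf.integrable.mul_bdd (c := 1) ?_ (ae_of_all _ fun u => norm_cohInner_le u a)
    exact (continuous_cohInner.comp (by fun_prop : Continuous fun u : ℂ => (u, a))).aestronglyMeasurable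
  obtain ⟨h, hd, he⟩ := hf.exists_entire
  -- Recentred at `a`, the integrand is a constant times the standard Gaussian density times this
  -- entire function. The mean is therefore `G 0`, a multiple of `f a`.
  set G : ℂ → ℂ := fun y => h (a + y) * Complex.exp (-(conj a * y)) with hG
  have hGd : Differentiable ℂ G := by
    have : Differentiable ℂ fun y => h (a + y) := hd.comp (by fun_prop)
    exact this.mul (by fun_prop)
  have hpi : (Real.pi : ℂ) ≠ 0 := by exact_mod_cast Real.pi_ne_zero
  have e : ∀ u : ℂ, (((Real.pi * 1)⁻¹ * Real.exp (-‖u - a‖ ^ 2 / 1) : ℝ) : ℂ) * G (u - a)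
      = (Real.pi : ℂ)⁻¹ * Complex.exp ((‖a‖ : ℂ) ^ 2 / 2) * (f u * cohInner u a) := fun u => by
    have e2 : Complex.exp (-(‖u - a‖ : ℂ) ^ 2 / 1) * Complex.exp (-(conj a * (u - a)))
        = Complex.exp ((‖a‖ : ℂ) ^ 2 / 2) * (Complex.exp (-(‖u‖ : ℂ) ^ 2 / 2) * cohInner u a) := by
      rw [cohInner, ← Complex.exp_add, ← Complex.exp_add, ← Complex.exp_add]
      congr 1
      simp only [norm_sq_eq_mul_conj, map_sub]
      ring
    rw [hG, he u]
    simp only [add_sub_cancel]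
    push_cast
    rw [mul_one]
    linear_combination (Real.pi : ℂ)⁻¹ * h u * e2
  have hGi : Integrable G (complexGaussian 1) := by
    rw [integrable_complexGaussian_iff one_pos]
    have h2 := hint.const_mul ((Real.pi : ℂ)⁻¹ * Complex.exp ((‖a‖ : ℂ) ^ 2 / 2))
    simp_rw [← e] at h2
    simpa using h2.comp_add_right a
  have h3 := integral_complexGaussian_of_differentiable zero_le_one hGd hGi
  rw [integral_complexGaussian_complex one_pos, ← integral_sub_right_eq_self _ a] at h3
  simp_rw [e] at h3
  rw [integral_const_mul] at h3
  have h4 : G 0 = Complex.exp ((‖a‖ : ℂ) ^ 2 / 2) * f a := by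
    rw [hG, he a]
    simp only [add_zero, mul_zero, neg_zero, Complex.exp_zero, mul_one]
    push_cast
    rw [← mul_assoc, ← Complex.exp_add]
    ring_nf
    simp
  rw [h4] at h3
  have hx : Complex.exp ((‖a‖ : ℂ) ^ 2 / 2) ≠ 0 := Complex.exp_ne_zero _
  have h5 : (Real.pi : ℂ)⁻¹ * ∫ u, f u * cohInner u a = f a :=
    mul_left_cancel₀ hx (by linear_combination h3)
  rw [← h5, ← mul_assoc, mul_inv_cancel₀ hpi, one_mul]

/-- The characteristic function `⟨ψ| D(-ξ) |ψ⟩` of the vector with overlaps `f`. -/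
def chi (f : ℂ → ℂ) (ξ : ℂ) : ℂ :=
  ((Real.pi : ℂ) ^ 2)⁻¹ * ∫ p : ℂ × ℂ, f p.1 * conj (f p.2) * weylInner (-ξ) p.1 p.2

theorem continuous_weylInner : Continuous fun p : ℂ × ℂ × ℂ => weylInner p.1 p.2.1 p.2.2 := by
  unfold weylInner cohInner
  fun_prop

theorem IsOverlap.integrable_prod {f : ℂ → ℂ} (hf : IsOverlap f) :
    Integrable (fun p : ℂ × ℂ => f p.1 * conj (f p.2)) := by
  have hc : Integrable fun z => conj (f z) :=
    hf.integrable.congr' (by have := hf.continuous; fun_prop) (ae_of_all _ fun z => by simp)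
  exact hf.integrable.mul_prod hc

theorem IsOverlap.norm_chi_le {f : ℂ → ℂ} (hf : IsOverlap f) (ξ : ℂ) :
    ‖chi f ξ‖ ≤ (Real.pi ^ 2)⁻¹ * ∫ p : ℂ × ℂ, ‖f p.1 * conj (f p.2)‖ := by
  rw [chi, norm_mul, norm_inv, norm_pow, Complex.norm_real, Real.norm_of_nonneg Real.pi_pos.le]
  gcongr
  refine norm_integral_le_of_norm_le hf.integrable_prod.norm (ae_of_all _ fun p => ?_)
  rw [norm_mul _ (weylInner _ _ _), norm_weylInner]
  refine mul_le_of_le_one_right (norm_nonneg _) ?_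
  rw [Real.exp_le_one_iff]
  nlinarith [sq_nonneg ‖-ξ + p.2 - p.1‖]

/-- The modulus of `weylInner` is a Gaussian in `ξ` whose integral does not depend on the pair of
coherent states, so integrability of `f` in each variable is enough. -/
theorem IsOverlap.integrable_chi {f : ℂ → ℂ} (hf : IsOverlap f) : Integrable (chi f) := by
  have hcont := hf.continuous
  have hexp : Integrable fun ξ : ℂ => Real.exp (-‖ξ‖ ^ 2 / 2) :=
    (integrable_exp_neg_mul_norm_sq (c := 1 / 2) (by norm_num)).congr
      (ae_of_all _ fun z => by ring_nf)
  have hn : ∀ (p : ℂ × ℂ) (ξ : ℂ), ‖f p.1 * conj (f p.2) * weylInner (-ξ) p.1 p.2‖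
      = ‖f p.1 * conj (f p.2)‖ * Real.exp (-‖(p.2 - p.1) - ξ‖ ^ 2 / 2) := fun p ξ => by
    rw [norm_mul _ (weylInner _ _ _), norm_weylInner]
    congr 4
    ring_nf
  have hcw : Continuous fun q : ℂ × (ℂ × ℂ) =>
      f q.2.1 * conj (f q.2.2) * weylInner (-q.1) q.2.1 q.2.2 := by
    have := continuous_weylInner.comp
      (by fun_prop : Continuous fun q : ℂ × (ℂ × ℂ) => (-q.1, q.2.1, q.2.2))
    exact Continuous.mul (by fun_prop) this
  have h : Integrable (fun q : ℂ × (ℂ × ℂ) =>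
      f q.2.1 * conj (f q.2.2) * weylInner (-q.1) q.2.1 q.2.2)
      ((volume : Measure ℂ).prod (volume : Measure (ℂ × ℂ))) := by
    rw [integrable_prod_iff' hcw.aestronglyMeasurable]
    refine ⟨ae_of_all _ fun p => ?_, ?_⟩
    · refine ((hexp.comp_sub_left (p.2 - p.1)).const_mul ‖f p.1 * conj (f p.2)‖).mono'
        (hcw.comp (by fun_prop : Continuous fun ξ : ℂ => (ξ, p))).aestronglyMeasurable
        (ae_of_all _ fun ξ => (hn p ξ).le)
    · simp only [hn]
      simp_rw [integral_const_mul,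
        integral_sub_left_eq_self (fun z : ℂ => Real.exp (-‖z‖ ^ 2 / 2)) volume]
      exact hf.integrable_prod.norm.mul_const _
  exact h.integral_prod_left.const_mul _

/-- The projection on the target as an integral of displacement operators. -/
theorem IsOverlap.integral_chi_mul_weylInner {f : ℂ → ℂ} (hf : IsOverlap f) (x y : ℂ) :
    ∫ ξ, chi f ξ * weylInner ξ x y = Real.pi * (conj (f x) * f y) := by
  have hcont := hf.continuous
  have hpi : (Real.pi : ℂ) ≠ 0 := by exact_mod_cast Real.pi_ne_zero
  have hexp : Integrable fun ξ : ℂ => Real.exp (-‖ξ‖ ^ 2 / 2) :=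
    (integrable_exp_neg_mul_norm_sq (c := 1 / 2) (by norm_num)).congr
      (ae_of_all _ fun z => by ring_nf)
  have hexp' : Integrable fun ξ : ℂ => Real.exp (-‖ξ + y - x‖ ^ 2 / 2) := by
    simpa only [add_sub_assoc] using hexp.comp_add_right (y - x)
  have hcw : Continuous fun q : ℂ × (ℂ × ℂ) =>
      f q.2.1 * conj (f q.2.2) * (weylInner (-q.1) q.2.1 q.2.2 * weylInner q.1 x y) := by
    have h1 := continuous_weylInner.comp
      (by fun_prop : Continuous fun q : ℂ × (ℂ × ℂ) => (-q.1, q.2.1, q.2.2))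
    have h2 := continuous_weylInner.comp
      (by fun_prop : Continuous fun q : ℂ × (ℂ × ℂ) => (q.1, x, y))
    exact Continuous.mul (by fun_prop) (h1.mul h2)
  have hint : Integrable (Function.uncurry fun (ξ : ℂ) (p : ℂ × ℂ) =>
      f p.1 * conj (f p.2) * (weylInner (-ξ) p.1 p.2 * weylInner ξ x y))
      ((volume : Measure ℂ).prod (volume : Measure (ℂ × ℂ))) := by
    refine (hexp'.mul_prod hf.integrable_prod.norm).mono' hcw.aestronglyMeasurable
      (ae_of_all _ fun q => ?_)
    simp only [Function.uncurry]
    rw [norm_mul, norm_mul (weylInner _ _ _), norm_weylInner, norm_weylInner, mul_comm]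
    gcongr
    refine mul_le_of_le_one_left (Real.exp_nonneg _) ?_
    rw [Real.exp_le_one_iff]
    nlinarith [sq_nonneg ‖-q.1 + q.2.2 - q.2.1‖]
  have e1 : ∀ ξ, chi f ξ * weylInner ξ x y = ((Real.pi : ℂ) ^ 2)⁻¹ * ∫ p : ℂ × ℂ,
      f p.1 * conj (f p.2) * (weylInner (-ξ) p.1 p.2 * weylInner ξ x y) := fun ξ => by
    rw [chi, mul_assoc, ← integral_mul_const]
    simp only [mul_assoc]
  simp_rw [e1]
  rw [integral_const_mul, integral_integral_swap hint]
  -- Orthogonality collapses the `ξ`-integral into a product of kernels in the two coherent labels,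
  -- and the reproducing property evaluates each factor.
  simp_rw [integral_const_mul, integral_weylInner_mul_weylInner]
  have e2 : ∀ p : ℂ × ℂ, f p.1 * conj (f p.2) * (Real.pi * (cohInner p.1 y * cohInner x p.2))
      = Real.pi * ((f p.1 * cohInner p.1 y) * conj (f p.2 * cohInner p.2 x)) := fun p => by
    rw [map_mul, conj_cohInner]; ring
  simp_rw [e2]
  rw [integral_const_mul, Measure.volume_eq_prod, integral_prod_mul (fun u => f u * cohInner u y)
    (fun v => conj (f v * cohInner v x)), integral_conj, hf.integral_mul_cohInner,
    hf.integral_mul_cohInner, map_mul, Complex.conj_ofReal]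
  field_simp

/-! ### The circuit in characteristic functions -/

/-- The rotation of the matrix elements between a pair of vectors. -/
def rotW (θ φ : ℝ) (w : Fin 2 → Fin 2 → ℂ) (a b : Fin 2) : ℂ :=
  conj (rotAmp θ φ (fun c => conj (rotAmp θ φ (w c) b)) a)

/-- The characteristic functions `⟨Ψ_a| D(ξ) |Ψ_b⟩` of the output state `Ψ` of a circuit. -/
def charW : (L : ℕ) → Params L → ℂ → Fin 2 → Fin 2 → ℂ
  | 0, _, ξ => ![![(Real.exp (-‖ξ‖ ^ 2 / 2) : ℂ), 0], ![0, 0]]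
  | L + 1, x, ξ =>
      let R := fun ζ => rotW (x.2.1 (Fin.last L)) (x.2.2 (Fin.last L)) (charW L (initParams x) ζ)
      ![![Complex.exp (-(Complex.I * (2 * (ξ * conj (x.1 (Fin.last L))).im : ℝ))) * R ξ 1 1,
          R (ξ + 2 * x.1 (Fin.last L)) 1 0],
        ![R (ξ - 2 * x.1 (Fin.last L)) 0 1,
          Complex.exp (Complex.I * (2 * (ξ * conj (x.1 (Fin.last L))).im : ℝ)) * R ξ 0 0]]

theorem norm_rotW_le (θ φ : ℝ) {w : Fin 2 → Fin 2 → ℂ} {B : ℝ} (hw : ∀ a b, ‖w a b‖ ≤ B)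
    (a b : Fin 2) : ‖rotW θ φ w a b‖ ≤ 4 * B := by
  rw [rotW, RCLike.norm_conj]
  refine (norm_rotAmp_le θ φ (B := 2 * B) (fun c => ?_) a).trans (by linarith)
  rw [RCLike.norm_conj]
  exact norm_rotAmp_le θ φ (hw c) b

theorem continuous_rotW {X : Type*} [TopologicalSpace X] {θ φ : X → ℝ}
    {w : X → Fin 2 → Fin 2 → ℂ} (hθ : Continuous θ) (hφ : Continuous φ)
    (hw : ∀ a b, Continuous fun x => w x a b) (a b : Fin 2) :
    Continuous fun x => rotW (θ x) (φ x) (w x) a b := by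
  unfold rotW
  exact Complex.continuous_conj.comp (continuous_rotAmp hθ hφ (fun c =>
    Complex.continuous_conj.comp (continuous_rotAmp hθ hφ (fun d => hw c d) b)) a)

theorem rotW_mul (θ φ : ℝ) (p q : Fin 2 → ℂ) (a b : Fin 2) :
    rotW θ φ (fun c d => conj (p c) * q d) a b = conj (rotAmp θ φ p a) * rotAmp θ φ q b := by
  simp only [rotW, rotAmp, map_add, map_mul, Complex.conj_conj]
  ring

theorem sum_norm_sq_rotAmp (θ φ : ℝ) (q : Fin 2 → ℂ) :
    ‖rotAmp θ φ q 0‖ ^ 2 + ‖rotAmp θ φ q 1‖ ^ 2 = ‖q 0‖ ^ 2 + ‖q 1‖ ^ 2 := by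
  set c := Real.cos (θ / 2)
  set s := Real.sin (θ / 2)
  have hsc : s ^ 2 + c ^ 2 = 1 := Real.sin_sq_add_cos_sq _
  have hsc' : (s : ℂ) ^ 2 + (c : ℂ) ^ 2 = 1 := by exact_mod_cast hsc
  have h1 : conj (Complex.exp (Complex.I * φ)) = Complex.exp (-Complex.I * φ) := by
    rw [← Complex.exp_conj]; simp
  have h2 : conj (Complex.exp (-Complex.I * φ)) = Complex.exp (Complex.I * φ) := by
    rw [← Complex.exp_conj]; simp
  have h3 : Complex.exp (Complex.I * φ) * Complex.exp (-Complex.I * φ) = 1 := by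
    rw [← Complex.exp_add]; simp
  have hI := Complex.I_mul_I
  have : ((‖rotAmp θ φ q 0‖ ^ 2 + ‖rotAmp θ φ q 1‖ ^ 2 : ℝ) : ℂ)
      = ((‖q 0‖ ^ 2 + ‖q 1‖ ^ 2 : ℝ) : ℂ) := by
    push_cast
    simp only [norm_sq_eq_mul_conj, rotAmp, rot, map_add, map_mul, map_neg, Matrix.of_apply,
      Matrix.cons_val_zero, Matrix.cons_val_one, Matrix.cons_val', Matrix.cons_val_fin_one,
      Complex.conj_ofReal, Complex.conj_I, h1, h2]
    generalize Complex.exp (Complex.I * φ) = e at *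
    generalize Complex.exp (-Complex.I * φ) = e' at *
    linear_combination (q 0 * conj (q 0) + q 1 * conj (q 1)) * hsc'
      - (s : ℂ) ^ 2 * e * e' * (q 0 * conj (q 0) + q 1 * conj (q 1)) * hI
      + (s : ℂ) ^ 2 * (q 0 * conj (q 0) + q 1 * conj (q 1)) * h3
  exact_mod_cast this

/-- The sum of the squared absolute values of the matrix elements. -/
def sumSq (w : Fin 2 → Fin 2 → ℂ) : ℝ :=
  ‖w 0 0‖ ^ 2 + ‖w 0 1‖ ^ 2 + (‖w 1 0‖ ^ 2 + ‖w 1 1‖ ^ 2)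

/-- The rotation acts unitarily on one index at a time, which preserves the Frobenius norm. -/
theorem sumSq_rotW (θ φ : ℝ) (w : Fin 2 → Fin 2 → ℂ) : sumSq (rotW θ φ w) = sumSq w := by
  have h := fun b => sum_norm_sq_rotAmp θ φ (fun c => conj (rotAmp θ φ (w c) b))
  have h0 := h 0
  have h1 := h 1
  have g0 := sum_norm_sq_rotAmp θ φ (w 0)
  have g1 := sum_norm_sq_rotAmp θ φ (w 1)
  simp only [RCLike.norm_conj] at h0 h1
  simp only [sumSq, rotW, RCLike.norm_conj]
  linarith

theorem continuous_charW (L : ℕ) (a b : Fin 2) :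
    Continuous fun p : Params L × ℂ => charW L p.1 p.2 a b := by
  induction L generalizing a b with
  | zero =>
    fin_cases a <;> fin_cases b <;> simp [charW] <;> fun_prop
  | succ L ih =>
    have key : ∀ {z : Params (L + 1) × ℂ → ℂ}, Continuous z → ∀ a b,
        Continuous fun p : Params (L + 1) × ℂ =>
          rotW (p.1.2.1 (Fin.last L)) (p.1.2.2 (Fin.last L))
            (charW L (initParams p.1) (z p)) a b := fun hz a b =>
      continuous_rotW (by fun_prop) (by fun_prop) (fun c d =>
        (ih c d).comp ((continuous_initParams.comp continuous_fst).prodMk hz)) a b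
    fin_cases a <;> fin_cases b
    · exact Continuous.mul (by fun_prop) (key (by fun_prop) 1 1)
    · exact key (by fun_prop) 1 0
    · exact key (by fun_prop) 0 1
    · exact Continuous.mul (by fun_prop) (key (by fun_prop) 0 0)

theorem norm_charW_le (L : ℕ) (x : Params L) (ξ : ℂ) (a b : Fin 2) :
    ‖charW L x ξ a b‖ ≤ 4 ^ L := by
  induction L generalizing ξ a b with
  | zero =>
    have : Real.exp (-‖ξ‖ ^ 2 / 2) ≤ 1 := by
      rw [Real.exp_le_one_iff]; nlinarith [sq_nonneg ‖ξ‖]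
    have h : ‖(Real.exp (-‖ξ‖ ^ 2 / 2) : ℂ)‖ ≤ 1 := by
      rwa [Complex.norm_real, Real.norm_of_nonneg (Real.exp_nonneg _)]
    fin_cases a <;> fin_cases b
    · simpa [charW] using h
    · simp [charW]
    · simp [charW]
    · simp [charW]
  | succ L ih =>
    have key : ∀ ζ a b, ‖rotW (x.2.1 (Fin.last L)) (x.2.2 (Fin.last L))
        (charW L (initParams x) ζ) a b‖ ≤ 4 ^ (L + 1) := fun ζ a b => by
      rw [pow_succ']
      exact norm_rotW_le _ _ (fun c d => ih _ ζ c d) a b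
    fin_cases a <;> fin_cases b
    · change ‖Complex.exp (-(Complex.I * (_ : ℝ))) * _‖ ≤ _
      rw [norm_mul, norm_cexp_neg_I_mul, one_mul]
      exact key _ _ _
    · exact key _ _ _
    · exact key _ _ _
    · change ‖Complex.exp (Complex.I * (_ : ℝ)) * _‖ ≤ _
      rw [norm_mul, norm_cexp_I_mul, one_mul]
      exact key _ _ _

theorem norm_sq_le_sumSq (w : Fin 2 → Fin 2 → ℂ) (a b : Fin 2) : ‖w a b‖ ^ 2 ≤ sumSq w := by
  have h := fun c d => sq_nonneg ‖w c d‖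
  have h00 := h 0 0
  have h01 := h 0 1
  have h10 := h 1 0
  have h11 := h 1 1
  unfold sumSq
  fin_cases a <;> fin_cases b <;> simp only [Fin.zero_eta, Fin.mk_one] <;> linarith

/-- A Plancherel identity obtained by induction: a layer rotates the matrix unitarily, permutes its
entries, multiplies the diagonal by phases and translates the off-diagonal entries, none of which
changes the total integral. The value `π` is that of the vacuum. -/
theorem integrable_sumSq_charW (L : ℕ) (x : Params L) :
    Integrable (fun ξ => sumSq (charW L x ξ)) ∧ ∫ ξ, sumSq (charW L x ξ) = Real.pi := by
  induction L with
  | zero =>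
    have e : ∀ ξ, sumSq (charW 0 x ξ) = Real.exp (-(1 * ‖ξ‖ ^ 2)) := fun ξ => by
      simp only [sumSq, charW, Matrix.cons_val_zero, Matrix.cons_val_one, Matrix.cons_val_fin_one,
        norm_zero, Complex.norm_real]
      rw [Real.norm_of_nonneg (Real.exp_nonneg _), ← Real.exp_nat_mul]
      simp only [ne_eq, OfNat.ofNat_ne_zero, not_false_eq_true, zero_pow, add_zero]
      congr 1
      push_cast
      ring
    simp_rw [e]
    exact ⟨integrable_exp_neg_mul_norm_sq one_pos, by rw [integral_exp_neg_mul_norm_sq one_pos, div_one]⟩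
  | succ L ih =>
    set θ := x.2.1 (Fin.last L)
    set φ := x.2.2 (Fin.last L)
    set β := x.1 (Fin.last L)
    set R := fun ζ => rotW θ φ (charW L (initParams x) ζ) with hR
    obtain ⟨h1, h2⟩ := ih (initParams x)
    have hRs : ∀ ζ, sumSq (R ζ) = sumSq (charW L (initParams x) ζ) := fun ζ => sumSq_rotW _ _ _
    have hRc : ∀ a b, Continuous fun ζ => R ζ a b := fun a b =>
      continuous_rotW continuous_const continuous_const (fun c d =>
        (continuous_charW L c d).comp (continuous_const.prodMk continuous_id)) a b
    have hRi : ∀ a b, Integrable fun ζ => ‖R ζ a b‖ ^ 2 := fun a b => by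
      refine h1.mono' ((hRc a b).norm.pow 2).aestronglyMeasurable (ae_of_all _ fun ζ => ?_)
      rw [Real.norm_of_nonneg (by positivity), ← hRs]
      exact norm_sq_le_sumSq _ a b
    have e : ∀ ξ, sumSq (charW (L + 1) x ξ) = ‖R ξ 1 1‖ ^ 2 + ‖R (ξ + 2 * β) 1 0‖ ^ 2
        + (‖R (ξ - 2 * β) 0 1‖ ^ 2 + ‖R ξ 0 0‖ ^ 2) := fun ξ => by
      have e0 : ‖charW (L + 1) x ξ 0 0‖ = ‖R ξ 1 1‖ := by
        change ‖Complex.exp (-(Complex.I * (_ : ℝ))) * _‖ = _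
        rw [norm_mul, norm_cexp_neg_I_mul, one_mul]
      have e1 : ‖charW (L + 1) x ξ 1 1‖ = ‖R ξ 0 0‖ := by
        change ‖Complex.exp (Complex.I * (_ : ℝ)) * _‖ = _
        rw [norm_mul, norm_cexp_I_mul, one_mul]
      rw [sumSq, e0, e1]
      rfl
    have i10 := (hRi 1 0).comp_add_right (2 * β)
    have i01 := (hRi 0 1).comp_sub_right (2 * β)
    simp_rw [e]
    have j1 : Integrable fun ξ => ‖R ξ 1 1‖ ^ 2 + ‖R (ξ + 2 * β) 1 0‖ ^ 2 := (hRi 1 1).add i10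
    have j2 : Integrable fun ξ => ‖R (ξ - 2 * β) 0 1‖ ^ 2 + ‖R ξ 0 0‖ ^ 2 := i01.add (hRi 0 0)
    have j3 : Integrable fun ξ => ‖R ξ 0 0‖ ^ 2 + ‖R ξ 0 1‖ ^ 2 := (hRi 0 0).add (hRi 0 1)
    have j4 : Integrable fun ξ => ‖R ξ 1 0‖ ^ 2 + ‖R ξ 1 1‖ ^ 2 := (hRi 1 0).add (hRi 1 1)
    refine ⟨j1.add j2, ?_⟩
    rw [integral_add j1 j2, integral_add (hRi 1 1) i10,
      integral_add i01 (hRi 0 0), integral_add_right_eq_self (fun ζ => ‖R ζ 1 0‖ ^ 2),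
      integral_sub_right_eq_self (fun ζ => ‖R ζ 0 1‖ ^ 2), ← h2]
    simp_rw [← hRs, sumSq]
    rw [integral_add j3 j4,
      integral_add (hRi 0 0) (hRi 0 1), integral_add (hRi 1 0) (hRi 1 1)]
    ring

/-! ### Products of amplitudes as phase-space integrals -/

/-- The phase of `D(-x) D(ξ) D(y)` with respect to `D(ξ + y - x)`. -/
def weylPhase (ξ x y : ℂ) : ℂ :=
  Complex.exp (Complex.I * ((ξ * (conj x + conj y)).im - (x * conj y).im : ℝ))

theorem continuous_weylPhase (x y : ℂ) : Continuous fun ξ => weylPhase ξ x y := by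
  unfold weylPhase
  fun_prop

theorem norm_weylPhase (ξ x y : ℂ) : ‖weylPhase ξ x y‖ = 1 := norm_cexp_I_mul _

/-- This and the next three identities match the phases of a gate in `amp` with those in `charW`,
one for each choice of signs. Displacing `x` and `y` alike leaves a phase linear in `β`; displacing
them oppositely leaves none, and the argument of `charW` moves by `±2β` instead. -/
theorem weylPhase_sub_sub (ξ x y β : ℂ) :
    Complex.exp (Complex.I * (x * conj β).im) * Complex.exp (-(Complex.I * (y * conj β).im))
      * weylPhase ξ (x - β) (y - β)
    = weylPhase ξ x y * Complex.exp (-(Complex.I * (2 * ((ξ + y - x) * conj β).im : ℝ))) := by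
  rw [weylPhase, weylPhase, ← Complex.exp_add, ← Complex.exp_add, ← Complex.exp_add]
  congr 1
  rw [← mul_neg, ← mul_neg, ← mul_add, ← mul_add, ← mul_add]
  congr 1
  norm_cast
  simp
  ring

theorem weylPhase_add_add (ξ x y β : ℂ) :
    Complex.exp (-(Complex.I * (x * conj β).im)) * Complex.exp (Complex.I * (y * conj β).im)
      * weylPhase ξ (x + β) (y + β)
    = weylPhase ξ x y * Complex.exp (Complex.I * (2 * ((ξ + y - x) * conj β).im : ℝ)) := by
  rw [weylPhase, weylPhase, ← Complex.exp_add, ← Complex.exp_add, ← Complex.exp_add]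
  congr 1
  rw [← mul_neg, ← mul_add, ← mul_add, ← mul_add]
  congr 1
  norm_cast
  simp
  ring

theorem weylPhase_sub_add (ξ x y β : ℂ) :
    Complex.exp (Complex.I * (x * conj β).im) * Complex.exp (Complex.I * (y * conj β).im)
      * weylPhase ξ (x - β) (y + β) = weylPhase ξ x y := by
  rw [weylPhase, weylPhase, ← Complex.exp_add, ← Complex.exp_add]
  congr 1
  rw [← mul_add, ← mul_add]
  congr 1
  norm_cast
  simp
  ring

theorem weylPhase_add_sub (ξ x y β : ℂ) :
    Complex.exp (-(Complex.I * (x * conj β).im)) * Complex.exp (-(Complex.I * (y * conj β).im))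
      * weylPhase ξ (x + β) (y - β) = weylPhase ξ x y := by
  rw [weylPhase, weylPhase, ← Complex.exp_add, ← Complex.exp_add]
  congr 1
  rw [← mul_neg, ← mul_neg, ← mul_add, ← mul_add]
  congr 1
  norm_cast
  simp
  ring

theorem IsOverlap.integrable_chi_mul_charW {f : ℂ → ℂ} (hf : IsOverlap f) {L : ℕ} (p : Params L)
    (x y : ℂ) (a b : Fin 2) :
    Integrable fun ξ => chi f ξ * (weylPhase ξ x y * charW L p (ξ + y - x) a b) := by
  refine hf.integrable_chi.mul_bdd (c := 4 ^ L) ?_ (ae_of_all _ fun ξ => ?_)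
  · exact ((continuous_weylPhase x y).mul ((continuous_charW L a b).comp
      (by fun_prop : Continuous fun ξ : ℂ => (p, ξ + y - x)))).aestronglyMeasurable
  · rw [norm_mul, norm_weylPhase, one_mul]
    exact norm_charW_le _ _ _ _ _

theorem rotW_smul_integral {f : ℂ → ℂ} (hf : IsOverlap f) {L : ℕ} (p : Params L)
    (x y : ℂ) (θ φ : ℝ) (a b : Fin 2)
    (h : ∀ c d, conj (amp f L p x c) * amp f L p y d
      = (Real.pi : ℂ)⁻¹ * ∫ ξ, chi f ξ * (weylPhase ξ x y * charW L p (ξ + y - x) c d)) :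
    conj (rotAmp θ φ (amp f L p x) a) * rotAmp θ φ (amp f L p y) b
      = (Real.pi : ℂ)⁻¹ * ∫ ξ, chi f ξ * (weylPhase ξ x y *
          rotW θ φ (charW L p (ξ + y - x)) a b) := by
  have hi := fun c d => hf.integrable_chi_mul_charW p x y c d
  have e : ∀ ξ, chi f ξ * (weylPhase ξ x y * rotW θ φ (charW L p (ξ + y - x)) a b)
      = (conj (rot θ φ a 0) * rot θ φ b 0) * (chi f ξ * (weylPhase ξ x y * charW L p (ξ + y - x) 0 0))
      + (conj (rot θ φ a 0) * rot θ φ b 1) * (chi f ξ * (weylPhase ξ x y * charW L p (ξ + y - x) 0 1))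
      + ((conj (rot θ φ a 1) * rot θ φ b 0) * (chi f ξ * (weylPhase ξ x y * charW L p (ξ + y - x) 1 0))
      + (conj (rot θ φ a 1) * rot θ φ b 1) * (chi f ξ * (weylPhase ξ x y * charW L p (ξ + y - x) 1 1))) :=
    fun ξ => by
      simp only [rotW, rotAmp, map_add, map_mul, Complex.conj_conj]
      ring
  simp_rw [e]
  simp only [rotAmp, map_add, map_mul]
  generalize rot θ φ a 0 = r₁, rot θ φ a 1 = r₂, rot θ φ b 0 = r₃, rot θ φ b 1 = r₄
  have j1 : Integrable fun ξ =>
      (conj r₁ * r₃) * (chi f ξ * (weylPhase ξ x y * charW L p (ξ + y - x) 0 0))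
      + (conj r₁ * r₄) * (chi f ξ * (weylPhase ξ x y * charW L p (ξ + y - x) 0 1)) :=
    ((hi 0 0).const_mul _).add ((hi 0 1).const_mul _)
  have j2 : Integrable fun ξ =>
      (conj r₂ * r₃) * (chi f ξ * (weylPhase ξ x y * charW L p (ξ + y - x) 1 0))
      + (conj r₂ * r₄) * (chi f ξ * (weylPhase ξ x y * charW L p (ξ + y - x) 1 1)) :=
    ((hi 1 0).const_mul _).add ((hi 1 1).const_mul _)
  rw [integral_add j1 j2, integral_add ((hi 0 0).const_mul _) ((hi 0 1).const_mul _),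
    integral_add ((hi 1 0).const_mul _) ((hi 1 1).const_mul _), integral_const_mul,
    integral_const_mul, integral_const_mul, integral_const_mul]
  linear_combination (conj r₁ * r₃) * h 0 0 + (conj r₁ * r₄) * h 0 1 + (conj r₂ * r₃) * h 1 0
    + (conj r₂ * r₄) * h 1 1

/-- The projection on `ψ`, placed between `D(-x)` and `D(y)`, is replaced by its Weyl integral.
Independent `x` and `y` are needed even for `x = y`, because the gate moves them in opposite
directions when `a ≠ b`. -/
theorem IsOverlap.conj_amp_mul_amp {f : ℂ → ℂ} (hf : IsOverlap f) (L : ℕ) (p : Params L) (x y : ℂ)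
    (a b : Fin 2) :
    conj (amp f L p x a) * amp f L p y b
      = (Real.pi : ℂ)⁻¹ * ∫ ξ, chi f ξ * (weylPhase ξ x y * charW L p (ξ + y - x) a b) := by
  induction L generalizing x y a b with
  | zero =>
    fin_cases a <;> fin_cases b
    · have hpi : (Real.pi : ℂ) ≠ 0 := by exact_mod_cast Real.pi_ne_zero
      have h := hf.integral_chi_mul_weylInner x y
      simp only [weylInner_eq] at h
      change conj (f x) * f y = (Real.pi : ℂ)⁻¹ * ∫ ξ, chi f ξ * (weylPhase ξ x y *
        (Real.exp (-‖ξ + y - x‖ ^ 2 / 2) : ℂ))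
      simp only [weylPhase]
      rw [h]
      field_simp
    · simp [amp, charW]
    · simp [amp, charW]
    · simp [amp, charW]
  | succ L ih =>
    set θ := p.2.1 (Fin.last L) with hθ
    set φ := p.2.2 (Fin.last L) with hφ
    set β := p.1 (Fin.last L) with hβ
    set q := initParams p with hq
    have key := fun (x y : ℂ) (a b : Fin 2) =>
      rotW_smul_integral hf q x y θ φ a b (fun c d => ih q x y c d)
    have hc1 : ∀ r : ℝ, conj (Complex.exp (-(Complex.I * r))) = Complex.exp (Complex.I * r) :=
      fun r => by rw [← Complex.exp_conj]; simp
    have hc2 : ∀ r : ℝ, conj (Complex.exp (Complex.I * r)) = Complex.exp (-(Complex.I * r)) :=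
      fun r => by rw [← Complex.exp_conj]; simp
    fin_cases a <;> fin_cases b
    · change conj (Complex.exp (-(Complex.I * (x * conj β).im)) * rotAmp θ φ (amp f L q (x - β)) 1)
        * (Complex.exp (-(Complex.I * (y * conj β).im)) * rotAmp θ φ (amp f L q (y - β)) 1)
        = (Real.pi : ℂ)⁻¹ * ∫ ξ, chi f ξ * (weylPhase ξ x y *
          (Complex.exp (-(Complex.I * (2 * ((ξ + y - x) * conj β).im : ℝ))) *
            rotW θ φ (charW L q (ξ + y - x)) 1 1))
      rw [map_mul, hc1, mul_mul_mul_comm, key, mul_left_comm, ← integral_const_mul]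
      congr 1
      refine integral_congr_ae (ae_of_all _ fun ξ => ?_)
      have e : ξ + (y - β) - (x - β) = ξ + y - x := by ring
      simp only [e]
      linear_combination chi f ξ * rotW θ φ (charW L q (ξ + y - x)) 1 1 *
        weylPhase_sub_sub ξ x y β
    · change conj (Complex.exp (-(Complex.I * (x * conj β).im)) * rotAmp θ φ (amp f L q (x - β)) 1)
        * (Complex.exp (Complex.I * (y * conj β).im) * rotAmp θ φ (amp f L q (y + β)) 0)
        = (Real.pi : ℂ)⁻¹ * ∫ ξ, chi f ξ * (weylPhase ξ x y *
            rotW θ φ (charW L q (ξ + y - x + 2 * β)) 1 0)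
      rw [map_mul, hc1, mul_mul_mul_comm, key, mul_left_comm, ← integral_const_mul]
      congr 1
      refine integral_congr_ae (ae_of_all _ fun ξ => ?_)
      have e : ξ + (y + β) - (x - β) = ξ + y - x + 2 * β := by ring
      simp only [e]
      linear_combination chi f ξ * rotW θ φ (charW L q (ξ + y - x + 2 * β)) 1 0 *
        weylPhase_sub_add ξ x y β
    · change conj (Complex.exp (Complex.I * (x * conj β).im) * rotAmp θ φ (amp f L q (x + β)) 0)
        * (Complex.exp (-(Complex.I * (y * conj β).im)) * rotAmp θ φ (amp f L q (y - β)) 1)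
        = (Real.pi : ℂ)⁻¹ * ∫ ξ, chi f ξ * (weylPhase ξ x y *
            rotW θ φ (charW L q (ξ + y - x - 2 * β)) 0 1)
      rw [map_mul, hc2, mul_mul_mul_comm, key, mul_left_comm, ← integral_const_mul]
      congr 1
      refine integral_congr_ae (ae_of_all _ fun ξ => ?_)
      have e : ξ + (y - β) - (x + β) = ξ + y - x - 2 * β := by ring
      simp only [e]
      linear_combination chi f ξ * rotW θ φ (charW L q (ξ + y - x - 2 * β)) 0 1 *
        weylPhase_add_sub ξ x y β
    · change conj (Complex.exp (Complex.I * (x * conj β).im) * rotAmp θ φ (amp f L q (x + β)) 0)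
        * (Complex.exp (Complex.I * (y * conj β).im) * rotAmp θ φ (amp f L q (y + β)) 0)
        = (Real.pi : ℂ)⁻¹ * ∫ ξ, chi f ξ * (weylPhase ξ x y *
          (Complex.exp (Complex.I * (2 * ((ξ + y - x) * conj β).im : ℝ)) *
            rotW θ φ (charW L q (ξ + y - x)) 0 0))
      rw [map_mul, hc2, mul_mul_mul_comm, key, mul_left_comm, ← integral_const_mul]
      congr 1
      refine integral_congr_ae (ae_of_all _ fun ξ => ?_)
      have e : ξ + (y + β) - (x + β) = ξ + y - x := by ring
      simp only [e]
      linear_combination chi f ξ * rotW θ φ (charW L q (ξ + y - x)) 0 0 *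
        weylPhase_add_add ξ x y β

/-! ### Averages over the angles of a layer -/

theorem integral_uniformAngle_trig (A B C D F : ℂ) :
    ∫ t : ℝ, (A + B * Complex.exp (Complex.I * t) + C * Complex.exp (-Complex.I * t)
      + D * Complex.exp (Complex.I * t) ^ 2 + F * Complex.exp (-Complex.I * t) ^ 2) ∂uniformAngle
      = A := by
  have hB := integral_uniformAngle_cexp (k := 1) (by norm_num)
  have hC := integral_uniformAngle_cexp (k := -1) (by norm_num)
  have hD := integral_uniformAngle_cexp (k := 2) (by norm_num)
  have hF := integral_uniformAngle_cexp (k := -2) (by norm_num)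
  have e : ∀ t : ℝ, A + B * Complex.exp (Complex.I * t) + C * Complex.exp (-Complex.I * t)
      + D * Complex.exp (Complex.I * t) ^ 2 + F * Complex.exp (-Complex.I * t) ^ 2
      = A + B * Complex.exp ((1 : ℤ) * Complex.I * t) + C * Complex.exp ((-1 : ℤ) * Complex.I * t)
      + D * Complex.exp ((2 : ℤ) * Complex.I * t) + F * Complex.exp ((-2 : ℤ) * Complex.I * t) :=
    fun t => by
      rw [← Complex.exp_nat_mul, ← Complex.exp_nat_mul]
      push_cast
      ring_nf
  simp_rw [e]
  rw [integral_add, integral_add, integral_add, integral_add, integral_const_mul,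
    integral_const_mul, integral_const_mul, integral_const_mul, hB, hC, hD, hF]
  · simp
  all_goals exact integrable_uniformAngle (by fun_prop)

/-- Single cosines average to zero and both kinds of product average to `cos(δ - δ')/2`, so shifts
are felt only through their difference. -/
theorem integral_uniformAngle_cos (A B C D F : ℂ) (δ δ' : ℝ) :
    ∫ t : ℝ, (A + B * Real.cos (t + δ) + C * Real.cos (t + δ')
      + D * (Real.cos (t + δ) * Real.cos (t + δ')) + F * (Real.sin (t + δ) * Real.sin (t + δ')))
        ∂uniformAngle = A + Real.cos (δ - δ') / 2 * (D + F) := by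
  have hcos : ∀ t d : ℝ, (Real.cos (t + d) : ℂ) = (Complex.exp (Complex.I * d) *
      Complex.exp (Complex.I * t) + Complex.exp (-Complex.I * d) * Complex.exp (-Complex.I * t)) / 2 :=
    fun t d => by
      rw [← Complex.exp_add, ← Complex.exp_add, Complex.ofReal_cos, Complex.cos]
      push_cast
      ring_nf
  have hsin : ∀ t d : ℝ, (Real.sin (t + d) : ℂ) = (Complex.exp (-Complex.I * d) *
      Complex.exp (-Complex.I * t) - Complex.exp (Complex.I * d) * Complex.exp (Complex.I * t))
        * Complex.I / 2 :=
    fun t d => by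
      rw [← Complex.exp_add, ← Complex.exp_add, Complex.ofReal_sin, Complex.sin]
      push_cast
      ring_nf
  have hκ : (Real.cos (δ - δ') : ℂ) = (Complex.exp (Complex.I * δ) * Complex.exp (-Complex.I * δ')
      + Complex.exp (-Complex.I * δ) * Complex.exp (Complex.I * δ')) / 2 := by
    rw [← Complex.exp_add, ← Complex.exp_add, Complex.ofReal_cos, Complex.cos]
    push_cast
    ring_nf
  have h1 : ∀ t : ℝ, Complex.exp (Complex.I * t) * Complex.exp (-Complex.I * t) = 1 := fun t => by
    rw [← Complex.exp_add]; simp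
  rw [hκ]
  generalize hu : Complex.exp (Complex.I * δ) = u at *
  generalize hu' : Complex.exp (-Complex.I * δ) = u' at *
  generalize hv : Complex.exp (Complex.I * δ') = v at *
  generalize hv' : Complex.exp (-Complex.I * δ') = v' at *
  rw [← integral_uniformAngle_trig (A + (u * v' + u' * v) / 2 / 2 * (D + F))
    (B * u / 2 + C * v / 2) (B * u' / 2 + C * v' / 2) ((D - F) * u * v / 4) ((D - F) * u' * v' / 4)]
  refine integral_congr_ae (ae_of_all _ fun t => ?_)
  simp only [hcos, hsin, hu, hu', hv, hv']
  linear_combination ((D + F) / 4 * (u * v' + u' * v)) * h1 t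
    + (F / 4 * (u' * Complex.exp (-Complex.I * t) - u * Complex.exp (Complex.I * t)) *
      (v' * Complex.exp (-Complex.I * t) - v * Complex.exp (Complex.I * t))) * Complex.I_mul_I

/-- The traceless part of a rotated matrix. -/
def rotDiff (θ φ : ℝ) (w : Fin 2 → Fin 2 → ℂ) : ℂ :=
  Real.cos θ * (w 0 0 - w 1 1) + Real.sin θ *
    (-Complex.I * Complex.exp (-Complex.I * φ) * w 0 1 + Complex.I * Complex.exp (Complex.I * φ) * w 1 0)

theorem rotW_zero_zero (θ φ : ℝ) (w : Fin 2 → Fin 2 → ℂ) :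
    rotW θ φ w 0 0 = (w 0 0 + w 1 1 + rotDiff θ φ w) / 2 := by
  have hc : (Real.cos θ : ℂ) = 2 * (Real.cos (θ / 2) : ℂ) ^ 2 - 1 := by
    rw [show θ = 2 * (θ / 2) by ring, Real.cos_two_mul]
    push_cast
    ring_nf
  have hs : (Real.sin θ : ℂ) = 2 * Real.sin (θ / 2) * Real.cos (θ / 2) := by
    rw [show θ = 2 * (θ / 2) by ring, Real.sin_two_mul]
    push_cast
    ring_nf
  have hsc : (Real.sin (θ / 2) : ℂ) ^ 2 + (Real.cos (θ / 2) : ℂ) ^ 2 = 1 := by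
    exact_mod_cast Real.sin_sq_add_cos_sq _
  have h1 : conj (Complex.exp (Complex.I * φ)) = Complex.exp (-Complex.I * φ) := by
    rw [← Complex.exp_conj]; simp
  have h2 : conj (Complex.exp (-Complex.I * φ)) = Complex.exp (Complex.I * φ) := by
    rw [← Complex.exp_conj]; simp
  have h3 : Complex.exp (Complex.I * φ) * Complex.exp (-Complex.I * φ) = 1 := by
    rw [← Complex.exp_add]; simp
  rw [rotDiff, hc, hs]
  simp only [rotW, rotAmp, rot, map_add, map_mul, map_neg, Matrix.of_apply,
    Matrix.cons_val_zero, Matrix.cons_val_one, Matrix.cons_val', Matrix.cons_val_fin_one,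
    Complex.conj_ofReal, Complex.conj_I, Complex.conj_conj, h1, h2]
  generalize Complex.exp (Complex.I * φ) = e at *
  generalize Complex.exp (-Complex.I * φ) = e' at *
  generalize (Real.sin (θ / 2) : ℂ) = s at *
  generalize (Real.cos (θ / 2) : ℂ) = c at *
  linear_combination (w 1 1) * hsc - (s ^ 2 * e * e' * w 1 1) * Complex.I_mul_I
    + (s ^ 2 * w 1 1) * h3

theorem rotW_one_one (θ φ : ℝ) (w : Fin 2 → Fin 2 → ℂ) :
    rotW θ φ w 1 1 = (w 0 0 + w 1 1 - rotDiff θ φ w) / 2 := by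
  have hc : (Real.cos θ : ℂ) = 2 * (Real.cos (θ / 2) : ℂ) ^ 2 - 1 := by
    rw [show θ = 2 * (θ / 2) by ring, Real.cos_two_mul]
    push_cast
    ring_nf
  have hs : (Real.sin θ : ℂ) = 2 * Real.sin (θ / 2) * Real.cos (θ / 2) := by
    rw [show θ = 2 * (θ / 2) by ring, Real.sin_two_mul]
    push_cast
    ring_nf
  have hsc : (Real.sin (θ / 2) : ℂ) ^ 2 + (Real.cos (θ / 2) : ℂ) ^ 2 = 1 := by
    exact_mod_cast Real.sin_sq_add_cos_sq _
  have h1 : conj (Complex.exp (Complex.I * φ)) = Complex.exp (-Complex.I * φ) := by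
    rw [← Complex.exp_conj]; simp
  have h2 : conj (Complex.exp (-Complex.I * φ)) = Complex.exp (Complex.I * φ) := by
    rw [← Complex.exp_conj]; simp
  have h3 : Complex.exp (Complex.I * φ) * Complex.exp (-Complex.I * φ) = 1 := by
    rw [← Complex.exp_add]; simp
  rw [rotDiff, hc, hs]
  simp only [rotW, rotAmp, rot, map_add, map_mul, map_neg, Matrix.of_apply,
    Matrix.cons_val_zero, Matrix.cons_val_one, Matrix.cons_val', Matrix.cons_val_fin_one,
    Complex.conj_ofReal, Complex.conj_I, Complex.conj_conj, h1, h2]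
  generalize Complex.exp (Complex.I * φ) = e at *
  generalize Complex.exp (-Complex.I * φ) = e' at *
  generalize (Real.sin (θ / 2) : ℂ) = s at *
  generalize (Real.cos (θ / 2) : ℂ) = c at *
  linear_combination (w 0 0) * hsc - (s ^ 2 * e * e' * w 0 0) * Complex.I_mul_I
    + (s ^ 2 * w 0 0) * h3

/-! ### Contractions of two copies of the circuit -/

/-- The part of `w ⊗ w'` on which both copies are in the same state of the qubit. -/
def corrM (w w' : Fin 2 → Fin 2 → ℂ) : ℂ := w 0 0 * w' 0 0 + w 1 1 * w' 1 1

/-- The part of `w ⊗ w'` on which the copies are in different states of the qubit. -/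
def corrA (w w' : Fin 2 → Fin 2 → ℂ) : ℂ := w 0 0 * w' 1 1 + w 1 1 * w' 0 0

/-- The coherences of `w ⊗ w'`. -/
def corrB (w w' : Fin 2 → Fin 2 → ℂ) : ℂ := w 0 1 * w' 1 0 + w 1 0 * w' 0 1

/-- The average over `φ` keeps only phase-neutral products of off-diagonal entries, which form
`corrB`; the average over `θ` then weights everything quadratic by `cos(δ - δ')/2`. The free
coefficients cover all diagonal entries of both copies and, with `y' = 0`, the first moment. -/
theorem integral_affine_rotDiff (x y x' y' : ℂ) (δ δ' : ℝ) (w w' : Fin 2 → Fin 2 → ℂ) :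
    ∫ θ, ∫ φ, (x + y * rotDiff (θ + δ) φ w) * (x' + y' * rotDiff (θ + δ') φ w')
      ∂uniformAngle ∂uniformAngle
      = x * x' + y * y' * (Real.cos (δ - δ') / 2 *
        ((w 0 0 - w 1 1) * (w' 0 0 - w' 1 1) + corrB w w')) := by
  have h1 : ∀ t : ℝ, Complex.exp (Complex.I * t) * Complex.exp (-Complex.I * t) = 1 := fun t => by
    rw [← Complex.exp_add]; simp
  have key : ∀ θ : ℝ, ∫ φ, (x + y * rotDiff (θ + δ) φ w) * (x' + y' * rotDiff (θ + δ') φ w')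
      ∂uniformAngle = x * x' + (x' * y * (w 0 0 - w 1 1)) * Real.cos (θ + δ)
        + (x * y' * (w' 0 0 - w' 1 1)) * Real.cos (θ + δ')
        + (y * y' * ((w 0 0 - w 1 1) * (w' 0 0 - w' 1 1))) *
          (Real.cos (θ + δ) * Real.cos (θ + δ'))
        + (y * y' * corrB w w') * (Real.sin (θ + δ) * Real.sin (θ + δ')) := fun θ => by
    generalize hX : x + y * (Real.cos (θ + δ) * (w 0 0 - w 1 1)) = X
    generalize hX' : x' + y' * (Real.cos (θ + δ') * (w' 0 0 - w' 1 1)) = X'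
    generalize hS : (Real.sin (θ + δ) : ℂ) = S
    generalize hS' : (Real.sin (θ + δ') : ℂ) = S'
    have := integral_uniformAngle_trig (X * X' + y * y' * S * S' * corrB w w')
      (Complex.I * (X * y' * S' * w' 1 0 + X' * y * S * w 1 0))
      (-Complex.I * (X * y' * S' * w' 0 1 + X' * y * S * w 0 1))
      (-(y * y' * S * S' * w 1 0 * w' 1 0)) (-(y * y' * S * S' * w 0 1 * w' 0 1))
    trans X * X' + y * y' * S * S' * corrB w w'
    · rw [← this]
      refine integral_congr_ae (ae_of_all _ fun φ => ?_)
      simp only [rotDiff, hS, hS', corrB]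
      rw [← hX, ← hX']
      generalize hc : Complex.exp (Complex.I * φ) = e
      generalize hc' : Complex.exp (-Complex.I * φ) = e'
      have h1' : e * e' = 1 := by rw [← hc, ← hc']; exact h1 φ
      linear_combination (y * y' * S * S' * (e' ^ 2 * w 0 1 * w' 0 1 + e ^ 2 * w 1 0 * w' 1 0
          - e * e' * (w 0 1 * w' 1 0 + w 1 0 * w' 0 1))) * Complex.I_mul_I
        + (y * y' * S * S' * (w 0 1 * w' 1 0 + w 1 0 * w' 0 1)) * h1'
    · rw [← hX, ← hX']
      ring
  simp_rw [key]
  rw [integral_uniformAngle_cos]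
  ring

/-- The same-state part after a layer whose angles differ by `arccos κ` between the copies. -/
def mixM (κ : ℂ) (m a b : ℂ) : ℂ := ((1 + κ / 2) * m + (1 - κ / 2) * a + κ / 2 * b) / 2

/-- The different-state part after a layer whose angles differ by `arccos κ` between the copies. -/
def mixA (κ : ℂ) (m a b : ℂ) : ℂ := ((1 - κ / 2) * m + (1 + κ / 2) * a - κ / 2 * b) / 2

theorem integral_rotW_same (δ δ' : ℝ) (w w' : Fin 2 → Fin 2 → ℂ) (a : Fin 2) :
    ∫ θ, ∫ φ, rotW (θ + δ) φ w a a * rotW (θ + δ') φ w' a a ∂uniformAngle ∂uniformAngle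
      = mixM (Real.cos (δ - δ')) (corrM w w') (corrA w w') (corrB w w') / 2 := by
  fin_cases a
  · have := integral_affine_rotDiff ((w 0 0 + w 1 1) / 2) (1 / 2) ((w' 0 0 + w' 1 1) / 2) (1 / 2)
      δ δ' w w'
    simp only [Fin.zero_eta, rotW_zero_zero]
    convert this using 1
    · congr! 4
      ring
    · simp only [mixM, corrM, corrA, corrB]
      ring
  · have := integral_affine_rotDiff ((w 0 0 + w 1 1) / 2) (-1 / 2) ((w' 0 0 + w' 1 1) / 2) (-1 / 2)
      δ δ' w w'
    simp only [Fin.mk_one, rotW_one_one]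
    convert this using 1
    · congr! 4
      ring
    · simp only [mixM, corrM, corrA, corrB]
      ring

theorem integral_rotW_diff (δ δ' : ℝ) (w w' : Fin 2 → Fin 2 → ℂ) {a b : Fin 2} (hab : a ≠ b) :
    ∫ θ, ∫ φ, rotW (θ + δ) φ w a a * rotW (θ + δ') φ w' b b ∂uniformAngle ∂uniformAngle
      = mixA (Real.cos (δ - δ')) (corrM w w') (corrA w w') (corrB w w') / 2 := by
  have h01 := integral_affine_rotDiff ((w 0 0 + w 1 1) / 2) (1 / 2) ((w' 0 0 + w' 1 1) / 2) (-1 / 2)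
    δ δ' w w'
  have h10 := integral_affine_rotDiff ((w 0 0 + w 1 1) / 2) (-1 / 2) ((w' 0 0 + w' 1 1) / 2) (1 / 2)
    δ δ' w w'
  fin_cases a <;> fin_cases b
  · exact absurd rfl hab
  · simp only [Fin.zero_eta, Fin.mk_one, rotW_zero_zero, rotW_one_one]
    convert h01 using 1
    · congr! 4
      ring
    · simp only [mixA, corrM, corrA, corrB]
      ring
  · simp only [Fin.zero_eta, Fin.mk_one, rotW_zero_zero, rotW_one_one]
    convert h10 using 1
    · congr! 4
      ring
    · simp only [mixA, corrM, corrA, corrB]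
      ring
  · exact absurd rfl hab

theorem integral_rotW (δ : ℝ) (w : Fin 2 → Fin 2 → ℂ) (a : Fin 2) :
    ∫ θ, ∫ φ, rotW (θ + δ) φ w a a ∂uniformAngle ∂uniformAngle = (w 0 0 + w 1 1) / 2 := by
  have h := fun y => integral_affine_rotDiff ((w 0 0 + w 1 1) / 2) y 1 0 δ δ w w
  fin_cases a
  · simp only [Fin.zero_eta, rotW_zero_zero]
    convert h (1 / 2) using 1
    · congr! 4
      ring
    · ring
  · simp only [Fin.mk_one, rotW_one_one]
    convert h (-1 / 2) using 1
    · congr! 4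
      ring
    · ring

/-! ### The ensemble, layer by layer -/

/-- The ensemble of depth `L` with variance `s` per displacement. -/
def ens (s : ℝ) (L : ℕ) : Measure (Params L) :=
  (Measure.pi fun _ : Fin L => complexGaussian s).prod
    ((Measure.pi fun _ : Fin L => uniformAngle).prod (Measure.pi fun _ : Fin L => uniformAngle))

instance isProbabilityMeasure_ens (s : ℝ) (L : ℕ) : IsProbabilityMeasure (ens s L) := by
  unfold ens
  infer_instance

/-- The law of the parameters of a single layer. -/
def layerLaw (s : ℝ) : Measure (ℂ × ℝ × ℝ) :=
  (complexGaussian s).prod (uniformAngle.prod uniformAngle)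

instance isProbabilityMeasure_layerLaw (s : ℝ) : IsProbabilityMeasure (layerLaw s) := by
  unfold layerLaw
  infer_instance

/-- A circuit with one more layer. -/
def snocParams {L : ℕ} (y : Params L) (q : ℂ × ℝ × ℝ) : Params (L + 1) :=
  (Fin.snoc y.1 q.1, Fin.snoc y.2.1 q.2.1, Fin.snoc y.2.2 q.2.2)

theorem initParams_snocParams {L : ℕ} (y : Params L) (q : ℂ × ℝ × ℝ) :
    initParams (snocParams y q) = y := by
  simp [initParams, snocParams]

theorem continuous_snocParams {L : ℕ} :
    Continuous fun p : Params L × (ℂ × ℝ × ℝ) => snocParams p.1 p.2 := by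
  unfold snocParams
  fun_prop

theorem measurePreserving_prodProdComm {α β γ δ : Type*} [MeasurableSpace α] [MeasurableSpace β]
    [MeasurableSpace γ] [MeasurableSpace δ] (μ : Measure α) (ν : Measure β) (ρ : Measure γ)
    (σ : Measure δ) [SFinite μ] [SFinite ν] [SFinite ρ] [SFinite σ] :
    MeasurePreserving (fun p : (α × β) × (γ × δ) => ((p.1.1, p.2.1), (p.1.2, p.2.2)))
      ((μ.prod ν).prod (ρ.prod σ)) ((μ.prod ρ).prod (ν.prod σ)) := by
  have h1 := measurePreserving_prodAssoc μ ν (ρ.prod σ)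
  have h2 := (MeasurePreserving.id μ).prod (measurePreserving_prodAssoc ν ρ σ).symm
  have h3 := (MeasurePreserving.id μ).prod
    ((Measure.measurePreserving_swap (μ := ν) (ν := ρ)).prod (MeasurePreserving.id σ))
  have h4 := (MeasurePreserving.id μ).prod (measurePreserving_prodAssoc ρ ν σ)
  have h5 := (measurePreserving_prodAssoc μ ρ (ν.prod σ)).symm
  exact h5.comp (h4.comp (h3.comp (h2.comp h1)))

theorem measurePreserving_snoc {α : Type} [MeasurableSpace α] (μ : Measure α) [SigmaFinite μ]
    (L : ℕ) :
    MeasurePreserving (fun p : (Fin L → α) × α => (Fin.snoc p.1 p.2 : Fin (L + 1) → α))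
      ((Measure.pi fun _ => μ).prod μ) (Measure.pi fun _ => μ) := by
  have h := (measurePreserving_piFinSuccAbove (fun _ : Fin (L + 1) => μ) (Fin.last L)).symm
  have := h.comp (Measure.measurePreserving_swap (μ := Measure.pi fun _ : Fin L => μ) (ν := μ))
  convert this using 1
  funext p
  simp [MeasurableEquiv.piFinSuccAbove]
  rfl

/-- Each of the three families of parameters splits off its last coordinate, and the factors are
regrouped layer by layer. All recursions for averages start here. -/
theorem measurePreserving_snocParams (s : ℝ) (L : ℕ) :
    MeasurePreserving (fun p : Params L × (ℂ × ℝ × ℝ) => snocParams p.1 p.2)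
      ((ens s L).prod (layerLaw s)) (ens s (L + 1)) := by
  have hU := measurePreserving_snoc uniformAngle L
  have h1 := (measurePreserving_snoc (complexGaussian s) L).prod (hU.prod hU)
  have h2 := (MeasurePreserving.id ((Measure.pi fun _ : Fin L => complexGaussian s).prod
    (complexGaussian s))).prod (measurePreserving_prodProdComm
      (Measure.pi fun _ : Fin L => uniformAngle) (Measure.pi fun _ : Fin L => uniformAngle)
      uniformAngle uniformAngle)
  have h3 := measurePreserving_prodProdComm (Measure.pi fun _ : Fin L => complexGaussian s)
    ((Measure.pi fun _ : Fin L => uniformAngle).prod (Measure.pi fun _ : Fin L => uniformAngle))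
    (complexGaussian s) (uniformAngle.prod uniformAngle)
  exact h1.comp (h2.comp h3)

theorem integrable_of_continuous {X : Type*} [TopologicalSpace X] [MeasurableSpace X]
    [OpensMeasurableSpace X] [SecondCountableTopology X] (μ : Measure X) [IsFiniteMeasure μ]
    {F : X → ℂ} (hF : Continuous F) {B : ℝ} (hB : ∀ x, ‖F x‖ ≤ B) : Integrable F μ :=
  Integrable.of_bound hF.aestronglyMeasurable B (ae_of_all _ hB)

theorem integral_ens_succ (s : ℝ) (L : ℕ) {F : Params (L + 1) → ℂ} (hF : Continuous F) {B : ℝ}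
    (hB : ∀ x, ‖F x‖ ≤ B) :
    ∫ x, F x ∂ens s (L + 1)
      = ∫ y, ∫ q, F (snocParams y q) ∂layerLaw s ∂ens s L := by
  have h := measurePreserving_snocParams s L
  rw [← h.map_eq, integral_map h.measurable.aemeasurable hF.aestronglyMeasurable]
  exact integral_prod _ (integrable_of_continuous _ (hF.comp continuous_snocParams)
    (fun p => hB _))

theorem integral_layerLaw (s : ℝ) {F : ℂ × ℝ × ℝ → ℂ} (hF : Continuous F) {B : ℝ}
    (hB : ∀ q, ‖F q‖ ≤ B) :
    ∫ q, F q ∂layerLaw s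
      = ∫ β, ∫ θ, ∫ φ, F (β, θ, φ) ∂uniformAngle ∂uniformAngle ∂complexGaussian s := by
  rw [layerLaw, integral_prod _ (integrable_of_continuous _ hF hB)]
  congr 1
  funext β
  exact integral_prod _ (integrable_of_continuous _ (hF.comp (by fun_prop)) (fun p => hB _))

theorem integral_layerLaw_symm (s : ℝ) {F : ℂ × ℝ × ℝ → ℂ} (hF : Continuous F) {B : ℝ}
    (hB : ∀ q, ‖F q‖ ≤ B) :
    ∫ q, F q ∂layerLaw s
      = ∫ t, ∫ β, F (β, t) ∂complexGaussian s ∂uniformAngle.prod uniformAngle := by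
  rw [layerLaw, integral_prod_symm _ (integrable_of_continuous _ hF hB)]

theorem continuous_integral {X Y : Type*} [TopologicalSpace X] [FirstCountableTopology X]
    [TopologicalSpace Y] [MeasurableSpace Y] [OpensMeasurableSpace Y] [SecondCountableTopology Y]
    (μ : Measure Y) [IsFiniteMeasure μ] {F : X × Y → ℂ} (hF : Continuous F) {B : ℝ}
    (hB : ∀ p, ‖F p‖ ≤ B) : Continuous fun x => ∫ y, F (x, y) ∂μ :=
  continuous_of_dominated (bound := fun _ => B)
    (fun x => (hF.comp (by fun_prop : Continuous fun y : Y => (x, y))).aestronglyMeasurable)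
    (fun x => ae_of_all _ fun y => hB _) (integrable_const _)
    (ae_of_all _ fun y => hF.comp (by fun_prop : Continuous fun x : X => (x, y)))

theorem norm_integral_le_of_norm_le_const_prob {Y : Type*} [MeasurableSpace Y] (μ : Measure Y)
    [IsProbabilityMeasure μ] {F : Y → ℂ} {B : ℝ} (hB : ∀ p, ‖F p‖ ≤ B) : ‖∫ y, F y ∂μ‖ ≤ B := by
  simpa using norm_integral_le_of_norm_le_const (μ := μ) (ae_of_all _ hB)

/-! ### The second moments of the amplitudes -/

/-- The products `A̅_a A_b` of the amplitudes. -/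
def ampW (f : ℂ → ℂ) (L : ℕ) (x : Params L) (g : ℂ) (a b : Fin 2) : ℂ :=
  conj (amp f L x g a) * amp f L x g b

theorem continuous_ampW {f : ℂ → ℂ} (hf : Continuous f) (L : ℕ) (a b : Fin 2) :
    Continuous fun p : Params L × ℂ => ampW f L p.1 p.2 a b :=
  (Complex.continuous_conj.comp (continuous_amp hf L a)).mul (continuous_amp hf L b)

theorem norm_ampW_le {f : ℂ → ℂ} {B : ℝ} (hB : ∀ z, ‖f z‖ ≤ B) (L : ℕ) (x : Params L) (g : ℂ)
    (a b : Fin 2) : ‖ampW f L x g a b‖ ≤ (2 ^ L * B) ^ 2 := by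
  have h := norm_amp_le hB L x g
  rw [ampW, norm_mul, RCLike.norm_conj, sq]
  exact mul_le_mul (h a) (h b) (norm_nonneg _) ((norm_nonneg _).trans (h a))

/-- On the diagonal the phase of the gate cancels against its conjugate; only the displacement of
`g` and the flip of the qubit are left. -/
theorem ampW_shiftAngles_snocParams_zero (f : ℂ → ℂ) (ε : ℕ → ℝ) {L : ℕ} (y : Params L)
    (q : ℂ × ℝ × ℝ) (g : ℂ) :
    ampW f (L + 1) (shiftAngles ε (snocParams y q)) g 0 0
      = rotW (q.2.1 + ε L) q.2.2 (ampW f L (shiftAngles ε y) (g - q.1)) 1 1 := by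
  have e : ampW f (L + 1) (shiftAngles ε (snocParams y q)) g 0 0
      = conj (rotAmp (q.2.1 + ε L) q.2.2 (amp f L (shiftAngles ε y) (g - q.1)) 1)
        * rotAmp (q.2.1 + ε L) q.2.2 (amp f L (shiftAngles ε y) (g - q.1)) 1 := by
    simp only [ampW, amp, Matrix.cons_val_zero, map_mul, initParams_shiftAngles,
      initParams_snocParams]
    rw [mul_mul_mul_comm, Complex.conj_mul', norm_cexp_neg_I_mul]
    simp [shiftAngles, snocParams]
  rw [e, ← rotW_mul]
  rfl

theorem ampW_shiftAngles_snocParams_one (f : ℂ → ℂ) (ε : ℕ → ℝ) {L : ℕ} (y : Params L)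
    (q : ℂ × ℝ × ℝ) (g : ℂ) :
    ampW f (L + 1) (shiftAngles ε (snocParams y q)) g 1 1
      = rotW (q.2.1 + ε L) q.2.2 (ampW f L (shiftAngles ε y) (g + q.1)) 0 0 := by
  have e : ampW f (L + 1) (shiftAngles ε (snocParams y q)) g 1 1
      = conj (rotAmp (q.2.1 + ε L) q.2.2 (amp f L (shiftAngles ε y) (g + q.1)) 0)
        * rotAmp (q.2.1 + ε L) q.2.2 (amp f L (shiftAngles ε y) (g + q.1)) 0 := by
    simp only [ampW, amp, Matrix.cons_val_one, Matrix.cons_val_fin_one, map_mul,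
      initParams_shiftAngles, initParams_snocParams]
    rw [mul_mul_mul_comm, Complex.conj_mul', norm_cexp_I_mul]
    simp [shiftAngles, snocParams]
  rw [e, ← rotW_mul]
  rfl

/-- The contractions `corrM`, `corrA` and `corrB` are sums of two products of entries. -/
def IsCorr (K : (Fin 2 → Fin 2 → ℂ) → (Fin 2 → Fin 2 → ℂ) → ℂ) : Prop :=
  ∃ a b c d a' b' c' d' : Fin 2, ∀ w w', K w w' = w a b * w' c d + w a' b' * w' c' d'

theorem isCorr_corrM : IsCorr corrM := ⟨0, 0, 0, 0, 1, 1, 1, 1, fun _ _ => rfl⟩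

theorem isCorr_corrA : IsCorr corrA := ⟨0, 0, 1, 1, 1, 1, 0, 0, fun _ _ => rfl⟩

theorem isCorr_corrB : IsCorr corrB := ⟨0, 1, 1, 0, 1, 0, 0, 1, fun _ _ => rfl⟩

theorem IsCorr.continuous {K : (Fin 2 → Fin 2 → ℂ) → (Fin 2 → Fin 2 → ℂ) → ℂ} (hK : IsCorr K)
    {X : Type*} [TopologicalSpace X] {w w' : X → Fin 2 → Fin 2 → ℂ}
    (hw : ∀ a b, Continuous fun x => w x a b) (hw' : ∀ a b, Continuous fun x => w' x a b) :
    Continuous fun x => K (w x) (w' x) := by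
  obtain ⟨a, b, c, d, a', b', c', d', h⟩ := hK
  simp only [h]
  exact ((hw _ _).mul (hw' _ _)).add ((hw _ _).mul (hw' _ _))

theorem IsCorr.norm_le {K : (Fin 2 → Fin 2 → ℂ) → (Fin 2 → Fin 2 → ℂ) → ℂ} (hK : IsCorr K)
    {w w' : Fin 2 → Fin 2 → ℂ} {B : ℝ} (hw : ∀ a b, ‖w a b‖ ≤ B) (hw' : ∀ a b, ‖w' a b‖ ≤ B) :
    ‖K w w'‖ ≤ 2 * B ^ 2 := by
  obtain ⟨a, b, c, d, a', b', c', d', h⟩ := hK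
  rw [h]
  have h0 : 0 ≤ B := (norm_nonneg _).trans (hw 0 0)
  have key : ∀ a b c d, ‖w a b * w' c d‖ ≤ B ^ 2 := fun a b c d => by
    rw [norm_mul, sq]
    exact mul_le_mul (hw _ _) (hw' _ _) (norm_nonneg _) h0
  linarith [norm_add_le (w a b * w' c d) (w a' b' * w' c' d'), key a b c d, key a' b' c' d']

theorem integral_mixM {Y : Type*} [MeasurableSpace Y] {μ : Measure Y} (κ : ℂ) {m a b : Y → ℂ}
    (hm : Integrable m μ) (ha : Integrable a μ) (hb : Integrable b μ) :
    ∫ y, mixM κ (m y) (a y) (b y) ∂μ = mixM κ (∫ y, m y ∂μ) (∫ y, a y ∂μ) (∫ y, b y ∂μ) := by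
  have h1 : Integrable (fun y => (1 + κ / 2) * m y + (1 - κ / 2) * a y) μ :=
    (hm.const_mul _).add (ha.const_mul _)
  simp only [mixM]
  rw [integral_div, integral_add h1 (hb.const_mul _),
    integral_add (hm.const_mul _) (ha.const_mul _), integral_const_mul, integral_const_mul,
    integral_const_mul]

theorem integral_mixA {Y : Type*} [MeasurableSpace Y] {μ : Measure Y} (κ : ℂ) {m a b : Y → ℂ}
    (hm : Integrable m μ) (ha : Integrable a μ) (hb : Integrable b μ) :
    ∫ y, mixA κ (m y) (a y) (b y) ∂μ = mixA κ (∫ y, m y ∂μ) (∫ y, a y ∂μ) (∫ y, b y ∂μ) := by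
  have h1 : Integrable (fun y => (1 - κ / 2) * m y + (1 + κ / 2) * a y) μ :=
    (hm.const_mul _).add (ha.const_mul _)
  simp only [mixA]
  rw [integral_div, integral_sub h1 (hb.const_mul _),
    integral_add (hm.const_mul _) (ha.const_mul _), integral_const_mul, integral_const_mul,
    integral_const_mul]

theorem continuous_mixM {X : Type*} [TopologicalSpace X] (κ : ℂ) {m a b : X → ℂ}
    (hm : Continuous m) (ha : Continuous a) (hb : Continuous b) :
    Continuous fun x => mixM κ (m x) (a x) (b x) := by
  unfold mixM
  fun_prop

theorem norm_mixM_le {κ m a b : ℂ} {B : ℝ} (hκ : ‖κ‖ ≤ 1) (hm : ‖m‖ ≤ B) (ha : ‖a‖ ≤ B)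
    (hb : ‖b‖ ≤ B) : ‖mixM κ m a b‖ ≤ 2 * B := by
  have h0 : 0 ≤ B := (norm_nonneg _).trans hm
  have h1 : ‖(1 + κ / 2) * m‖ ≤ 3 / 2 * B := by
    rw [norm_mul]
    refine mul_le_mul ((norm_add_le _ _).trans ?_) hm (norm_nonneg _) (by norm_num)
    rw [norm_one, norm_div, Complex.norm_ofNat]
    linarith
  have h2 : ‖(1 - κ / 2) * a‖ ≤ 3 / 2 * B := by
    rw [norm_mul]
    refine mul_le_mul ((norm_sub_le _ _).trans ?_) ha (norm_nonneg _) (by norm_num)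
    rw [norm_one, norm_div, Complex.norm_ofNat]
    linarith
  have h3 : ‖κ / 2 * b‖ ≤ 1 / 2 * B := by
    rw [norm_mul]
    refine mul_le_mul ?_ hb (norm_nonneg _) (by norm_num)
    rw [norm_div, Complex.norm_ofNat]
    linarith
  rw [mixM, norm_div, Complex.norm_ofNat]
  have := norm_add_le ((1 + κ / 2) * m + (1 - κ / 2) * a) (κ / 2 * b)
  have := norm_add_le ((1 + κ / 2) * m) ((1 - κ / 2) * a)
  linarith

theorem norm_ofReal_cos_le (t : ℝ) : ‖(Real.cos t : ℂ)‖ ≤ 1 := by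
  rw [Complex.norm_real]
  exact Real.abs_cos_le_one t

/-- The mean of a contraction of the amplitudes of two copies of the circuit whose angles are
shifted by `ε` and `ε'`. -/
def ampCorr (K : (Fin 2 → Fin 2 → ℂ) → (Fin 2 → Fin 2 → ℂ) → ℂ) (f : ℂ → ℂ) (s : ℝ)
    (ε ε' : ℕ → ℝ) (L : ℕ) (g : ℂ) : ℂ :=
  ∫ x, K (ampW f L (shiftAngles ε x) g) (ampW f L (shiftAngles ε' x) g) ∂ens s L

section

variable {f : ℂ → ℂ} {K : (Fin 2 → Fin 2 → ℂ) → (Fin 2 → Fin 2 → ℂ) → ℂ}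

theorem continuous_corr_ampW (hf : Continuous f) (hK : IsCorr K) (ε ε' : ℕ → ℝ) {L : ℕ}
    {X : Type*} [TopologicalSpace X] {g : X → ℂ} {x : X → Params L} (hg : Continuous g)
    (hx : Continuous x) :
    Continuous fun t =>
      K (ampW f L (shiftAngles ε (x t)) (g t)) (ampW f L (shiftAngles ε' (x t)) (g t)) :=
  hK.continuous
    (fun a b => (continuous_ampW hf L a b).comp (((continuous_shiftAngles ε).comp hx).prodMk hg))
    (fun a b => (continuous_ampW hf L a b).comp (((continuous_shiftAngles ε').comp hx).prodMk hg))

theorem norm_corr_ampW_le {B : ℝ} (hB : ∀ z, ‖f z‖ ≤ B) (hK : IsCorr K) (L : ℕ) (x x' : Params L)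
    (g : ℂ) : ‖K (ampW f L x g) (ampW f L x' g)‖ ≤ 2 * ((2 ^ L * B) ^ 2) ^ 2 :=
  hK.norm_le (fun a b => norm_ampW_le hB L _ _ a b) (fun a b => norm_ampW_le hB L _ _ a b)

theorem integrable_corr_ampW (hf : IsOverlap f) (hK : IsCorr K) (s : ℝ) (ε ε' : ℕ → ℝ) (L : ℕ)
    (g : ℂ) : Integrable (fun x => K (ampW f L (shiftAngles ε x) g)
      (ampW f L (shiftAngles ε' x) g)) (ens s L) := by
  obtain ⟨B, hB⟩ := hf.exists_norm_le
  exact integrable_of_continuous _ (continuous_corr_ampW hf.continuous hK ε ε' continuous_const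
    continuous_id)
    (fun x => norm_corr_ampW_le hB hK L _ _ g)

theorem continuous_ampCorr (hf : IsOverlap f) (hK : IsCorr K) (s : ℝ) (ε ε' : ℕ → ℝ) (L : ℕ) :
    Continuous (ampCorr K f s ε ε' L) := by
  obtain ⟨B, hB⟩ := hf.exists_norm_le
  exact continuous_integral _
    (continuous_corr_ampW hf.continuous hK ε ε' continuous_fst continuous_snd)
    (fun p => norm_corr_ampW_le hB hK L _ _ _)

theorem norm_ampCorr_le {B : ℝ} (hB : ∀ z, ‖f z‖ ≤ B) (hK : IsCorr K) (s : ℝ)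
    (ε ε' : ℕ → ℝ) (L : ℕ) (g : ℂ) :
    ‖ampCorr K f s ε ε' L g‖ ≤ 2 * ((2 ^ L * B) ^ 2) ^ 2 :=
  norm_integral_le_of_norm_le_const_prob _ fun _ => norm_corr_ampW_le hB hK L _ _ _

/-- The mean of `corrM` after a layer. -/
def ampMix (f : ℂ → ℂ) (s : ℝ) (ε ε' : ℕ → ℝ) (L : ℕ) (g : ℂ) : ℂ :=
  mixM (Real.cos (ε L - ε' L)) (ampCorr corrM f s ε ε' L g) (ampCorr corrA f s ε ε' L g)
    (ampCorr corrB f s ε ε' L g)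

theorem continuous_ampMix (hf : IsOverlap f) (s : ℝ) (ε ε' : ℕ → ℝ) (L : ℕ) :
    Continuous (ampMix f s ε ε' L) :=
  continuous_mixM _ (continuous_ampCorr hf isCorr_corrM s ε ε' L)
    (continuous_ampCorr hf isCorr_corrA s ε ε' L) (continuous_ampCorr hf isCorr_corrB s ε ε' L)

theorem norm_ampMix_le {B : ℝ} (hB : ∀ z, ‖f z‖ ≤ B) (s : ℝ) (ε ε' : ℕ → ℝ) (L : ℕ) (g : ℂ) :
    ‖ampMix f s ε ε' L g‖ ≤ 2 * (2 * ((2 ^ L * B) ^ 2) ^ 2) :=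
  norm_mixM_le (norm_ofReal_cos_le _) (norm_ampCorr_le hB isCorr_corrM s ε ε' L g)
    (norm_ampCorr_le hB isCorr_corrA s ε ε' L g) (norm_ampCorr_le hB isCorr_corrB s ε ε' L g)

theorem integral_integral_mixM (hf : IsOverlap f) (s : ℝ) (ε ε' : ℕ → ℝ) (L : ℕ) {z : ℂ → ℂ}
    (hz : Continuous z) (κ : ℝ) (hκ : κ = Real.cos (ε L - ε' L)) :
    ∫ y, ∫ β, mixM κ
        (corrM (ampW f L (shiftAngles ε y) (z β)) (ampW f L (shiftAngles ε' y) (z β)))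
        (corrA (ampW f L (shiftAngles ε y) (z β)) (ampW f L (shiftAngles ε' y) (z β)))
        (corrB (ampW f L (shiftAngles ε y) (z β)) (ampW f L (shiftAngles ε' y) (z β)))
          ∂complexGaussian s ∂ens s L
      = ∫ β, ampMix f s ε ε' L (z β) ∂complexGaussian s := by
  obtain ⟨B, hB⟩ := hf.exists_norm_le
  rw [integral_integral_swap]
  · refine integral_congr_ae (ae_of_all _ fun β => ?_)
    simp only [ampMix, ampCorr, hκ]
    exact integral_mixM _ (integrable_corr_ampW hf isCorr_corrM s ε ε' L _)
      (integrable_corr_ampW hf isCorr_corrA s ε ε' L _)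
      (integrable_corr_ampW hf isCorr_corrB s ε ε' L _)
  · have hc : Continuous fun p : Params L × ℂ => z p.2 := by fun_prop
    have hcont : Continuous fun p : Params L × ℂ => mixM κ
        (corrM (ampW f L (shiftAngles ε p.1) (z p.2)) (ampW f L (shiftAngles ε' p.1) (z p.2)))
        (corrA (ampW f L (shiftAngles ε p.1) (z p.2)) (ampW f L (shiftAngles ε' p.1) (z p.2)))
        (corrB (ampW f L (shiftAngles ε p.1) (z p.2)) (ampW f L (shiftAngles ε' p.1) (z p.2))) :=
      continuous_mixM _
        (continuous_corr_ampW hf.continuous isCorr_corrM ε ε' hc continuous_fst)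
        (continuous_corr_ampW hf.continuous isCorr_corrA ε ε' hc continuous_fst)
        (continuous_corr_ampW hf.continuous isCorr_corrB ε ε' hc continuous_fst)
    have hκ' : ‖(κ : ℂ)‖ ≤ 1 := by
      rw [hκ]
      exact norm_ofReal_cos_le _
    exact integrable_of_continuous _ hcont fun p => norm_mixM_le hκ'
      (norm_corr_ampW_le hB isCorr_corrM L _ _ _) (norm_corr_ampW_le hB isCorr_corrA L _ _ _)
      (norm_corr_ampW_le hB isCorr_corrB L _ _ _)

theorem continuous_ampW_mul_ampW_shiftAngles (hf : Continuous f) (ε ε' : ℕ → ℝ) (L : ℕ) (g : ℂ)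
    (a b : Fin 2) : Continuous fun x =>
      ampW f L (shiftAngles ε x) g a b * ampW f L (shiftAngles ε' x) g a b :=
  ((continuous_ampW hf L a b).comp ((continuous_shiftAngles ε).prodMk continuous_const)).mul
    ((continuous_ampW hf L a b).comp ((continuous_shiftAngles ε').prodMk continuous_const))

theorem norm_ampW_mul_ampW_le {B : ℝ} (hB : ∀ z, ‖f z‖ ≤ B) (L : ℕ) (x x' : Params L) (g : ℂ)
    (a b : Fin 2) : ‖ampW f L x g a b * ampW f L x' g a b‖ ≤ ((2 ^ L * B) ^ 2) ^ 2 := by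
  rw [norm_mul, sq ((2 ^ L * B) ^ 2)]
  exact mul_le_mul (norm_ampW_le hB L x g a b) (norm_ampW_le hB L x' g a b) (norm_nonneg _)
    (by positivity)

theorem continuous_snocParams_right {L : ℕ} (y : Params L) : Continuous (snocParams y) :=
  continuous_snocParams.comp (continuous_const.prodMk continuous_id)

theorem integral_ampW_zero_zero (hf : IsOverlap f) (s : ℝ) (ε ε' : ℕ → ℝ) (L : ℕ) (g : ℂ) :
    ∫ x, ampW f (L + 1) (shiftAngles ε x) g 0 0 * ampW f (L + 1) (shiftAngles ε' x) g 0 0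
        ∂ens s (L + 1)
      = (∫ β, ampMix f s ε ε' L (g - β) ∂complexGaussian s) / 2 := by
  obtain ⟨B, hB⟩ := hf.exists_norm_le
  have hc := continuous_ampW_mul_ampW_shiftAngles hf.continuous ε ε' (L + 1) g 0 0
  have hb := fun x x' => norm_ampW_mul_ampW_le hB (L + 1) x x' g 0 0
  rw [integral_ens_succ s L hc (fun x => hb _ _), ← integral_integral_mixM hf s ε ε' L
    (by fun_prop : Continuous fun β => g - β) _ rfl, ← integral_div]
  congr 1
  funext y
  rw [integral_layerLaw s (F := fun q =>
    ampW f (L + 1) (shiftAngles ε (snocParams y q)) g 0 0 * ampW f (L + 1) (shiftAngles ε' (snocParams y q)) g 0 0)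
    (hc.comp (continuous_snocParams_right y)) (fun q => hb _ _),
    ← integral_div]
  congr 1
  funext β
  simp only [ampW_shiftAngles_snocParams_zero]
  exact integral_rotW_same _ _ _ _ _

theorem integral_ampW_one_one (hf : IsOverlap f) (s : ℝ) (ε ε' : ℕ → ℝ) (L : ℕ) (g : ℂ) :
    ∫ x, ampW f (L + 1) (shiftAngles ε x) g 1 1 * ampW f (L + 1) (shiftAngles ε' x) g 1 1
        ∂ens s (L + 1)
      = (∫ β, ampMix f s ε ε' L (g + β) ∂complexGaussian s) / 2 := by
  obtain ⟨B, hB⟩ := hf.exists_norm_le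
  have hc := continuous_ampW_mul_ampW_shiftAngles hf.continuous ε ε' (L + 1) g 1 1
  have hb := fun x x' => norm_ampW_mul_ampW_le hB (L + 1) x x' g 1 1
  rw [integral_ens_succ s L hc (fun x => hb _ _), ← integral_integral_mixM hf s ε ε' L
    (by fun_prop : Continuous fun β => g + β) _ rfl, ← integral_div]
  congr 1
  funext y
  rw [integral_layerLaw s (F := fun q =>
    ampW f (L + 1) (shiftAngles ε (snocParams y q)) g 1 1 * ampW f (L + 1) (shiftAngles ε' (snocParams y q)) g 1 1)
    (hc.comp (continuous_snocParams_right y)) (fun q => hb _ _),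
    ← integral_div]
  congr 1
  funext β
  simp only [ampW_shiftAngles_snocParams_one]
  exact integral_rotW_same _ _ _ _ _

theorem ampCorr_corrM_succ (hf : IsOverlap f) (s : ℝ) (ε ε' : ℕ → ℝ) (L : ℕ) (g : ℂ) :
    ampCorr corrM f s ε ε' (L + 1) g
      = (∫ β, ampMix f s ε ε' L (g - β) ∂complexGaussian s) / 2
        + (∫ β, ampMix f s ε ε' L (g + β) ∂complexGaussian s) / 2 := by
  obtain ⟨B, hB⟩ := hf.exists_norm_le
  rw [← integral_ampW_zero_zero hf, ← integral_ampW_one_one hf, ← integral_add]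
  · rfl
  all_goals
    exact integrable_of_continuous _
      (continuous_ampW_mul_ampW_shiftAngles hf.continuous ε ε' (L + 1) g _ _)
      (fun x => norm_ampW_mul_ampW_le hB (L + 1) _ _ g _ _)

/-- The average of `ampCorr` over displacements of variance `v`. -/
def ampMean (K : (Fin 2 → Fin 2 → ℂ) → (Fin 2 → Fin 2 → ℂ) → ℂ) (f : ℂ → ℂ) (s : ℝ)
    (ε ε' : ℕ → ℝ) (v : ℝ) (L : ℕ) : ℂ :=
  ∫ g, ampCorr K f s ε ε' L g ∂complexGaussian v

theorem integrable_ampCorr (hf : IsOverlap f) (hK : IsCorr K) (s : ℝ) (ε ε' : ℕ → ℝ) (v : ℝ)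
    (L : ℕ) : Integrable (ampCorr K f s ε ε' L) (complexGaussian v) := by
  obtain ⟨B, hB⟩ := hf.exists_norm_le
  exact integrable_of_continuous _ (continuous_ampCorr hf hK s ε ε' L)
    (norm_ampCorr_le hB hK s ε ε' L)

theorem integral_ampMix (hf : IsOverlap f) (s : ℝ) (ε ε' : ℕ → ℝ) (v : ℝ) (L : ℕ) :
    ∫ g, ampMix f s ε ε' L g ∂complexGaussian v
      = mixM (Real.cos (ε L - ε' L)) (ampMean corrM f s ε ε' v L) (ampMean corrA f s ε ε' v L)
        (ampMean corrB f s ε ε' v L) :=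
  integral_mixM _ (integrable_ampCorr hf isCorr_corrM s ε ε' v L)
    (integrable_ampCorr hf isCorr_corrA s ε ε' v L) (integrable_ampCorr hf isCorr_corrB s ε ε' v L)

/-- Equal qubit states move `g` by the same `±β` in both copies, so the layer merely adds its
variance to that of `g`. For `corrA` the two copies would be evaluated at different points and no
such closure exists. -/
theorem ampMean_corrM_succ (hf : IsOverlap f) {s v : ℝ} (hs : 0 ≤ s) (hv : 0 ≤ v) (ε ε' : ℕ → ℝ)
    (L : ℕ) :
    ampMean corrM f s ε ε' v (L + 1)
      = mixM (Real.cos (ε L - ε' L)) (ampMean corrM f s ε ε' (v + s) L)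
        (ampMean corrA f s ε ε' (v + s) L) (ampMean corrB f s ε ε' (v + s) L) := by
  obtain ⟨B, hB⟩ := hf.exists_norm_le
  have hc := continuous_ampMix hf s ε ε' L
  have hb := norm_ampMix_le hB s ε ε' L
  have hi : ∀ z : ℂ → ℂ → ℂ, (Continuous fun p : ℂ × ℂ => z p.1 p.2) →
      Integrable (fun g => (∫ β, ampMix f s ε ε' L (z g β) ∂complexGaussian s) / 2)
        (complexGaussian v) := fun z hz => by
    have h := continuous_integral (complexGaussian s)
      (F := fun p : ℂ × ℂ => ampMix f s ε ε' L (z p.1 p.2)) (hc.comp hz) (fun p => hb _)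
    exact (integrable_of_continuous _ h
      (fun p => norm_integral_le_of_norm_le_const_prob _ fun _ => hb _)).div_const 2
  rw [ampMean]
  simp_rw [ampCorr_corrM_succ hf]
  rw [integral_add (hi (fun g β => g - β) (by fun_prop)) (hi (fun g β => g + β) (by fun_prop)),
    integral_div, integral_div, integral_complexGaussian_sub hv hs hc hb,
    integral_complexGaussian_add hv hs hc hb, ← integral_ampMix hf]
  ring

/-- The cost sees one of the two qubit states in `corrM`. At `g = 0` the symmetry `β ↦ -β` makes
both contribute equally, hence the half. -/
theorem integral_ampW_zero_zero_eq (hf : IsOverlap f) {s : ℝ} (hs : 0 ≤ s) (ε ε' : ℕ → ℝ) (L : ℕ) :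
    ∫ x, ampW f (L + 1) (shiftAngles ε x) 0 0 0 * ampW f (L + 1) (shiftAngles ε' x) 0 0 0
        ∂ens s (L + 1) = ampMean corrM f s ε ε' 0 (L + 1) / 2 := by
  rw [integral_ampW_zero_zero hf, ampMean_corrM_succ hf hs le_rfl, zero_add, ← integral_ampMix hf]
  simp_rw [zero_sub]
  rw [integral_complexGaussian_neg hs]

/-! ### Unwinding the recursion for the same-state part -/

theorem norm_integral_le_re_integral {Y : Type*} [MeasurableSpace Y] {μ : Measure Y} {F G : Y → ℂ}
    (hG : Integrable G μ) (h : ∀ y, ‖F y‖ ≤ (G y).re) : ‖∫ y, F y ∂μ‖ ≤ (∫ y, G y ∂μ).re := by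
  have e : (∫ y, G y ∂μ).re = ∫ y, (G y).re ∂μ := (integral_re hG).symm
  rw [e]
  exact norm_integral_le_of_norm_le hG.re (ae_of_all _ h)

/-- `ampW` has rank one, so the coherences have modulus at most twice the product of four moduli,
which the inequality of the means bounds by `corrA`. The latter is real and nonnegative here, so the
bound survives averaging. -/
theorem norm_corrB_ampW_le (f : ℂ → ℂ) (L : ℕ) (x x' : Params L) (g : ℂ) :
    ‖corrB (ampW f L x g) (ampW f L x' g)‖ ≤ (corrA (ampW f L x g) (ampW f L x' g)).re := by
  have e : corrA (ampW f L x g) (ampW f L x' g)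
      = ((‖amp f L x g 0‖ ^ 2 * ‖amp f L x' g 1‖ ^ 2
        + ‖amp f L x g 1‖ ^ 2 * ‖amp f L x' g 0‖ ^ 2 : ℝ) : ℂ) := by
    simp only [corrA, ampW, Complex.conj_mul']
    push_cast
    ring
  rw [e, Complex.ofReal_re]
  refine (norm_add_le _ _).trans ?_
  simp only [ampW, norm_mul, RCLike.norm_conj]
  nlinarith [sq_nonneg (‖amp f L x g 0‖ * ‖amp f L x' g 1‖ - ‖amp f L x g 1‖ * ‖amp f L x' g 0‖)]

theorem norm_ampMean_corrB_le (hf : IsOverlap f) (s : ℝ) (ε ε' : ℕ → ℝ) (v : ℝ) (L : ℕ) :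
    ‖ampMean corrB f s ε ε' v L‖ ≤ ‖ampMean corrA f s ε ε' v L‖ :=
  (norm_integral_le_re_integral (integrable_ampCorr hf isCorr_corrA s ε ε' v L) fun g =>
    norm_integral_le_re_integral (integrable_corr_ampW hf isCorr_corrA s ε ε' L g) fun _ =>
      norm_corrB_ampW_le f L _ _ g).trans (Complex.re_le_norm _)

/-- The remaining coefficients have total size `(1 - κ/2)/2 + |κ|/4`, which is at most 1, with
equality at `κ = -1`. -/
theorem norm_mixM_sub_le {κ : ℝ} {m a b : ℂ} (hκ : |κ| ≤ 1) (hb : ‖b‖ ≤ ‖a‖) :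
    ‖mixM κ m a b - ((1 + κ / 2) / 2 : ℝ) * m‖ ≤ ‖a‖ := by
  have e : mixM κ m a b - ((1 + κ / 2) / 2 : ℝ) * m
      = ((1 - κ / 2) / 2 : ℝ) * a + (κ / 4 : ℝ) * b := by
    rw [mixM]
    push_cast
    ring
  obtain ⟨h1, h2⟩ := abs_le.1 hκ
  rw [e]
  refine (norm_add_le _ _).trans ?_
  rw [norm_mul, norm_mul, Complex.norm_real, Complex.norm_real, Real.norm_of_nonneg (by linarith),
    Real.norm_eq_abs, abs_div, abs_of_pos (by norm_num : (0 : ℝ) < 4)]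
  have h3 : |κ| / 4 * ‖b‖ ≤ |κ| / 4 * ‖a‖ := mul_le_mul_of_nonneg_left hb (by positivity)
  have h4 : (|κ| - κ) * ‖a‖ ≤ 2 * ‖a‖ :=
    mul_le_mul_of_nonneg_right (by linarith) (norm_nonneg a)
  nlinarith [norm_nonneg a]

theorem ampMean_corrM_zero (f : ℂ → ℂ) (s : ℝ) (ε ε' : ℕ → ℝ) (v : ℝ) :
    ampMean corrM f s ε ε' v 0 = ((∫ g, ‖f g‖ ^ 4 ∂complexGaussian v : ℝ) : ℂ) := by
  rw [ampMean, ← integral_complex_ofReal]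
  congr 1
  funext g
  simp only [ampCorr, corrM, ampW, amp, Matrix.cons_val_zero, Matrix.cons_val_one,
    Matrix.cons_val_fin_one, mul_zero, add_zero, Complex.conj_mul', integral_const, probReal_univ,
    one_smul]
  push_cast
  ring

theorem ampMean_corrA_zero (f : ℂ → ℂ) (s : ℝ) (ε ε' : ℕ → ℝ) (v : ℝ) :
    ampMean corrA f s ε ε' v 0 = 0 := by
  simp [ampMean, ampCorr, corrA, ampW, amp]

/-- Each step of the recursion raises `v` by `s`, down to depth zero, where the fourth moment of `f`
appears. The error committed at depth `i` is multiplied by the `L - 1 - i` factors of the later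
layers, each at most 3/4. The bound `e` is needed only for `v ≥ s`, since a layer has been removed
before `corrA` enters. -/
theorem norm_ampMean_corrM_sub_le (hf : IsOverlap f) {s : ℝ} (hs : 0 ≤ s) (ε ε' : ℕ → ℝ)
    {e : ℕ → ℝ} (he : ∀ v, s ≤ v → ∀ L, ‖ampMean corrA f s ε ε' v L‖ ≤ e L) (L : ℕ) {v : ℝ}
    (hv : 0 ≤ v) :
    ‖ampMean corrM f s ε ε' v L - ((∏ l ∈ Finset.range L, (1 + Real.cos (ε l - ε' l) / 2) / 2 : ℝ)
        * (∫ g, ‖f g‖ ^ 4 ∂complexGaussian (v + L * s) : ℝ) : ℂ)‖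
      ≤ ∑ i ∈ Finset.range L, (3 / 4) ^ (L - 1 - i) * e i := by
  induction L generalizing v with
  | zero => simp [ampMean_corrM_zero]
  | succ L ih =>
    have h1 := ih (add_nonneg hv hs)
    have h2 := norm_mixM_sub_le (m := ampMean corrM f s ε ε' (v + s) L)
      (Real.abs_cos_le_one (ε L - ε' L)) (norm_ampMean_corrB_le hf s ε ε' (v + s) L)
    have h3 := he (v + s) (by linarith) L
    have hc : |(1 + Real.cos (ε L - ε' L) / 2) / 2| ≤ 3 / 4 := by
      have h4 := Real.neg_one_le_cos (ε L - ε' L)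
      have h5 := Real.cos_le_one (ε L - ε' L)
      rw [abs_le]
      constructor <;> linarith
    have e1 : v + s + L * s = v + (L + 1 : ℕ) * s := by push_cast; ring
    have e2 : ∑ i ∈ Finset.range (L + 1), (3 / 4 : ℝ) ^ (L + 1 - 1 - i) * e i
        = 3 / 4 * (∑ i ∈ Finset.range L, (3 / 4) ^ (L - 1 - i) * e i) + e L := by
      rw [Finset.sum_range_succ, Finset.mul_sum]
      congr 1
      · refine Finset.sum_congr rfl fun i hi => ?_
        have := Finset.mem_range.1 hi
        rw [show L + 1 - 1 - i = (L - 1 - i) + 1 by omega, pow_succ]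
        ring
      · simp
    rw [e1] at h1
    rw [ampMean_corrM_succ hf hs hv, e2, Finset.prod_range_succ]
    set m := ampMean corrM f s ε ε' (v + s) L
    set c := (1 + Real.cos (ε L - ε' L) / 2) / 2
    set P := ∏ l ∈ Finset.range L, (1 + Real.cos (ε l - ε' l) / 2) / 2
    set I := ∫ g, ‖f g‖ ^ 4 ∂complexGaussian (v + (L + 1 : ℕ) * s)
    have h6 : ‖(c : ℂ) * (m - (P : ℂ) * I)‖
        ≤ 3 / 4 * ∑ i ∈ Finset.range L, (3 / 4) ^ (L - 1 - i) * e i := by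
      rw [norm_mul, Complex.norm_real, Real.norm_eq_abs]
      exact mul_le_mul hc h1 (norm_nonneg _) (by norm_num)
    have e3 : mixM (Real.cos (ε L - ε' L)) m (ampMean corrA f s ε ε' (v + s) L)
          (ampMean corrB f s ε ε' (v + s) L) - ((P * c : ℝ) : ℂ) * I
        = (mixM (Real.cos (ε L - ε' L)) m (ampMean corrA f s ε ε' (v + s) L)
          (ampMean corrB f s ε ε' (v + s) L) - (c : ℂ) * m) + (c : ℂ) * (m - (P : ℂ) * I) := by
      push_cast
      ring
    rw [e3]
    exact (norm_add_le _ _).trans (by linarith)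

end

/-! ### The second moments of the characteristic functions -/

/-- The mean of a contraction of the characteristic functions of two copies of the circuit whose
angles are shifted by `ε` and `ε'`. -/
def charCorr (K : (Fin 2 → Fin 2 → ℂ) → (Fin 2 → Fin 2 → ℂ) → ℂ) (s : ℝ) (ε ε' : ℕ → ℝ) (L : ℕ)
    (ξ η : ℂ) : ℂ :=
  ∫ x, K (charW L (shiftAngles ε x) ξ) (charW L (shiftAngles ε' x) η) ∂ens s L

theorem continuous_charW_shiftAngles {X : Type*} [TopologicalSpace X] (ε : ℕ → ℝ) {L : ℕ}
    {x : X → Params L} {ξ : X → ℂ} (hx : Continuous x) (hξ : Continuous ξ) (a b : Fin 2) :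
    Continuous fun t => charW L (shiftAngles ε (x t)) (ξ t) a b :=
  (continuous_charW L a b).comp (((continuous_shiftAngles ε).comp hx).prodMk hξ)

theorem continuous_corr_charW {K : (Fin 2 → Fin 2 → ℂ) → (Fin 2 → Fin 2 → ℂ) → ℂ} (hK : IsCorr K)
    {X : Type*} [TopologicalSpace X] (ε ε' : ℕ → ℝ) {L : ℕ} {x : X → Params L} {ξ η : X → ℂ}
    (hx : Continuous x) (hξ : Continuous ξ) (hη : Continuous η) : Continuous fun t =>
      K (charW L (shiftAngles ε (x t)) (ξ t)) (charW L (shiftAngles ε' (x t)) (η t)) :=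
  hK.continuous (continuous_charW_shiftAngles ε hx hξ) (continuous_charW_shiftAngles ε' hx hη)

theorem norm_corr_charW_le {K : (Fin 2 → Fin 2 → ℂ) → (Fin 2 → Fin 2 → ℂ) → ℂ} (hK : IsCorr K)
    (L : ℕ) (x x' : Params L) (ξ η : ℂ) :
    ‖K (charW L x ξ) (charW L x' η)‖ ≤ 2 * (4 ^ L) ^ 2 :=
  hK.norm_le (norm_charW_le L x ξ) (norm_charW_le L x' η)

theorem integrable_corr_charW {K : (Fin 2 → Fin 2 → ℂ) → (Fin 2 → Fin 2 → ℂ) → ℂ} (hK : IsCorr K)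
    (s : ℝ) (ε ε' : ℕ → ℝ) (L : ℕ) (ξ η : ℂ) :
    Integrable (fun x => K (charW L (shiftAngles ε x) ξ) (charW L (shiftAngles ε' x) η)) (ens s L) :=
  integrable_of_continuous _ (continuous_corr_charW hK ε ε' continuous_id continuous_const
    continuous_const) (fun _ => norm_corr_charW_le hK L _ _ ξ η)

theorem continuous_charCorr {K : (Fin 2 → Fin 2 → ℂ) → (Fin 2 → Fin 2 → ℂ) → ℂ} (hK : IsCorr K)
    (s : ℝ) (ε ε' : ℕ → ℝ) (L : ℕ) : Continuous fun p : ℂ × ℂ => charCorr K s ε ε' L p.1 p.2 :=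
  continuous_integral (ens s L) (F := fun p : (ℂ × ℂ) × Params L =>
      K (charW L (shiftAngles ε p.2) p.1.1) (charW L (shiftAngles ε' p.2) p.1.2))
    (continuous_corr_charW hK ε ε' continuous_snd (by fun_prop) (by fun_prop))
    (fun p => norm_corr_charW_le hK L _ _ _ _)

theorem norm_charCorr_le {K : (Fin 2 → Fin 2 → ℂ) → (Fin 2 → Fin 2 → ℂ) → ℂ} (hK : IsCorr K)
    (s : ℝ) (ε ε' : ℕ → ℝ) (L : ℕ) (ξ η : ℂ) : ‖charCorr K s ε ε' L ξ η‖ ≤ 2 * (4 ^ L) ^ 2 :=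
  norm_integral_le_of_norm_le_const_prob _ fun _ => norm_corr_charW_le hK L _ _ ξ η

/-- The sign of the displacement that brings the qubit into the state `|a⟩`. -/
def ecdSign : Fin 2 → ℂ := ![-1, 1]

/-- The flip of the qubit. -/
def flip : Fin 2 → Fin 2 := ![1, 0]

theorem initParams_shiftAngles_snocParams (ε : ℕ → ℝ) {L : ℕ} (y : Params L) (q : ℂ × ℝ × ℝ) :
    initParams (shiftAngles ε (snocParams y q)) = shiftAngles ε y := by
  rw [initParams_shiftAngles, initParams_snocParams]

theorem shiftAngles_snocParams_last (ε : ℕ → ℝ) {L : ℕ} (y : Params L) (q : ℂ × ℝ × ℝ) :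
    (shiftAngles ε (snocParams y q)).1 (Fin.last L) = q.1 ∧
      (shiftAngles ε (snocParams y q)).2.1 (Fin.last L) = q.2.1 + ε L ∧
      (shiftAngles ε (snocParams y q)).2.2 (Fin.last L) = q.2.2 := by
  simp [shiftAngles, snocParams]

theorem charW_snocParams_diag (ε : ℕ → ℝ) {L : ℕ} (y : Params L) (q : ℂ × ℝ × ℝ) (ξ : ℂ) (a : Fin 2) :
    charW (L + 1) (shiftAngles ε (snocParams y q)) ξ a a
      = Complex.exp (Complex.I * (2 * ((ecdSign a * ξ) * conj q.1).im : ℝ)) *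
        rotW (q.2.1 + ε L) q.2.2 (charW L (shiftAngles ε y) ξ) (flip a) (flip a) := by
  fin_cases a
  · have e : (2 * ((ecdSign 0 * ξ) * conj q.1).im : ℝ) = -(2 * (ξ * conj q.1).im) := by
      simp [ecdSign]
      ring
    simp only [Fin.zero_eta, e]
    simp [charW, initParams_shiftAngles_snocParams, shiftAngles_snocParams_last, flip]
  · simp [charW, initParams_shiftAngles_snocParams, shiftAngles_snocParams_last, flip,
      ecdSign]

theorem charW_snocParams_zero_one (ε : ℕ → ℝ) {L : ℕ} (y : Params L) (q : ℂ × ℝ × ℝ) (ξ : ℂ) :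
    charW (L + 1) (shiftAngles ε (snocParams y q)) ξ 0 1
      = rotW (q.2.1 + ε L) q.2.2 (charW L (shiftAngles ε y) (ξ + (2 : ℝ) • q.1)) 1 0 := by
  simp [charW, initParams_shiftAngles_snocParams, shiftAngles_snocParams_last]

theorem charW_snocParams_one_zero (ε : ℕ → ℝ) {L : ℕ} (y : Params L) (q : ℂ × ℝ × ℝ) (ξ : ℂ) :
    charW (L + 1) (shiftAngles ε (snocParams y q)) ξ 1 0
      = rotW (q.2.1 + ε L) q.2.2 (charW L (shiftAngles ε y) (ξ + (-2 : ℝ) • q.1)) 0 1 := by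
  have e : ξ - 2 * q.1 = ξ + (-2 : ℝ) • q.1 := by
    rw [neg_smul, ← sub_eq_add_neg, Complex.real_smul]
    norm_num
  rw [← e]
  simp [charW, initParams_shiftAngles_snocParams, shiftAngles_snocParams_last]

theorem continuous_charW_mul_charW (ε ε' : ℕ → ℝ) (L : ℕ) (ξ η : ℂ) (a b c d : Fin 2) :
    Continuous fun x : Params L =>
      charW L (shiftAngles ε x) ξ a b * charW L (shiftAngles ε' x) η c d :=
  (continuous_charW_shiftAngles ε continuous_id continuous_const a b).mul
    (continuous_charW_shiftAngles ε' continuous_id continuous_const c d)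

theorem norm_charW_mul_charW_le (L : ℕ) (x x' : Params L) (ξ η : ℂ) (a b c d : Fin 2) :
    ‖charW L x ξ a b * charW L x' η c d‖ ≤ 4 ^ L * 4 ^ L := by
  rw [norm_mul]
  exact mul_le_mul (norm_charW_le _ _ _ _ _) (norm_charW_le _ _ _ _ _) (norm_nonneg _)
    (by positivity)

theorem integrable_charW_mul_charW (s : ℝ) (ε ε' : ℕ → ℝ) (L : ℕ) (ξ η : ℂ) (a b c d : Fin 2) :
    Integrable (fun x : Params L =>
      charW L (shiftAngles ε x) ξ a b * charW L (shiftAngles ε' x) η c d) (ens s L) :=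
  integrable_of_continuous _ (continuous_charW_mul_charW ε ε' L ξ η a b c d)
    (fun _ => norm_charW_mul_charW_le L _ _ ξ η a b c d)

/-- Diagonal entries depend on the last `β` only through phases linear in it, so its average factors
out as a Gaussian of the signed combination of `ξ` and `η`. -/
theorem integral_charW_diag {s : ℝ} (hs : 0 ≤ s) (ε ε' : ℕ → ℝ) (L : ℕ) (ξ η : ℂ) (a b : Fin 2) :
    ∫ x, charW (L + 1) (shiftAngles ε x) ξ a a * charW (L + 1) (shiftAngles ε' x) η b b
        ∂ens s (L + 1)
      = (Real.exp (-(s * ‖ecdSign a * ξ + ecdSign b * η‖ ^ 2)) : ℂ) *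
        ∫ y, ∫ θ, ∫ φ, rotW (θ + ε L) φ (charW L (shiftAngles ε y) ξ) (flip a) (flip a) *
          rotW (θ + ε' L) φ (charW L (shiftAngles ε' y) η) (flip b) (flip b)
            ∂uniformAngle ∂uniformAngle ∂ens s L := by
  have hc := continuous_charW_mul_charW ε ε' (L + 1) ξ η a a b b
  have hb := fun x x' => norm_charW_mul_charW_le (L + 1) x x' ξ η a a b b
  rw [integral_ens_succ s L hc (fun x => hb _ _), ← integral_const_mul]
  congr 1
  funext y
  rw [integral_layerLaw s (F := fun q => charW (L + 1) (shiftAngles ε (snocParams y q)) ξ a a *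
    charW (L + 1) (shiftAngles ε' (snocParams y q)) η b b)
    (hc.comp (continuous_snocParams_right y)) (fun q => hb _ _),
    ← integral_cexp_complexGaussian hs, ← integral_mul_const]
  congr 1
  funext β
  rw [← integral_const_mul]
  congr 1
  funext θ
  rw [← integral_const_mul]
  congr 1
  funext φ
  rw [charW_snocParams_diag, charW_snocParams_diag, mul_mul_mul_comm, ← Complex.exp_add]
  congr 2
  rw [← mul_add, add_mul, Complex.add_im]
  push_cast
  ring

/-- Copies in the same qubit state carry the same sign of displacement, which damps `ξ + η`; in
`charCorr_corrA_succ` the signs are opposite and `ξ - η` is damped. -/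
theorem charCorr_corrM_succ {s : ℝ} (hs : 0 ≤ s) (ε ε' : ℕ → ℝ) (L : ℕ) (ξ η : ℂ) :
    charCorr corrM s ε ε' (L + 1) ξ η
      = (Real.exp (-(s * ‖ξ + η‖ ^ 2)) : ℂ) * mixM (Real.cos (ε L - ε' L))
        (charCorr corrM s ε ε' L ξ η) (charCorr corrA s ε ε' L ξ η)
        (charCorr corrB s ε ε' L ξ η) := by
  have key : ∀ a, ∫ x, charW (L + 1) (shiftAngles ε x) ξ a a *
      charW (L + 1) (shiftAngles ε' x) η a a ∂ens s (L + 1)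
      = (Real.exp (-(s * ‖ξ + η‖ ^ 2)) : ℂ) * (mixM (Real.cos (ε L - ε' L))
        (charCorr corrM s ε ε' L ξ η) (charCorr corrA s ε ε' L ξ η)
        (charCorr corrB s ε ε' L ξ η) / 2) := fun a => by
    have e : ‖ecdSign a * ξ + ecdSign a * η‖ = ‖ξ + η‖ := by
      rw [← mul_add, norm_mul]
      fin_cases a <;> simp [ecdSign]
    rw [integral_charW_diag hs, e]
    simp_rw [integral_rotW_same]
    rw [integral_div, integral_mixM _ (integrable_corr_charW isCorr_corrM s ε ε' L ξ η)
      (integrable_corr_charW isCorr_corrA s ε ε' L ξ η)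
      (integrable_corr_charW isCorr_corrB s ε ε' L ξ η)]
    rfl
  have h : charCorr corrM s ε ε' (L + 1) ξ η = _ :=
    integral_add (integrable_charW_mul_charW s ε ε' (L + 1) ξ η 0 0 0 0)
      (integrable_charW_mul_charW s ε ε' (L + 1) ξ η 1 1 1 1)
  rw [h, key, key]
  ring

theorem charCorr_corrA_succ {s : ℝ} (hs : 0 ≤ s) (ε ε' : ℕ → ℝ) (L : ℕ) (ξ η : ℂ) :
    charCorr corrA s ε ε' (L + 1) ξ η
      = (Real.exp (-(s * ‖ξ - η‖ ^ 2)) : ℂ) * mixA (Real.cos (ε L - ε' L))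
        (charCorr corrM s ε ε' L ξ η) (charCorr corrA s ε ε' L ξ η)
        (charCorr corrB s ε ε' L ξ η) := by
  have key : ∀ a b, a ≠ b → ∫ x, charW (L + 1) (shiftAngles ε x) ξ a a *
      charW (L + 1) (shiftAngles ε' x) η b b ∂ens s (L + 1)
      = (Real.exp (-(s * ‖ξ - η‖ ^ 2)) : ℂ) * (mixA (Real.cos (ε L - ε' L))
        (charCorr corrM s ε ε' L ξ η) (charCorr corrA s ε ε' L ξ η)
        (charCorr corrB s ε ε' L ξ η) / 2) := fun a b hab => by
    have e : ‖ecdSign a * ξ + ecdSign b * η‖ = ‖ξ - η‖ := by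
      fin_cases a <;> fin_cases b
      · exact absurd rfl hab
      · simp only [ecdSign, Fin.zero_eta, Fin.mk_one, Matrix.cons_val_zero, Matrix.cons_val_one,
          neg_one_mul, one_mul]
        rw [← norm_neg]
        congr 1
        simp
        ring
      · simp [ecdSign, sub_eq_add_neg]
      · exact absurd rfl hab
    have hf : flip a ≠ flip b := by
      fin_cases a <;> fin_cases b <;> simp_all [flip]
    rw [integral_charW_diag hs, e]
    simp_rw [integral_rotW_diff _ _ _ _ hf]
    rw [integral_div, integral_mixA _ (integrable_corr_charW isCorr_corrM s ε ε' L ξ η)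
      (integrable_corr_charW isCorr_corrA s ε ε' L ξ η)
      (integrable_corr_charW isCorr_corrB s ε ε' L ξ η)]
    rfl
  have h : charCorr corrA s ε ε' (L + 1) ξ η = _ :=
    integral_add (integrable_charW_mul_charW s ε ε' (L + 1) ξ η 0 0 1 1)
      (integrable_charW_mul_charW s ε ε' (L + 1) ξ η 1 1 0 0)
  rw [h, key _ _ (by decide), key _ _ (by decide)]
  ring

theorem charCorr_corrB_zero (s : ℝ) (ε ε' : ℕ → ℝ) (ξ η : ℂ) :
    charCorr corrB s ε ε' 0 ξ η = 0 := by
  simp [charCorr, corrB, charW]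

theorem charCorr_corrA_zero (s : ℝ) (ε ε' : ℕ → ℝ) (ξ η : ℂ) :
    charCorr corrA s ε ε' 0 ξ η = 0 := by
  simp [charCorr, corrA, charW]

theorem norm_charCorr_corrM_zero_le (s : ℝ) (ε ε' : ℕ → ℝ) (ξ η : ℂ) :
    ‖charCorr corrM s ε ε' 0 ξ η‖ ≤ 1 := by
  refine norm_integral_le_of_norm_le_const_prob _ fun x => ?_
  have h := fun (x : Params 0) (ξ : ℂ) => norm_charW_le 0 x ξ 0 0
  simp only [pow_zero] at h
  have e : corrM (charW 0 (shiftAngles ε x) ξ) (charW 0 (shiftAngles ε' x) η)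
      = charW 0 (shiftAngles ε x) ξ 0 0 * charW 0 (shiftAngles ε' x) η 0 0 := by
    simp [corrM, charW]
  rw [e, norm_mul]
  exact mul_le_one₀ (h _ _) (norm_nonneg _) (h _ _)

theorem integrable_norm_sq_rotW_charW (L : ℕ) (x : Params L) (θ φ : ℝ) (a b : Fin 2) :
    Integrable (fun ξ => ‖rotW θ φ (charW L x ξ) a b‖ ^ 2) ∧
      ∫ ξ, ‖rotW θ φ (charW L x ξ) a b‖ ^ 2 ≤ Real.pi := by
  obtain ⟨h1, h2⟩ := integrable_sumSq_charW L x
  have hc : Continuous fun ξ => rotW θ φ (charW L x ξ) a b :=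
    continuous_rotW continuous_const continuous_const (fun c d =>
      (continuous_charW L c d).comp (continuous_const.prodMk continuous_id)) a b
  have hle : ∀ ξ, ‖rotW θ φ (charW L x ξ) a b‖ ^ 2 ≤ sumSq (charW L x ξ) := fun ξ =>
    (norm_sq_le_sumSq _ a b).trans (sumSq_rotW θ φ _).le
  have hi : Integrable (fun ξ => ‖rotW θ φ (charW L x ξ) a b‖ ^ 2) :=
    h1.mono' (hc.norm.pow 2).aestronglyMeasurable (ae_of_all _ fun ξ => by
      rw [Real.norm_of_nonneg (by positivity)]
      exact hle ξ)
  exact ⟨hi, (integral_mono hi h1 hle).trans h2.le⟩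

/-- The density is at most `1/(πs)`, and the substitution `β ↦ ξ ± 2β` of the plane has Jacobian 4.
-/
theorem integral_complexGaussian_smul_le {s : ℝ} (hs : 0 < s) {r : ℝ} (hr : r ^ 2 = 4) {H : ℂ → ℝ}
    (h0 : ∀ z, 0 ≤ H z) (hH : Integrable H) (hI : ∫ z, H z ≤ Real.pi) (ξ : ℂ) :
    ∫ β, H (ξ + r • β) ∂complexGaussian s ≤ (4 * s)⁻¹ := by
  have hr0 : r ≠ 0 := by
    rintro rfl
    norm_num at hr
  have hi : Integrable fun z => H (ξ + z) := hH.comp_add_left ξ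
  have hi' : Integrable fun β : ℂ => H (ξ + r • β) := hi.comp_smul hr0
  have e : ∫ β : ℂ, H (ξ + r • β) = 1 / 4 * ∫ z, H z := by
    have := Measure.integral_comp_smul (volume : Measure ℂ) (fun z => H (ξ + z)) r
    rw [this, integral_add_left_eq_self, Complex.finrank_real_complex, hr, smul_eq_mul,
      abs_of_pos (by norm_num)]
    norm_num
  refine (integral_complexGaussian_le hs (fun _ => h0 _) hi').trans ?_
  rw [e]
  have hpi := Real.pi_pos
  calc (Real.pi * s)⁻¹ * (1 / 4 * ∫ z, H z) ≤ (Real.pi * s)⁻¹ * (1 / 4 * Real.pi) := by gcongr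
    _ = (4 * s)⁻¹ := by field_simp

/-- Off-diagonal entries are evaluated at `ξ ± 2β`. With every other parameter fixed, the average
over `β` spreads over phase space and is controlled by the conserved `L²` norm; this is why `β` is
integrated innermost. -/
theorem norm_integral_charW_offDiag_le {s : ℝ} (hs : 0 < s) (ε ε' : ℕ → ℝ) (L : ℕ) (ξ η : ℂ)
    {a b c d a' b' c' d' : Fin 2} {r r' : ℝ} (hr : r ^ 2 = 4) (hr' : r' ^ 2 = 4)
    (h : ∀ (y : Params L) (q : ℂ × ℝ × ℝ), charW (L + 1) (shiftAngles ε (snocParams y q)) ξ a b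
      = rotW (q.2.1 + ε L) q.2.2 (charW L (shiftAngles ε y) (ξ + r • q.1)) a' b')
    (h' : ∀ (y : Params L) (q : ℂ × ℝ × ℝ), charW (L + 1) (shiftAngles ε' (snocParams y q)) η c d
      = rotW (q.2.1 + ε' L) q.2.2 (charW L (shiftAngles ε' y) (η + r' • q.1)) c' d') :
    ‖∫ x, charW (L + 1) (shiftAngles ε x) ξ a b * charW (L + 1) (shiftAngles ε' x) η c d
        ∂ens s (L + 1)‖ ≤ (4 * s)⁻¹ := by
  have hc := continuous_charW_mul_charW ε ε' (L + 1) ξ η a b c d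
  have hb := fun x x' => norm_charW_mul_charW_le (L + 1) x x' ξ η a b c d
  rw [integral_ens_succ s L hc (fun x => hb _ _)]
  refine norm_integral_le_of_norm_le_const_prob _ fun y => ?_
  rw [integral_layerLaw_symm s (F := fun q => charW (L + 1) (shiftAngles ε (snocParams y q)) ξ a b *
    charW (L + 1) (shiftAngles ε' (snocParams y q)) η c d)
    (hc.comp (continuous_snocParams_right y)) (fun q => hb _ _)]
  refine norm_integral_le_of_norm_le_const_prob _ fun t => ?_
  simp only [h, h']
  obtain ⟨i1, i2⟩ := integrable_norm_sq_rotW_charW L (shiftAngles ε y) (t.1 + ε L) t.2 a' b'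
  obtain ⟨j1, j2⟩ := integrable_norm_sq_rotW_charW L (shiftAngles ε' y) (t.1 + ε' L) t.2 c' d'
  have k1 := integral_complexGaussian_smul_le hs hr (fun _ => sq_nonneg _) i1 i2 ξ
  have k2 := integral_complexGaussian_smul_le hs hr' (fun _ => sq_nonneg _) j1 j2 η
  have hint : ∀ (x : Params L) (θ φ r : ℝ) (ζ : ℂ) (a b : Fin 2),
      Integrable (fun β : ℂ => ‖rotW θ φ (charW L x (ζ + r • β)) a b‖ ^ 2) (complexGaussian s) :=
    fun x θ φ r ζ a b => by
      have hcont : Continuous fun β : ℂ => rotW θ φ (charW L x (ζ + r • β)) a b :=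
        continuous_rotW continuous_const continuous_const (fun c d =>
          (continuous_charW L c d).comp (continuous_const.prodMk (by fun_prop))) a b
      refine Integrable.of_bound (hcont.norm.pow 2).aestronglyMeasurable ((4 * 4 ^ L) ^ 2)
        (ae_of_all _ fun β => ?_)
      rw [Real.norm_of_nonneg (by positivity)]
      exact pow_le_pow_left₀ (norm_nonneg _) (norm_rotW_le _ _ (norm_charW_le L x _) _ _) 2
  have l1 := hint (shiftAngles ε y) (t.1 + ε L) t.2 r ξ a' b'
  have l2 := hint (shiftAngles ε' y) (t.1 + ε' L) t.2 r' η c' d'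
  -- A product is at most half the sum of the squares, and each square has mean at most `1/(4s)`.
  refine (norm_integral_le_of_norm_le ((l1.add l2).div_const 2)
    (ae_of_all _ fun β => ?_)).trans (?_ : _ ≤ (∫ β, ‖rotW (t.1 + ε L) t.2 (charW L (shiftAngles ε y) (ξ + r • β)) a' b'‖ ^ 2
        ∂complexGaussian s
      + ∫ β, ‖rotW (t.1 + ε' L) t.2 (charW L (shiftAngles ε' y) (η + r' • β)) c' d'‖ ^ 2
        ∂complexGaussian s) / 2) |>.trans ?_
  · rw [norm_mul]
    simp only [Pi.add_apply]
    nlinarith [sq_nonneg (‖rotW (t.1 + ε L) t.2 (charW L (shiftAngles ε y) (ξ + r • β)) a' b'‖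
      - ‖rotW (t.1 + ε' L) t.2 (charW L (shiftAngles ε' y) (η + r' • β)) c' d'‖)]
  · rw [integral_div, ← integral_add l1 l2]
    rfl
  · linarith

theorem norm_charCorr_corrB_le {s : ℝ} (hs : 0 < s) (ε ε' : ℕ → ℝ) (L : ℕ) (ξ η : ℂ) :
    ‖charCorr corrB s ε ε' L ξ η‖ ≤ (2 * s)⁻¹ := by
  cases L with
  | zero =>
    rw [charCorr_corrB_zero, norm_zero]
    positivity
  | succ L =>
    have h : charCorr corrB s ε ε' (L + 1) ξ η = _ :=
      integral_add (integrable_charW_mul_charW s ε ε' (L + 1) ξ η 0 1 1 0)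
        (integrable_charW_mul_charW s ε ε' (L + 1) ξ η 1 0 0 1)
    have h1 := norm_integral_charW_offDiag_le hs ε ε' L ξ η (by norm_num) (by norm_num)
      (fun y q => charW_snocParams_zero_one ε y q ξ) (fun y q => charW_snocParams_one_zero ε' y q η)
    have h2 := norm_integral_charW_offDiag_le hs ε ε' L ξ η (by norm_num) (by norm_num)
      (fun y q => charW_snocParams_one_zero ε y q ξ) (fun y q => charW_snocParams_zero_one ε' y q η)
    rw [h]
    refine (norm_add_le _ _).trans ((add_le_add h1 h2).trans_eq ?_)
    field_simp
    norm_num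

/-! ### Amplitudes and characteristic functions -/

theorem IsOverlap.integrable_chi_mul_charW_self {f : ℂ → ℂ} (hf : IsOverlap f) {L : ℕ} (x : Params L)
    (g : ℂ) (a b : Fin 2) : Integrable fun ξ => chi f ξ *
      (Complex.exp (Complex.I * (2 * (ξ * conj g).im : ℝ)) * charW L x ξ a b) := by
  refine hf.integrable_chi.mul_bdd (c := 4 ^ L) ?_ (ae_of_all _ fun ξ => ?_)
  · exact (Continuous.mul (by fun_prop) ((continuous_charW L a b).comp
      (by fun_prop : Continuous fun ξ : ℂ => (x, ξ)))).aestronglyMeasurable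
  · rw [norm_mul, norm_cexp_I_mul, one_mul]
    exact norm_charW_le _ _ _ _ _

theorem IsOverlap.ampW_eq {f : ℂ → ℂ} (hf : IsOverlap f) (L : ℕ) (x : Params L) (g : ℂ)
    (a b : Fin 2) :
    ampW f L x g a b = (Real.pi : ℂ)⁻¹ * ∫ ξ, chi f ξ *
      (Complex.exp (Complex.I * (2 * (ξ * conj g).im : ℝ)) * charW L x ξ a b) := by
  rw [ampW, hf.conj_amp_mul_amp]
  congr 2
  funext ξ
  rw [weylPhase, add_sub_cancel_right]
  have e : (ξ * (conj g + conj g)).im - (g * conj g).im = 2 * (ξ * conj g).im := by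
    rw [← two_mul, Complex.mul_conj, Complex.ofReal_im, sub_zero, mul_left_comm]
    simp
  rw [e]

section

variable {f : ℂ → ℂ} {K : (Fin 2 → Fin 2 → ℂ) → (Fin 2 → Fin 2 → ℂ) → ℂ}

/-- Each copy contributes one Weyl integral; bilinearity of `K` moves the contraction inside the
double integral, and the phases in `g` combine to one in `ξ + η`. -/
theorem IsOverlap.corr_ampW_eq (hf : IsOverlap f) (hK : IsCorr K) (L : ℕ) (x x' : Params L) (g : ℂ) :
    K (ampW f L x g) (ampW f L x' g) = (Real.pi : ℂ)⁻¹ ^ 2 * ∫ p : ℂ × ℂ, chi f p.1 * chi f p.2 *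
      (Complex.exp (Complex.I * (2 * ((p.1 + p.2) * conj g).im : ℝ)) *
        K (charW L x p.1) (charW L x' p.2)) := by
  obtain ⟨a, b, c, d, a', b', c', d', h⟩ := hK
  have hi := fun (x : Params L) a b => hf.integrable_chi_mul_charW_self x g a b
  simp only [h, hf.ampW_eq]
  have e : ∀ p : ℂ × ℂ, chi f p.1 * chi f p.2 *
      (Complex.exp (Complex.I * (2 * ((p.1 + p.2) * conj g).im : ℝ)) *
        (charW L x p.1 a b * charW L x' p.2 c d + charW L x p.1 a' b' * charW L x' p.2 c' d'))
      = (chi f p.1 * (Complex.exp (Complex.I * (2 * (p.1 * conj g).im : ℝ)) * charW L x p.1 a b)) *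
        (chi f p.2 * (Complex.exp (Complex.I * (2 * (p.2 * conj g).im : ℝ)) * charW L x' p.2 c d))
      + (chi f p.1 * (Complex.exp (Complex.I * (2 * (p.1 * conj g).im : ℝ)) * charW L x p.1 a' b')) *
        (chi f p.2 * (Complex.exp (Complex.I * (2 * (p.2 * conj g).im : ℝ)) * charW L x' p.2 c' d')) :=
    fun p => by
      have e' : Complex.exp (Complex.I * (2 * ((p.1 + p.2) * conj g).im : ℝ))
          = Complex.exp (Complex.I * (2 * (p.1 * conj g).im : ℝ)) *
            Complex.exp (Complex.I * (2 * (p.2 * conj g).im : ℝ)) := by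
        rw [← Complex.exp_add, add_mul, Complex.add_im]
        congr 1
        push_cast
        ring
      rw [e']
      ring
  have hP : ∀ a b c d, ∫ p : ℂ × ℂ,
      (chi f p.1 * (Complex.exp (Complex.I * (2 * (p.1 * conj g).im : ℝ)) * charW L x p.1 a b)) *
        (chi f p.2 * (Complex.exp (Complex.I * (2 * (p.2 * conj g).im : ℝ)) * charW L x' p.2 c d))
          ∂(volume : Measure ℂ).prod volume
      = (∫ ξ, chi f ξ * (Complex.exp (Complex.I * (2 * (ξ * conj g).im : ℝ)) * charW L x ξ a b)) *
        ∫ ξ, chi f ξ * (Complex.exp (Complex.I * (2 * (ξ * conj g).im : ℝ)) * charW L x' ξ c d) :=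
    fun a b c d => integral_prod_mul
      (fun ξ => chi f ξ * (Complex.exp (Complex.I * (2 * (ξ * conj g).im : ℝ)) * charW L x ξ a b))
      (fun ξ => chi f ξ * (Complex.exp (Complex.I * (2 * (ξ * conj g).im : ℝ)) * charW L x' ξ c d))
  simp_rw [e]
  rw [Measure.volume_eq_prod, integral_add ((hi x a b).mul_prod (hi x' c d))
    ((hi x a' b').mul_prod (hi x' c' d')), hP, hP]
  ring

theorem IsOverlap.integrable_chi_mul_chi (hf : IsOverlap f) :
    Integrable fun p : ℂ × ℂ => chi f p.1 * chi f p.2 :=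
  hf.integrable_chi.mul_prod hf.integrable_chi

theorem IsOverlap.ampCorr_eq (hf : IsOverlap f) (hK : IsCorr K) (s : ℝ) (ε ε' : ℕ → ℝ) (L : ℕ)
    (g : ℂ) :
    ampCorr K f s ε ε' L g = (Real.pi : ℂ)⁻¹ ^ 2 * ∫ p : ℂ × ℂ, chi f p.1 * chi f p.2 *
      (Complex.exp (Complex.I * (2 * ((p.1 + p.2) * conj g).im : ℝ)) *
        charCorr K s ε ε' L p.1 p.2) := by
  simp only [ampCorr, hf.corr_ampW_eq hK]
  rw [integral_const_mul, integral_integral_swap]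
  · congr 2
    funext p
    rw [integral_const_mul, integral_const_mul, charCorr]
  · have h : Integrable (fun q : Params L × (ℂ × ℂ) => chi f q.2.1 * chi f q.2.2)
        ((ens s L).prod volume) := hf.integrable_chi_mul_chi.comp_snd (ens s L)
    have hc : Continuous fun q : Params L × (ℂ × ℂ) =>
        Complex.exp (Complex.I * (2 * ((q.2.1 + q.2.2) * conj g).im : ℝ)) *
          K (charW L (shiftAngles ε q.1) q.2.1) (charW L (shiftAngles ε' q.1) q.2.2) :=
      Continuous.mul (by fun_prop)
        (continuous_corr_charW hK ε ε' continuous_fst (by fun_prop) (by fun_prop))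
    refine h.mul_bdd (c := 2 * (4 ^ L) ^ 2) hc.aestronglyMeasurable (ae_of_all _ fun q => ?_)
    rw [norm_mul, norm_cexp_I_mul, one_mul]
    exact norm_corr_charW_le hK L _ _ _ _

/-- Averaging over `g` turns the common phase into damping of `ξ + η`, the direction that the last
layer does not damp in `corrA`. -/
theorem IsOverlap.ampMean_eq (hf : IsOverlap f) (hK : IsCorr K) (s : ℝ) (ε ε' : ℕ → ℝ) {v : ℝ}
    (hv : 0 ≤ v) (L : ℕ) :
    ampMean K f s ε ε' v L = (Real.pi : ℂ)⁻¹ ^ 2 * ∫ p : ℂ × ℂ, chi f p.1 * chi f p.2 *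
      ((Real.exp (-(v * ‖p.1 + p.2‖ ^ 2)) : ℂ) * charCorr K s ε ε' L p.1 p.2) := by
  simp only [ampMean, hf.ampCorr_eq hK]
  rw [integral_const_mul, integral_integral_swap]
  · congr 2
    funext p
    rw [integral_const_mul, integral_mul_const, integral_cexp_complexGaussian hv]
  · have h : Integrable (fun q : ℂ × (ℂ × ℂ) => chi f q.2.1 * chi f q.2.2)
        ((complexGaussian v).prod volume) := hf.integrable_chi_mul_chi.comp_snd (complexGaussian v)
    have hc : Continuous fun q : ℂ × (ℂ × ℂ) =>
        Complex.exp (Complex.I * (2 * ((q.2.1 + q.2.2) * conj q.1).im : ℝ)) *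
          charCorr K s ε ε' L q.2.1 q.2.2 :=
      Continuous.mul (by fun_prop) ((continuous_charCorr hK s ε ε' L).comp continuous_snd)
    refine h.mul_bdd (c := 2 * (4 ^ L) ^ 2) hc.aestronglyMeasurable (ae_of_all _ fun q => ?_)
    rw [norm_mul, norm_cexp_I_mul, one_mul]
    exact norm_charCorr_le hK s ε ε' L _ _

end

/-! ### Decay of the different-state part -/

theorem norm_mixM_le_add {κ : ℝ} {m a b : ℂ} (hκ : |κ| ≤ 1) :
    ‖mixM κ m a b‖ ≤ ((1 + κ / 2) * ‖m‖ + (1 - κ / 2) * ‖a‖ + 1 / 2 * ‖b‖) / 2 := by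
  obtain ⟨h1, h2⟩ := abs_le.1 hκ
  have e : mixM κ m a b = ((1 + κ / 2 : ℝ) * m + (1 - κ / 2 : ℝ) * a + (κ / 2 : ℝ) * b) / 2 := by
    rw [mixM]
    push_cast
    ring
  have h3 : |κ / 2| ≤ 1 / 2 := by rw [abs_div, abs_two]; linarith
  have h4 := mul_le_mul_of_nonneg_right h3 (norm_nonneg b)
  rw [e, norm_div, Complex.norm_ofNat]
  refine div_le_div_of_nonneg_right ((norm_add₃_le).trans ?_) (by norm_num)
  rw [norm_mul, norm_mul, norm_mul, Complex.norm_real, Complex.norm_real, Complex.norm_real,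
    Real.norm_of_nonneg (by linarith : (0 : ℝ) ≤ 1 + κ / 2),
    Real.norm_of_nonneg (by linarith : (0 : ℝ) ≤ 1 - κ / 2), Real.norm_eq_abs]
  linarith

theorem norm_mixA_le_add {κ : ℝ} {m a b : ℂ} (hκ : |κ| ≤ 1) :
    ‖mixA κ m a b‖ ≤ ((1 - κ / 2) * ‖m‖ + (1 + κ / 2) * ‖a‖ + 1 / 2 * ‖b‖) / 2 := by
  have h := norm_mixM_le_add (κ := -κ) (m := m) (a := a) (b := b) (by rwa [abs_neg])
  have e : mixM (-κ : ℝ) m a b = mixA κ m a b := by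
    rw [mixM, mixA]
    push_cast
    ring
  rw [e] at h
  linarith

/-- Let `x` and `y` be the damping factors of `ξ + η` and `ξ - η`. The layer map on the norms of M
and A has column sums `x(1 ± κ/2)/2 + y(1 ∓ κ/2)/2`, and for `|κ| ≤ 1` both are at most `1/2 + (x +
y)/4`. The coherences add at most `(x + y)/4 · 1/(2s) ≤ 1/(4s)` per layer. -/
theorem norm_charCorr_add_le {s : ℝ} (hs : 0 < s) (ε ε' : ℕ → ℝ) (L : ℕ) (ξ η : ℂ) :
    ‖charCorr corrM s ε ε' L ξ η‖ + ‖charCorr corrA s ε ε' L ξ η‖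
      ≤ (1 / 2 + (Real.exp (-(s * ‖ξ + η‖ ^ 2)) + Real.exp (-(s * ‖ξ - η‖ ^ 2))) / 4) ^ L
        + L * (4 * s)⁻¹ := by
  set x := Real.exp (-(s * ‖ξ + η‖ ^ 2))
  set y := Real.exp (-(s * ‖ξ - η‖ ^ 2))
  have hx0 : 0 ≤ x := Real.exp_nonneg _
  have hy0 : 0 ≤ y := Real.exp_nonneg _
  have hx1 : x ≤ 1 := Real.exp_le_one_iff.2 (by
    have : 0 ≤ s * ‖ξ + η‖ ^ 2 := by positivity
    linarith)
  have hy1 : y ≤ 1 := Real.exp_le_one_iff.2 (by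
    have : 0 ≤ s * ‖ξ - η‖ ^ 2 := by positivity
    linarith)
  induction L with
  | zero =>
    rw [charCorr_corrA_zero, norm_zero]
    simpa using norm_charCorr_corrM_zero_le s ε ε' ξ η
  | succ L ih =>
    have hκ := Real.abs_cos_le_one (ε L - ε' L)
    set κ := Real.cos (ε L - ε' L)
    have hb := norm_charCorr_corrB_le hs ε ε' L ξ η
    rw [charCorr_corrM_succ hs.le, charCorr_corrA_succ hs.le, norm_mul, norm_mul,
      Complex.norm_real, Complex.norm_real, Real.norm_of_nonneg hx0, Real.norm_of_nonneg hy0]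
    have h1 := mul_le_mul_of_nonneg_left (norm_mixM_le_add (m := charCorr corrM s ε ε' L ξ η)
      (a := charCorr corrA s ε ε' L ξ η) (b := charCorr corrB s ε ε' L ξ η) hκ) hx0
    have h2 := mul_le_mul_of_nonneg_left (norm_mixA_le_add (m := charCorr corrM s ε ε' L ξ η)
      (a := charCorr corrA s ε ε' L ξ η) (b := charCorr corrB s ε ε' L ξ η) hκ) hy0
    have hm := norm_nonneg (charCorr corrM s ε ε' L ξ η)
    have ha := norm_nonneg (charCorr corrA s ε ε' L ξ η)
    have hb0 := norm_nonneg (charCorr corrB s ε ε' L ξ η)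
    generalize ‖charCorr corrM s ε ε' L ξ η‖ = m at *
    generalize ‖charCorr corrA s ε ε' L ξ η‖ = a at *
    generalize ‖charCorr corrB s ε ε' L ξ η‖ = b at *
    obtain ⟨hκ1, hκ2⟩ := abs_le.1 hκ
    set l := 1 / 2 + (x + y) / 4 with hl
    have hl0 : 0 ≤ l := by positivity
    have hl1 : l ≤ 1 := by rw [hl]; linarith
    have hm' : x * (1 + κ / 2) / 2 + y * (1 - κ / 2) / 2 ≤ l := by
      rw [hl]
      nlinarith [mul_nonneg (sub_nonneg.2 hx1) (sub_nonneg.2 hκ2),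
        mul_nonneg (sub_nonneg.2 hy1) (by linarith : 0 ≤ 1 + κ), mul_nonneg hx0 hy0]
    have ha' : x * (1 - κ / 2) / 2 + y * (1 + κ / 2) / 2 ≤ l := by
      rw [hl]
      nlinarith [mul_nonneg (sub_nonneg.2 hy1) (sub_nonneg.2 hκ2),
        mul_nonneg (sub_nonneg.2 hx1) (by linarith : 0 ≤ 1 + κ), mul_nonneg hx0 hy0]
    have h3 := mul_le_mul_of_nonneg_right hm' hm
    have h4 := mul_le_mul_of_nonneg_right ha' ha
    have h5 := mul_le_mul_of_nonneg_left ih hl0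
    have h6 : (x + y) / 4 * b ≤ 1 / 2 * (2 * s)⁻¹ :=
      mul_le_mul (by linarith) hb hb0 (by norm_num)
    have h7 : l * (L * (4 * s)⁻¹) ≤ L * (4 * s)⁻¹ := mul_le_of_le_one_left (by positivity) hl1
    have e : 1 / 2 * (2 * s)⁻¹ = (4 * s)⁻¹ := by field_simp; norm_num
    rw [pow_succ, Nat.cast_succ]
    linarith

/-- The last layer is kept apart from the power because its factor makes the whole bound, coherence
term included, integrable in `ξ - η`. -/
theorem norm_charCorr_corrA_succ_le {s : ℝ} (hs : 0 < s) (ε ε' : ℕ → ℝ) (L : ℕ) (ξ η : ℂ) :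
    ‖charCorr corrA s ε ε' (L + 1) ξ η‖ ≤ Real.exp (-(s * ‖ξ - η‖ ^ 2)) *
      ((1 / 2 + (Real.exp (-(s * ‖ξ + η‖ ^ 2)) + Real.exp (-(s * ‖ξ - η‖ ^ 2))) / 4) ^ L
        + (L + 1) * (4 * s)⁻¹) := by
  have h := norm_charCorr_add_le hs ε ε' L ξ η
  have hb := norm_charCorr_corrB_le hs ε ε' L ξ η
  have hκ := Real.abs_cos_le_one (ε L - ε' L)
  have h2 := norm_mixA_le_add (m := charCorr corrM s ε ε' L ξ η)
    (a := charCorr corrA s ε ε' L ξ η) (b := charCorr corrB s ε ε' L ξ η) hκ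
  obtain ⟨hκ1, hκ2⟩ := abs_le.1 hκ
  have hm := norm_nonneg (charCorr corrM s ε ε' L ξ η)
  have ha := norm_nonneg (charCorr corrA s ε ε' L ξ η)
  have e : 1 / 2 * (2 * s)⁻¹ = (4 * s)⁻¹ := by field_simp; norm_num
  have hpos : 0 < (4 * s)⁻¹ := by positivity
  rw [charCorr_corrA_succ hs.le, norm_mul, Complex.norm_real, Real.norm_of_nonneg (Real.exp_nonneg _)]
  refine mul_le_mul_of_nonneg_left (h2.trans ?_) (Real.exp_nonneg _)
  nlinarith

/-- The profile of the decay in one of the directions `ξ ± η`. -/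
def decayProfile (s : ℝ) (L : ℕ) (z : ℂ) : ℝ :=
  Real.exp (-((1 + L / 8) * s * ‖z‖ ^ 2)) + Real.exp (-(L / 8)) * Real.exp (-(s * ‖z‖ ^ 2))

/-- `1 - e^{-r} ≥ r/(1 + r)` is at least `r/2` for `r ≤ 1` and at least `1/2` for `r ≥ 1`: Gaussian
decay near the origin, a constant gain away from it. -/
theorem exp_neg_mul_one_sub_exp_neg_le {κ r : ℝ} (hκ : 0 ≤ κ) (hr : 0 ≤ r) :
    Real.exp (-(κ * (1 - Real.exp (-r)))) ≤ Real.exp (-(κ * r / 2)) + Real.exp (-(κ / 2)) := by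
  have h1 : Real.exp (-r) ≤ (1 + r)⁻¹ := by
    rw [Real.exp_neg]
    exact inv_anti₀ (by linarith) (by linarith [Real.add_one_le_exp r])
  rcases le_total r 1 with h | h
  · have h2 : r / 2 ≤ 1 - Real.exp (-r) := by
      have : (1 + r)⁻¹ ≤ 1 - r / 2 := by
        rw [inv_le_iff_one_le_mul₀ (by linarith)]
        nlinarith
      linarith
    have h3 := mul_le_mul_of_nonneg_left h2 hκ
    have h4 : Real.exp (-(κ * (1 - Real.exp (-r)))) ≤ Real.exp (-(κ * r / 2)) :=
      Real.exp_le_exp.2 (by linarith)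
    linarith [Real.exp_pos (-(κ / 2))]
  · have h2 : 1 / 2 ≤ 1 - Real.exp (-r) := by
      have : (1 + r)⁻¹ ≤ 1 / 2 := by
        rw [inv_le_iff_one_le_mul₀ (by linarith)]
        linarith
      linarith
    have h3 := mul_le_mul_of_nonneg_left h2 hκ
    have h4 : Real.exp (-(κ * (1 - Real.exp (-r)))) ≤ Real.exp (-(κ / 2)) :=
      Real.exp_le_exp.2 (by linarith)
    linarith [Real.exp_pos (-(κ * r / 2))]

/-- The base is `1 - (1 - x)/4 - (1 - y)/4`, so `1 + t ≤ e^t` splits its power into one factor for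
each direction, and each factor is bounded separately. -/
theorem exp_mul_pow_le_decayProfile {s : ℝ} (hs : 0 < s) (L : ℕ) (z w : ℂ) :
    Real.exp (-(s * ‖z‖ ^ 2)) * Real.exp (-(s * ‖w‖ ^ 2)) *
      (1 / 2 + (Real.exp (-(s * ‖z‖ ^ 2)) + Real.exp (-(s * ‖w‖ ^ 2))) / 4) ^ L
      ≤ decayProfile s L z * decayProfile s L w := by
  have key : ∀ z : ℂ, Real.exp (-(s * ‖z‖ ^ 2)) *
      Real.exp (-(L / 4 * (1 - Real.exp (-(s * ‖z‖ ^ 2))))) ≤ decayProfile s L z := fun z => by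
    have h := exp_neg_mul_one_sub_exp_neg_le (κ := L / 4) (r := s * ‖z‖ ^ 2) (by positivity)
      (by positivity)
    refine (mul_le_mul_of_nonneg_left h (Real.exp_nonneg _)).trans_eq ?_
    rw [mul_add, ← Real.exp_add, decayProfile, mul_comm (Real.exp (-(L / 8)))]
    congr 2
    · ring_nf
    · ring_nf
  have hpow : (1 / 2 + (Real.exp (-(s * ‖z‖ ^ 2)) + Real.exp (-(s * ‖w‖ ^ 2))) / 4) ^ L
      ≤ Real.exp (-(L / 4 * (1 - Real.exp (-(s * ‖z‖ ^ 2))))) *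
        Real.exp (-(L / 4 * (1 - Real.exp (-(s * ‖w‖ ^ 2))))) := by
    rw [← Real.exp_add]
    have h : 1 / 2 + (Real.exp (-(s * ‖z‖ ^ 2)) + Real.exp (-(s * ‖w‖ ^ 2))) / 4
        ≤ Real.exp (-((1 - Real.exp (-(s * ‖z‖ ^ 2))) / 4)
          + -((1 - Real.exp (-(s * ‖w‖ ^ 2))) / 4)) := by
      refine le_trans ?_ (Real.add_one_le_exp _)
      linarith
    refine (pow_le_pow_left₀ (by positivity) h L).trans_eq ?_
    rw [← Real.exp_nat_mul]
    congr 1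
    ring
  calc _ ≤ Real.exp (-(s * ‖z‖ ^ 2)) * Real.exp (-(s * ‖w‖ ^ 2)) *
      (Real.exp (-(L / 4 * (1 - Real.exp (-(s * ‖z‖ ^ 2))))) *
        Real.exp (-(L / 4 * (1 - Real.exp (-(s * ‖w‖ ^ 2)))))) :=
        mul_le_mul_of_nonneg_left hpow (by positivity)
    _ = (Real.exp (-(s * ‖z‖ ^ 2)) * Real.exp (-(L / 4 * (1 - Real.exp (-(s * ‖z‖ ^ 2)))))) *
      (Real.exp (-(s * ‖w‖ ^ 2)) * Real.exp (-(L / 4 * (1 - Real.exp (-(s * ‖w‖ ^ 2)))))) := by ring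
    _ ≤ _ := mul_le_mul (key z) (key w) (by positivity) ((by positivity : (0 : ℝ) ≤ _).trans (key z))

theorem integrable_decayProfile {s : ℝ} (hs : 0 < s) (L : ℕ) : Integrable (decayProfile s L) :=
  (integrable_exp_neg_mul_norm_sq (by positivity : 0 < (1 + (L : ℝ) / 8) * s)).add
    ((integrable_exp_neg_mul_norm_sq hs).const_mul _)

/-- In the plane a Gaussian integral is inversely proportional to its rate, so the narrowed part
gains `1/(1 + L/8)`; the weight `e^{-L/8}` of the other part is no larger than that. -/
theorem integral_decayProfile_le {s : ℝ} (hs : 0 < s) (L : ℕ) :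
    ∫ z, decayProfile s L z ≤ 16 * Real.pi / (s * (L + 1)) := by
  simp only [decayProfile]
  rw [integral_add (integrable_exp_neg_mul_norm_sq (by positivity : 0 < (1 + (L : ℝ) / 8) * s))
    ((integrable_exp_neg_mul_norm_sq hs).const_mul _), integral_const_mul,
    integral_exp_neg_mul_norm_sq (by positivity), integral_exp_neg_mul_norm_sq hs]
  have h1 : Real.exp (-((L : ℝ) / 8)) ≤ (1 + (L : ℝ) / 8)⁻¹ := by
    rw [Real.exp_neg]
    exact inv_anti₀ (by positivity) (by linarith [Real.add_one_le_exp ((L : ℝ) / 8)])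
  have h2 : (1 + (L : ℝ) / 8)⁻¹ ≤ 8 / (L + 1) := by
    rw [inv_le_iff_one_le_mul₀ (by positivity), div_mul_eq_mul_div, le_div_iff₀ (by positivity)]
    linarith
  have hpi := Real.pi_pos
  calc Real.pi / ((1 + L / 8) * s) + Real.exp (-(L / 8)) * (Real.pi / s)
      ≤ (1 + (L : ℝ) / 8)⁻¹ * (Real.pi / s) + (1 + (L : ℝ) / 8)⁻¹ * (Real.pi / s) := by
        refine add_le_add (le_of_eq ?_) (mul_le_mul_of_nonneg_right h1 (by positivity))
        field_simp
    _ ≤ 8 / (L + 1) * (Real.pi / s) + 8 / (L + 1) * (Real.pi / s) := by gcongr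
    _ = _ := by field_simp; norm_num

/-- Two shears and a swap carry `(ξ, η)` to `(ξ + η, (ξ - η)/2)` and preserve the measure; the
factor 1/4 comes from doubling the second complex variable. -/
theorem integrable_and_integral_add_sub {H₁ H₂ : ℂ → ℝ} (h₁ : Integrable H₁) (h₂ : Integrable H₂) :
    Integrable (fun p : ℂ × ℂ => H₁ (p.1 + p.2) * H₂ (p.1 - p.2)) ∧
      ∫ p : ℂ × ℂ, H₁ (p.1 + p.2) * H₂ (p.1 - p.2) = 1 / 4 * ((∫ z, H₁ z) * ∫ z, H₂ z) := by
  have hA : MeasurePreserving (fun p : ℂ × ℂ => (p.1, p.1 + p.2)) :=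
    measurePreserving_prod_add volume volume
  have hB : MeasurePreserving (fun p : ℂ × ℂ => (p.1, p.2 - (2 : ℝ)⁻¹ • p.1)) :=
    (MeasurePreserving.id volume).skew_product (g := fun a b => b - (2 : ℝ)⁻¹ • a) (by fun_prop)
      (ae_of_all _ fun a => (measurePreserving_sub_right volume ((2 : ℝ)⁻¹ • a)).map_eq)
  have hS : MeasurePreserving (Prod.swap : ℂ × ℂ → ℂ × ℂ) := Measure.measurePreserving_swap
  have hC := hB.comp (hS.comp hA)
  have h₂' : Integrable fun z : ℂ => H₂ ((2 : ℝ) • z) := h₂.comp_smul two_ne_zero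
  have hi := h₁.mul_prod h₂'
  have e : ∀ p : ℂ × ℂ, H₁ (p.1 + p.2) * H₂ (p.1 - p.2)
      = (fun q : ℂ × ℂ => H₁ q.1 * H₂ ((2 : ℝ) • q.2))
        (((fun p : ℂ × ℂ => (p.1, p.2 - (2 : ℝ)⁻¹ • p.1)) ∘ Prod.swap ∘
          fun p : ℂ × ℂ => (p.1, p.1 + p.2)) p) := fun p => by
    simp only [Function.comp, Prod.swap]
    congr 2
    rw [smul_sub, smul_smul, two_smul]
    norm_num
  simp_rw [e]
  refine ⟨hC.integrable_comp_of_integrable hi, ?_⟩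
  have hm := hC.map_eq
  have h := integral_map (μ := volume) hC.measurable.aemeasurable
    (f := fun q : ℂ × ℂ => H₁ q.1 * H₂ ((2 : ℝ) • q.2)) (by rw [hm]; exact hi.aestronglyMeasurable)
  rw [hm] at h
  refine h.symm.trans ?_
  have h' : ∫ q : ℂ × ℂ, H₁ q.1 * H₂ ((2 : ℝ) • q.2)
      = (∫ z, H₁ z) * ∫ z, H₂ ((2 : ℝ) • z) := integral_prod_mul H₁ fun z => H₂ ((2 : ℝ) • z)
  rw [h', Measure.integral_comp_smul, Complex.finrank_real_complex, smul_eq_mul,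
    abs_of_pos (by norm_num)]
  ring

theorem IsOverlap.exists_norm_ampMean_corrA_le {f : ℂ → ℂ} (hf : IsOverlap f) :
    ∃ C, 0 ≤ C ∧ ∀ (s : ℝ) (_ : 0 < s) (ε ε' : ℕ → ℝ) (v : ℝ) (_ : s ≤ v) (L : ℕ),
      ‖ampMean corrA f s ε ε' v L‖ ≤ C * (1 / (s ^ 2 * (L + 1) ^ 2) + (L + 1) / s ^ 3) := by
  set X := (Real.pi ^ 2)⁻¹ * ∫ p : ℂ × ℂ, ‖f p.1 * conj (f p.2)‖
  have hX : ∀ ξ, ‖chi f ξ‖ ≤ X := hf.norm_chi_le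
  have hX0 : 0 ≤ X := (norm_nonneg _).trans (hX 0)
  -- The constant is `64 · 4`: `16² / 4` from the two profile integrals and the Jacobian, and 4 from
  -- `(L + 2)² ≤ 4(L + 1)²`. The coherence term needs only `1/16`.
  refine ⟨256 * X ^ 2, by positivity, fun s hs ε ε' v hv L => ?_⟩
  -- Without layers the qubit stays in `|0⟩`, so the different-state part vanishes. With layers, `v
  -- ≥ s` confines `ξ + η`, the last layer confines `ξ - η`, and the layers before it narrow both.
  cases L with
  | zero =>
    rw [ampMean_corrA_zero, norm_zero]
    positivity
  | succ L =>
    obtain ⟨i1, j1⟩ := integrable_and_integral_add_sub (integrable_decayProfile hs L)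
      (integrable_decayProfile hs L)
    obtain ⟨i2, j2⟩ := integrable_and_integral_add_sub (integrable_exp_neg_mul_norm_sq hs)
      (integrable_exp_neg_mul_norm_sq hs)
    rw [integral_exp_neg_mul_norm_sq hs] at j2
    have hbound : ∀ p : ℂ × ℂ, ‖chi f p.1 * chi f p.2 *
        ((Real.exp (-(v * ‖p.1 + p.2‖ ^ 2)) : ℂ) * charCorr corrA s ε ε' (L + 1) p.1 p.2)‖
        ≤ X ^ 2 * (decayProfile s L (p.1 + p.2) * decayProfile s L (p.1 - p.2)
          + (L + 1) * (4 * s)⁻¹ * (Real.exp (-(s * ‖p.1 + p.2‖ ^ 2)) *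
            Real.exp (-(s * ‖p.1 - p.2‖ ^ 2)))) := fun p => by
      have h1 := norm_charCorr_corrA_succ_le hs ε ε' L p.1 p.2
      have h2 := exp_mul_pow_le_decayProfile hs L (p.1 + p.2) (p.1 - p.2)
      have h3 : Real.exp (-(v * ‖p.1 + p.2‖ ^ 2)) ≤ Real.exp (-(s * ‖p.1 + p.2‖ ^ 2)) :=
        Real.exp_le_exp.2 (by nlinarith [sq_nonneg ‖p.1 + p.2‖])
      rw [norm_mul, norm_mul, norm_mul, Complex.norm_real, Real.norm_of_nonneg (Real.exp_nonneg _),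
        sq X]
      refine mul_le_mul (mul_le_mul (hX _) (hX _) (norm_nonneg _) hX0) ?_ (by positivity)
        (by positivity)
      refine (mul_le_mul h3 h1 (norm_nonneg _) (Real.exp_nonneg _)).trans ?_
      linarith
    rw [hf.ampMean_eq isCorr_corrA s ε ε' (hs.le.trans hv), norm_mul, norm_pow, norm_inv,
      Complex.norm_real, Real.norm_of_nonneg Real.pi_pos.le]
    have hI := norm_integral_le_of_norm_le ((i1.add (i2.const_mul ((L + 1) * (4 * s)⁻¹))).const_mul
      (X ^ 2)) (ae_of_all _ hbound)
    have hE : ∫ p : ℂ × ℂ, X ^ 2 * (((fun p : ℂ × ℂ =>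
          decayProfile s L (p.1 + p.2) * decayProfile s L (p.1 - p.2)) + fun p : ℂ × ℂ =>
          (L + 1) * (4 * s)⁻¹ * (Real.exp (-(s * ‖p.1 + p.2‖ ^ 2)) *
            Real.exp (-(s * ‖p.1 - p.2‖ ^ 2)))) p)
        = X ^ 2 * (1 / 4 * ((∫ z, decayProfile s L z) * ∫ z, decayProfile s L z)
          + (L + 1) * (4 * s)⁻¹ * (1 / 4 * (Real.pi / s * (Real.pi / s)))) := by
      rw [integral_const_mul, integral_add' i1 (i2.const_mul _), integral_const_mul, j1, j2]
    have hD := integral_decayProfile_le hs L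
    have hD0 : 0 ≤ ∫ z, decayProfile s L z := integral_nonneg fun z => by
      unfold decayProfile
      positivity
    have hDD := mul_le_mul hD hD hD0 (by positivity)
    have hL : (0 : ℝ) < (L : ℝ) + 1 := by positivity
    have hpi := Real.pi_pos
    have hA : Real.pi⁻¹ ^ 2 * (1 / 4 * (16 * Real.pi / (s * (L + 1)) * (16 * Real.pi / (s * (L + 1)))))
        ≤ 256 * (1 / (s ^ 2 * ((L + 1 : ℕ) + 1) ^ 2)) := by
      have e : Real.pi⁻¹ ^ 2 * (1 / 4 * (16 * Real.pi / (s * (L + 1)) *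
          (16 * Real.pi / (s * (L + 1))))) = 64 / (s ^ 2 * (L + 1) ^ 2) := by
        field_simp
        norm_num
      rw [e, mul_one_div, div_le_div_iff₀ (by positivity) (by positivity)]
      push_cast
      have : ((L : ℝ) + 1 + 1) ^ 2 ≤ 4 * (L + 1) ^ 2 := by nlinarith
      nlinarith [mul_le_mul_of_nonneg_left this (by positivity : 0 ≤ s ^ 2)]
    have hB : Real.pi⁻¹ ^ 2 * ((L + 1) * (4 * s)⁻¹ * (1 / 4 * (Real.pi / s * (Real.pi / s))))
        ≤ 256 * (((L + 1 : ℕ) + 1) / s ^ 3) := by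
      have e : Real.pi⁻¹ ^ 2 * ((L + 1) * (4 * s)⁻¹ * (1 / 4 * (Real.pi / s * (Real.pi / s))))
          = 1 / 16 * ((L + 1) / s ^ 3) := by
        field_simp
        norm_num
      have h : ((L : ℝ) + 1) / s ^ 3 ≤ ((L + 1 : ℕ) + 1) / s ^ 3 := by
        push_cast
        gcongr
        linarith
      have h0 : 0 ≤ ((L : ℝ) + 1) / s ^ 3 := by positivity
      rw [e]
      linarith
    calc _ ≤ Real.pi⁻¹ ^ 2 * (X ^ 2 * (1 / 4 * ((∫ z, decayProfile s L z) * ∫ z, decayProfile s L z)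
          + (L + 1) * (4 * s)⁻¹ * (1 / 4 * (Real.pi / s * (Real.pi / s))))) :=
          mul_le_mul_of_nonneg_left (hI.trans_eq hE) (by positivity)
      _ ≤ Real.pi⁻¹ ^ 2 * (X ^ 2 * (1 / 4 * (16 * Real.pi / (s * (L + 1)) *
          (16 * Real.pi / (s * (L + 1))))
          + (L + 1) * (4 * s)⁻¹ * (1 / 4 * (Real.pi / s * (Real.pi / s))))) := by gcongr
      _ = X ^ 2 * (Real.pi⁻¹ ^ 2 * (1 / 4 * (16 * Real.pi / (s * (L + 1)) *
          (16 * Real.pi / (s * (L + 1)))))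
          + Real.pi⁻¹ ^ 2 * ((L + 1) * (4 * s)⁻¹ * (1 / 4 * (Real.pi / s * (Real.pi / s))))) := by ring
      _ ≤ X ^ 2 * (256 * (1 / (s ^ 2 * ((L + 1 : ℕ) + 1) ^ 2)) + 256 * (((L + 1 : ℕ) + 1) / s ^ 3)) := by
          gcongr
      _ = _ := by ring

/-! ### The mean of the cost -/

section

variable {f : ℂ → ℂ}

theorem continuous_ampW_shiftAngles (hf : Continuous f) (ε : ℕ → ℝ) {X : Type*} [TopologicalSpace X]
    {L : ℕ} {x : X → Params L} {g : X → ℂ} (hx : Continuous x) (hg : Continuous g) (a b : Fin 2) :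
    Continuous fun t => ampW f L (shiftAngles ε (x t)) (g t) a b :=
  (continuous_ampW hf L a b).comp (((continuous_shiftAngles ε).comp hx).prodMk hg)

theorem integrable_ampW_shiftAngles (hf : IsOverlap f) (s : ℝ) (ε : ℕ → ℝ) (L : ℕ) (g : ℂ)
    (a b : Fin 2) : Integrable (fun x => ampW f L (shiftAngles ε x) g a b) (ens s L) := by
  obtain ⟨B, hB⟩ := hf.exists_norm_le
  exact integrable_of_continuous _
    (continuous_ampW_shiftAngles hf.continuous ε continuous_id continuous_const a b)
    (fun _ => norm_ampW_le hB L _ g a b)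

theorem integral_ampW_succ_eq (hf : IsOverlap f) (s : ℝ) (ε : ℕ → ℝ) (L : ℕ) (g : ℂ) (a c : Fin 2)
    {z : ℂ → ℂ} (hz : Continuous z)
    (h : ∀ (y : Params L) (q : ℂ × ℝ × ℝ), ampW f (L + 1) (shiftAngles ε (snocParams y q)) g a a
      = rotW (q.2.1 + ε L) q.2.2 (ampW f L (shiftAngles ε y) (z q.1)) c c) :
    ∫ x, ampW f (L + 1) (shiftAngles ε x) g a a ∂ens s (L + 1)
      = ∫ β, (∫ y, ampW f L (shiftAngles ε y) (z β) 0 0 ∂ens s L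
        + ∫ y, ampW f L (shiftAngles ε y) (z β) 1 1 ∂ens s L) / 2 ∂complexGaussian s := by
  obtain ⟨B, hB⟩ := hf.exists_norm_le
  have hc : Continuous fun x => ampW f (L + 1) (shiftAngles ε x) g a a :=
    continuous_ampW_shiftAngles hf.continuous ε continuous_id continuous_const a a
  have hb := fun x => norm_ampW_le hB (L + 1) x g a a
  rw [integral_ens_succ s L hc (fun x => hb _)]
  have e : ∀ y, ∫ q, ampW f (L + 1) (shiftAngles ε (snocParams y q)) g a a ∂layerLaw s
      = ∫ β, (ampW f L (shiftAngles ε y) (z β) 0 0 + ampW f L (shiftAngles ε y) (z β) 1 1) / 2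
        ∂complexGaussian s := fun y => by
    rw [integral_layerLaw s (F := fun q => ampW f (L + 1) (shiftAngles ε (snocParams y q)) g a a)
      (hc.comp (continuous_snocParams_right y)) (fun q => hb _)]
    congr 1
    funext β
    simp only [h]
    exact integral_rotW _ _ _
  simp only [e]
  rw [integral_integral_swap]
  · congr 1
    funext β
    rw [integral_div, integral_add (integrable_ampW_shiftAngles hf s ε L _ 0 0)
      (integrable_ampW_shiftAngles hf s ε L _ 1 1)]
  · have hcont : ∀ a b, Integrable (fun p : Params L × ℂ =>
        ampW f L (shiftAngles ε p.1) (z p.2) a b) ((ens s L).prod (complexGaussian s)) := fun a b =>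
      integrable_of_continuous _ (continuous_ampW_shiftAngles hf.continuous ε continuous_fst
        (hz.comp continuous_snd) a b) (fun _ => norm_ampW_le hB L _ _ a b)
    exact ((hcont 0 0).add (hcont 1 1)).div_const 2

/-- The mean over the angles of a layer sees only the trace of the preceding matrix, and its own
shift has dropped out. -/
theorem integral_ampW_shiftAngles_eq (hf : IsOverlap f) (s : ℝ) (ε ε' : ℕ → ℝ) (L : ℕ) (g : ℂ)
    (a : Fin 2) :
    ∫ x, ampW f L (shiftAngles ε x) g a a ∂ens s L
      = ∫ x, ampW f L (shiftAngles ε' x) g a a ∂ens s L := by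
  induction L generalizing g a with
  | zero => rfl
  | succ L ih =>
    fin_cases a
    · have h := fun ε => integral_ampW_succ_eq hf s ε L g 0 1
        (by fun_prop : Continuous fun β => g - β)
        (fun y q => ampW_shiftAngles_snocParams_zero f ε y q g)
      simp only [Fin.zero_eta, h, ih]
    · have h := fun ε => integral_ampW_succ_eq hf s ε L g 1 0
        (by fun_prop : Continuous fun β => g + β)
        (fun y q => ampW_shiftAngles_snocParams_one f ε y q g)
      simp only [Fin.mk_one, h, ih]

end

/-! ### The variance of the gradient -/

theorem ofReal_cost (T : Target) {L : ℕ} (x : Params L) :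
    (cost T x : ℂ) = ampW (overlap T) L x 0 0 0 := by
  rw [cost_eq, ampW, Complex.conj_mul']
  push_cast
  rfl

theorem continuous_cost (T : Target) (L : ℕ) : Continuous (cost T (L := L)) := by
  have h := (continuous_amp (isOverlap_overlap T).continuous L 0).comp
    (by fun_prop : Continuous fun x : Params L => (x, (0 : ℂ)))
  have e : cost T (L := L) = fun x => ‖amp (overlap T) L x 0 0‖ ^ 2 := funext fun x => cost_eq T x
  rw [e]
  exact h.norm.pow 2

theorem cost_nonneg (T : Target) {L : ℕ} (x : Params L) : 0 ≤ cost T x := sq_nonneg _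

theorem exists_cost_le (T : Target) (L : ℕ) : ∃ B, ∀ x : Params L, cost T x ≤ B := by
  obtain ⟨B, hB⟩ := (isOverlap_overlap T).exists_norm_le
  refine ⟨(2 ^ L * B) ^ 2, fun x => ?_⟩
  rw [cost_eq]
  exact pow_le_pow_left₀ (norm_nonneg _) (norm_amp_le hB L x 0 0) 2

theorem integrable_cost (T : Target) (s : ℝ) (ε : ℕ → ℝ) (L : ℕ) :
    Integrable (fun x => cost T (shiftAngles ε x)) (ens s L) := by
  obtain ⟨B, hB⟩ := exists_cost_le T L
  refine Integrable.of_bound ((continuous_cost T L).comp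
    (continuous_shiftAngles ε)).aestronglyMeasurable B (ae_of_all _ fun x => ?_)
  rw [Real.norm_of_nonneg (cost_nonneg T _)]
  exact hB _

theorem integrable_cost_mul_cost (T : Target) (s : ℝ) (ε ε' : ℕ → ℝ) (L : ℕ) :
    Integrable (fun x => cost T (shiftAngles ε x) * cost T (shiftAngles ε' x)) (ens s L) := by
  obtain ⟨B, hB⟩ := exists_cost_le T L
  refine (integrable_cost T s ε L).mul_bdd (c := B) ((continuous_cost T L).comp
    (continuous_shiftAngles ε')).aestronglyMeasurable (ae_of_all _ fun x => ?_)
  rw [Real.norm_of_nonneg (cost_nonneg T _)]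
  exact hB _

theorem integral_cost_shiftAngles_eq (T : Target) (s : ℝ) (ε ε' : ℕ → ℝ) (L : ℕ) :
    ∫ x, cost T (shiftAngles ε x) ∂ens s L = ∫ x, cost T (shiftAngles ε' x) ∂ens s L := by
  have h := integral_ampW_shiftAngles_eq (isOverlap_overlap T) s ε ε' L 0 0
  simp only [← ofReal_cost] at h
  rw [integral_complex_ofReal, integral_complex_ofReal] at h
  exact_mod_cast h

/-- The cost is taken at `g = 0`, so the recursion starts from `v = 0` and ends at variance `L s`,
where the fourth moment is `C₁`. The halves reflect that the cost keeps one of the two qubit states.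
-/
theorem abs_integral_cost_mul_cost_sub_le (T : Target) {s : ℝ} (hs : 0 ≤ s) (ε ε' : ℕ → ℝ)
    {e : ℕ → ℝ} (he : ∀ v, s ≤ v → ∀ L, ‖ampMean corrA (overlap T) s ε ε' v L‖ ≤ e L) {L : ℕ}
    (hL : 0 < L) (hsL : 0 < L * s) :
    |∫ x, cost T (shiftAngles ε x) * cost T (shiftAngles ε' x) ∂ens s L
        - (∏ l ∈ Finset.range L, (1 + Real.cos (ε l - ε' l) / 2) / 2) * T.C₁ (L * s) / 2|
      ≤ (∑ i ∈ Finset.range L, (3 / 4) ^ (L - 1 - i) * e i) / 2 := by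
  obtain ⟨L, rfl⟩ := Nat.exists_eq_succ_of_ne_zero hL.ne'
  have h1 := norm_ampMean_corrM_sub_le (isOverlap_overlap T) hs ε ε' he (L + 1) le_rfl
  have h2 := integral_ampW_zero_zero_eq (isOverlap_overlap T) hs ε ε' L
  simp only [← ofReal_cost, ← Complex.ofReal_mul] at h2
  rw [integral_complex_ofReal] at h2
  have h3 : ampMean corrM (overlap T) s ε ε' 0 (L + 1)
      = ((2 * ∫ x, cost T (shiftAngles ε x) * cost T (shiftAngles ε' x) ∂ens s (L + 1) : ℝ) : ℂ) := by
    rw [Complex.ofReal_mul, h2]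
    push_cast
    ring
  rw [zero_add, ← C₁_eq_integral T hsL, h3, ← Complex.ofReal_mul, ← Complex.ofReal_sub,
    Complex.norm_real, Real.norm_eq_abs] at h1
  rw [le_div_iff₀ two_pos]
  refine le_trans (le_of_eq ?_) h1
  rw [← abs_two, ← abs_mul, abs_two]
  congr 1
  ring

theorem continuous_gradient (T : Target) {L : ℕ} (k : Fin L) : Continuous (gradient T k) := by
  have h := fun ε => (continuous_cost T L).comp (continuous_shiftAngles ε)
  have e : gradient T k = fun x => _ := funext fun x => gradient_eq T k x
  rw [e]
  exact ((h _).sub (h _)).div_const 2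

theorem memLp_gradient (T : Target) (s : ℝ) {L : ℕ} (k : Fin L) :
    MemLp (gradient T k) 2 (ens s L) := by
  obtain ⟨B, hB⟩ := exists_cost_le T L
  refine MemLp.of_bound (continuous_gradient T k).aestronglyMeasurable B (ae_of_all _ fun x => ?_)
  have h := fun ε => hB (shiftAngles ε x)
  have h0 := fun ε => cost_nonneg T (shiftAngles ε x)
  rw [gradient_eq, Real.norm_eq_abs, abs_le]
  constructor <;> linarith [h (Pi.single (k : ℕ) (Real.pi / 2)), h0 (Pi.single (k : ℕ) (Real.pi / 2)),
    h (Pi.single (k : ℕ) (-(Real.pi / 2))), h0 (Pi.single (k : ℕ) (-(Real.pi / 2)))]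

theorem integral_gradient (T : Target) (s : ℝ) {L : ℕ} (k : Fin L) :
    ∫ x, gradient T k x ∂ens s L = 0 := by
  simp only [gradient_eq]
  rw [integral_div, integral_sub (integrable_cost T s _ L) (integrable_cost T s _ L),
    integral_cost_shiftAngles_eq T s _ (Pi.single (k : ℕ) (-(Real.pi / 2))), sub_self, zero_div]

theorem variance_gradient_eq (T : Target) (s : ℝ) {L : ℕ} (k : Fin L) (ε ε' : ℕ → ℝ)
    (hε : ε = Pi.single (k : ℕ) (Real.pi / 2)) (hε' : ε' = Pi.single (k : ℕ) (-(Real.pi / 2))) :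
    variance (gradient T k) (ens s L)
      = (∫ x, cost T (shiftAngles ε x) * cost T (shiftAngles ε x) ∂ens s L
        - 2 * ∫ x, cost T (shiftAngles ε x) * cost T (shiftAngles ε' x) ∂ens s L
        + ∫ x, cost T (shiftAngles ε' x) * cost T (shiftAngles ε' x) ∂ens s L) / 4 := by
  have hi := integrable_cost_mul_cost T s
  have h1 : Integrable (fun x => cost T (shiftAngles ε x) * cost T (shiftAngles ε x)
      - 2 * (cost T (shiftAngles ε x) * cost T (shiftAngles ε' x))) (ens s L) :=
    (hi ε ε L).sub ((hi ε ε' L).const_mul 2)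
  rw [variance_of_integral_eq_zero (continuous_gradient T k).aemeasurable (integral_gradient T s k),
    ← integral_const_mul, ← integral_sub (hi ε ε L) ((hi ε ε' L).const_mul 2),
    ← integral_add h1 (hi ε' ε' L), ← integral_div]
  congr 1
  funext x
  rw [gradient_eq, ← hε, ← hε']
  ring

theorem prod_shift_self (ε : ℕ → ℝ) (L : ℕ) :
    ∏ l ∈ Finset.range L, (1 + Real.cos (ε l - ε l) / 2) / 2 = (3 / 4) ^ L := by
  simp only [sub_self, Real.cos_zero, Finset.prod_const, Finset.card_range]
  congr 1
  norm_num

/-- The shifts differ at layer `k` only, by `π`; there the cosine is `-1` and the factor 1/4 is a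
third of the usual 3/4. -/
theorem prod_shift_single {L : ℕ} (k : Fin L) :
    ∏ l ∈ Finset.range L, (1 + Real.cos ((Pi.single (k : ℕ) (Real.pi / 2) : ℕ → ℝ) l
      - (Pi.single (k : ℕ) (-(Real.pi / 2)) : ℕ → ℝ) l) / 2) / 2 = (3 / 4) ^ L / 3 := by
  have hk : (k : ℕ) ∈ Finset.range L := Finset.mem_range.2 k.2
  rw [← Finset.mul_prod_erase _ _ hk]
  have h : ∀ l ∈ (Finset.range L).erase k,
      (1 + Real.cos ((Pi.single (k : ℕ) (Real.pi / 2) : ℕ → ℝ) l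
        - (Pi.single (k : ℕ) (-(Real.pi / 2)) : ℕ → ℝ) l) / 2) / 2 = 3 / 4 := fun l hl => by
    have hne := Finset.ne_of_mem_erase hl
    rw [Pi.single_eq_of_ne hne, Pi.single_eq_of_ne hne, sub_zero, Real.cos_zero]
    norm_num
  rw [Finset.prod_congr rfl h, Finset.prod_const, Finset.card_erase_of_mem hk, Finset.card_range,
    Pi.single_eq_same, Pi.single_eq_same, sub_neg_eq_add, add_halves, Real.cos_pi]
  obtain ⟨n, rfl⟩ := Nat.exists_eq_succ_of_ne_zero (Fin.pos k).ne'
  rw [Nat.succ_sub_one, pow_succ]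
  ring

/-- The three second moments have leading coefficients 1/2, 1/6 and 1/2, and `(1/2 - 2/6 + 1/2)/4 =
1/6`. Their errors enter with weights 1, 2, 1 over 4, so the bound for a single moment is
reproduced. -/
theorem abs_variance_gradient_sub_le (T : Target) {s : ℝ} (hs : 0 < s) {L : ℕ} (k : Fin L)
    {e : ℕ → ℝ}
    (he : ∀ ε ε' v, s ≤ v → ∀ L, ‖ampMean corrA (overlap T) s ε ε' v L‖ ≤ e L) :
    |variance (gradient T k) (ens s L) - 1 / 6 * (3 / 4 : ℝ) ^ L * T.C₁ (L * s)|
      ≤ (∑ i ∈ Finset.range L, (3 / 4) ^ (L - 1 - i) * e i) / 2 := by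
  have hL : 0 < L := Fin.pos k
  have hsL : 0 < L * s := by positivity
  have h := fun ε ε' => abs_le.1 (abs_integral_cost_mul_cost_sub_le T hs.le ε ε' (he ε ε') hL hsL)
  set ε : ℕ → ℝ := Pi.single (k : ℕ) (Real.pi / 2) with hε
  set ε' : ℕ → ℝ := Pi.single (k : ℕ) (-(Real.pi / 2)) with hε'
  obtain ⟨a1, a2⟩ := h ε ε
  obtain ⟨b1, b2⟩ := h ε ε'
  obtain ⟨c1, c2⟩ := h ε' ε'
  rw [prod_shift_self] at a1 a2 c1 c2
  rw [prod_shift_single k] at b1 b2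
  rw [variance_gradient_eq T s k ε ε' hε hε', abs_le]
  constructor <;> linarith

/-! ### Summation over the layers and asymptotics in the energy -/

theorem exists_sum_geometric_le : ∃ S : ℝ, 0 ≤ S ∧ ∀ L : ℕ,
    ∑ i ∈ Finset.range L, (3 / 4 : ℝ) ^ (L - 1 - i) * ((L : ℝ) ^ 2 / (i + 1) ^ 2) ≤ S := by
  have h0 : ‖(3 / 4 : ℝ)‖ < 1 := by norm_num
  have hsum : Summable fun n : ℕ => (3 / 4 : ℝ) ^ n * (n + 1) ^ 2 := by
    have h1 := summable_pow_mul_geometric_of_norm_lt_one 2 h0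
    have h2 := (summable_pow_mul_geometric_of_norm_lt_one 1 h0).mul_left 2
    have h3 := summable_pow_mul_geometric_of_norm_lt_one 0 h0
    refine ((h1.add h2).add h3).congr fun n => ?_
    ring
  refine ⟨∑' n : ℕ, (3 / 4 : ℝ) ^ n * (n + 1) ^ 2, tsum_nonneg fun n => by positivity, fun L => ?_⟩
  refine le_trans ?_ (hsum.sum_le_tsum (Finset.range L) fun n _ => by positivity)
  -- Counting from the last layer, `n = L - 1 - i`, the ratio becomes `L/(L - n) ≤ n + 1` for `n <
  -- L`, which a convergent series dominates.
  rw [← Finset.sum_range_reflect]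
  refine Finset.sum_le_sum fun n hn => ?_
  have hn := Finset.mem_range.1 hn
  have e : L - 1 - (L - 1 - n) = n := by omega
  have e2 : ((L - 1 - n : ℕ) : ℝ) + 1 = L - n := by
    rw [show L - 1 - n = L - (n + 1) by omega, Nat.cast_sub (by omega)]
    push_cast
    ring
  have hn' : (n : ℝ) + 1 ≤ L := by exact_mod_cast hn
  have hn0 : (0 : ℝ) ≤ n := n.cast_nonneg
  rw [e, e2]
  refine mul_le_mul_of_nonneg_left ?_ (by positivity)
  rw [div_le_iff₀ (by nlinarith), ← mul_pow]
  refine pow_le_pow_left₀ (by positivity) ?_ 2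
  nlinarith

/-- With `s = E/L`, the term `1/s²` brings `L²/E²`; the factor `1/(i + 1)²` compensates it on the
late layers, where the geometric weight sits. The coherence terms are at most `L⁴/E³` each, and
there are `L` of them. -/
theorem exists_abs_variance_gradient_sub_le (T : Target) : ∃ A, 0 ≤ A ∧
    ∀ (E : ℝ), 0 < E → ∀ (L : ℕ) (k : Fin L),
      |variance (gradient T k) (ensemble E L) - 1 / 6 * (3 / 4 : ℝ) ^ L * T.C₁ E|
        ≤ A * (1 / E ^ 2 + L ^ 5 / E ^ 3) := by
  obtain ⟨C, hC, h⟩ := (isOverlap_overlap T).exists_norm_ampMean_corrA_le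
  obtain ⟨S, hS, hsum⟩ := exists_sum_geometric_le
  refine ⟨C * (S + 1), by positivity, fun E hE L k => ?_⟩
  have hL : (0 : ℝ) < L := by exact_mod_cast Fin.pos k
  have hs : 0 < E / L := by positivity
  have h1 := abs_variance_gradient_sub_le T hs k (fun ε ε' v hv i => h (E / L) hs ε ε' v hv i)
  rw [mul_div_cancel₀ _ hL.ne'] at h1
  refine h1.trans ?_
  have e : ∀ i ∈ Finset.range L, (3 / 4 : ℝ) ^ (L - 1 - i) *
      (C * (1 / ((E / L) ^ 2 * ((i : ℝ) + 1) ^ 2) + (i + 1) / (E / L) ^ 3))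
      ≤ C * (((3 / 4 : ℝ) ^ (L - 1 - i) * ((L : ℝ) ^ 2 / (i + 1) ^ 2)) / E ^ 2 + L ^ 4 / E ^ 3) :=
    fun i hi => by
      have hi' : (i : ℝ) + 1 ≤ L := by exact_mod_cast Finset.mem_range.1 hi
      have hp : (3 / 4 : ℝ) ^ (L - 1 - i) ≤ 1 := pow_le_one₀ (by norm_num) (by norm_num)
      have e1 : (3 / 4 : ℝ) ^ (L - 1 - i) *
          (C * (1 / ((E / L) ^ 2 * ((i : ℝ) + 1) ^ 2) + (i + 1) / (E / L) ^ 3))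
          = C * (((3 / 4 : ℝ) ^ (L - 1 - i) * ((L : ℝ) ^ 2 / (i + 1) ^ 2)) / E ^ 2
            + (3 / 4 : ℝ) ^ (L - 1 - i) * ((i + 1) * L ^ 3 / E ^ 3)) := by
        field_simp
      rw [e1]
      refine mul_le_mul_of_nonneg_left (add_le_add_right ?_ _) hC
      refine (mul_le_of_le_one_left (by positivity) hp).trans ?_
      refine div_le_div_of_nonneg_right ?_ (by positivity)
      calc ((i : ℝ) + 1) * (L : ℝ) ^ 3 ≤ L * (L : ℝ) ^ 3 := by gcongr
        _ = (L : ℝ) ^ 4 := by ring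
  have h2 := Finset.sum_le_sum e
  rw [← Finset.mul_sum, Finset.sum_add_distrib, ← Finset.sum_div, Finset.sum_const,
    Finset.card_range, nsmul_eq_mul] at h2
  have h3 : (∑ i ∈ Finset.range L, (3 / 4 : ℝ) ^ (L - 1 - i) * ((L : ℝ) ^ 2 / (i + 1) ^ 2)) / E ^ 2
      ≤ S / E ^ 2 := div_le_div_of_nonneg_right (hsum L) (by positivity)
  have e4 : (L : ℝ) * (L ^ 4 / E ^ 3) = L ^ 5 / E ^ 3 := by ring
  rw [e4] at h2
  have h5 : 0 ≤ (L : ℝ) ^ 5 / E ^ 3 := by positivity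
  have h6 : 0 ≤ 1 / E ^ 2 := by positivity
  have h7 : S / E ^ 2 = S * (1 / E ^ 2) := by ring
  rw [h7] at h3
  have h8 := mul_le_mul_of_nonneg_left h3 hC
  have h9 : 0 ≤ C * (S * ((L : ℝ) ^ 5 / E ^ 3)) := by positivity
  have h10 : 0 ≤ C * (1 / E ^ 2) := by positivity
  have h11 : 0 ≤ C * (S * (1 / E ^ 2)) := by positivity
  have h12 : 0 ≤ C * ((L : ℝ) ^ 5 / E ^ 3) := by positivity
  nlinarith

theorem exists_variance_gradient_shallow (T : Target) (ℓc : ℝ → ℝ) (hℓ : ℓc =O[atTop] Real.log) :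
    ∃ A E₀ : ℝ, ∀ E : ℝ, E₀ ≤ E → ∀ (L : ℕ) (k : Fin L), (L : ℝ) ≤ ℓc E →
      |variance (gradient T k) (ensemble E L) - 1 / 6 * (3 / 4 : ℝ) ^ L * T.C₁ E| ≤ A / E ^ 2 := by
  obtain ⟨A, hA, h⟩ := exists_abs_variance_gradient_sub_le T
  -- The fifth power is the one for which `L⁵/E³` drops below `1/E²`.
  have h1 : (fun E => ℓc E ^ 5) =o[atTop] (fun E : ℝ => E) :=
    (hℓ.pow 5).trans_isLittleO Real.isLittleO_pow_log_id_atTop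
  have h2 := h1.bound one_pos
  obtain ⟨E₀, hE₀⟩ := eventually_atTop.1 (h2.and (eventually_gt_atTop 0))
  refine ⟨A * 2, E₀, fun E hE L k hL => ?_⟩
  obtain ⟨h3, hpos⟩ := hE₀ E hE
  rw [one_mul, Real.norm_of_nonneg hpos.le] at h3
  have h4 : (L : ℝ) ^ 5 ≤ E :=
    (pow_le_pow_left₀ L.cast_nonneg hL 5).trans ((le_abs_self _).trans h3)
  refine (h E hpos L k).trans ?_
  have h5 : (L : ℝ) ^ 5 / E ^ 3 ≤ 1 / E ^ 2 := by
    rw [div_le_div_iff₀ (by positivity) (by positivity)]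
    nlinarith [mul_le_mul_of_nonneg_right h4 (by positivity : 0 ≤ E ^ 2)]
  calc A * (1 / E ^ 2 + L ^ 5 / E ^ 3) ≤ A * (1 / E ^ 2 + 1 / E ^ 2) := by gcongr
    _ = A * 2 / E ^ 2 := by ring

/-- Written in `u = 1/E`, the function `E * C₁` extends continuously to `u = 0` with a positive
value, and that value is the limit. -/
theorem exists_tendsto_mul_C₁ (T : Target) :
    ∃ c : ℝ, 0 < c ∧ Tendsto (fun E : ℝ => E * T.C₁ E) atTop (𝓝 c) := by
  have hu := tendsto_inv_atTop_zero (𝕜 := ℝ)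
  cases T with
  | gaussian γ τ ζ =>
    have hσ : 0 < sech ζ := one_div_pos.2 (Real.cosh_pos ζ)
    set a := 2 * ‖γ‖ ^ 2 + 2 * Real.tanh ζ * ‖γ‖ ^ 2 * Real.cos (2 * (Complex.arg γ + τ)) with ha
    set b := 4 * sech ζ ^ 2 * ‖γ‖ ^ 2 with hb
    set H : ℝ → ℝ := fun u => sech ζ ^ 2 *
      Real.exp (-((a * u ^ 2 + b * u) / (u ^ 2 + 4 * u + 4 * sech ζ ^ 2)))
        / Real.sqrt (u ^ 2 + 4 * u + 4 * sech ζ ^ 2) with hH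
    have h0 : ContinuousAt H 0 := by
      have h1 : (0 : ℝ) ^ 2 + 4 * 0 + 4 * sech ζ ^ 2 ≠ 0 := by positivity
      have h2 : Real.sqrt ((0 : ℝ) ^ 2 + 4 * 0 + 4 * sech ζ ^ 2) ≠ 0 := by positivity
      have h3 : Continuous fun u : ℝ => u ^ 2 + 4 * u + 4 * sech ζ ^ 2 := by fun_prop
      have h4 : Continuous fun u : ℝ => a * u ^ 2 + b * u := by fun_prop
      have h5 := (h4.continuousAt.div h3.continuousAt h1).neg.rexp
      exact (h5.const_mul _).div h3.sqrt.continuousAt h2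
    refine ⟨H 0, by positivity, (h0.tendsto.comp hu).congr' ?_⟩
    filter_upwards [eventually_gt_atTop 0] with E hE
    have e1 : E⁻¹ ^ 2 + 4 * E⁻¹ + 4 * sech ζ ^ 2 = G₁ ζ E / E ^ 2 := by
      rw [G₁]
      field_simp
    have e2 : a * E⁻¹ ^ 2 + b * E⁻¹ = Rfun γ τ ζ E / E ^ 2 := by
      rw [Rfun, ha, hb]
      field_simp
      ring
    have hG : 0 < G₁ ζ E := by
      unfold G₁
      positivity
    have e3 : Real.sqrt (G₁ ζ E / E ^ 2) = Real.sqrt (G₁ ζ E) / E := by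
      rw [Real.sqrt_div hG.le, Real.sqrt_sq hE.le]
    have e4 : Rfun γ τ ζ E / E ^ 2 / (G₁ ζ E / E ^ 2) = Rfun γ τ ζ E / G₁ ζ E := by
      field_simp
    have hs : Real.sqrt (G₁ ζ E) ≠ 0 := by positivity
    simp only [Function.comp, hH, e1, e2, e3, e4, Target.C₁]
    field_simp
  | fock n =>
    set H : ℝ → ℝ := fun u => ((2 * n).factorial : ℝ) / (2 ^ n * (n.factorial : ℝ)) ^ 2
        * (((1 + u / 2) ^ (2 * n))⁻¹ / (u + 2)) with hH
    have h0 : ContinuousAt H 0 := by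
      refine continuousAt_const.mul (ContinuousAt.div (ContinuousAt.inv₀ (by fun_prop) ?_)
        (by fun_prop) ?_)
      · norm_num
      · norm_num
    refine ⟨H 0, by positivity, (h0.tendsto.comp hu).congr' ?_⟩
    filter_upwards [eventually_gt_atTop 0] with E hE
    have e1 : 1 + E⁻¹ / 2 = 1 + 1 / (2 * E) := by
      field_simp
    have e2 : E⁻¹ + 2 = (1 + 2 * E) / E := by
      field_simp
    simp only [Function.comp, hH, e1, e2, Target.C₁]
    have : 0 < 1 + 1 / (2 * E) := by positivity
    field_simp

theorem exists_tendsto_mul_variance_gradient (T : Target) {L : ℕ} (k : Fin L) : ∃ c : ℝ, 0 < c ∧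
    Tendsto (fun E : ℝ => E * variance (gradient T k) (ensemble E L)) atTop (𝓝 c) := by
  obtain ⟨A, hA, h⟩ := exists_abs_variance_gradient_sub_le T
  obtain ⟨c, hc, hlim⟩ := exists_tendsto_mul_C₁ T
  refine ⟨1 / 6 * (3 / 4) ^ L * c, by positivity, ?_⟩
  have h1 := hlim.const_mul (1 / 6 * (3 / 4 : ℝ) ^ L)
  have hu := tendsto_inv_atTop_zero (𝕜 := ℝ)
  have h2 : Tendsto (fun E : ℝ => A * (E⁻¹ + L ^ 5 * E⁻¹ ^ 2)) atTop (𝓝 0) := by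
    have := (hu.add ((hu.pow 2).const_mul ((L : ℝ) ^ 5))).const_mul A
    simpa using this
  -- At fixed depth the error is `O(1/E²)`, so it vanishes even after multiplication by `E`.
  have h3 : Tendsto (fun E : ℝ => E * variance (gradient T k) (ensemble E L)
      - 1 / 6 * (3 / 4 : ℝ) ^ L * (E * T.C₁ E)) atTop (𝓝 0) := by
    refine squeeze_zero_norm' ?_ h2
    filter_upwards [eventually_gt_atTop 0] with E hE
    have e : E * variance (gradient T k) (ensemble E L) - 1 / 6 * (3 / 4 : ℝ) ^ L * (E * T.C₁ E)
        = E * (variance (gradient T k) (ensemble E L) - 1 / 6 * (3 / 4 : ℝ) ^ L * T.C₁ E) := by ring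
    rw [e, norm_mul, Real.norm_of_nonneg hE.le, Real.norm_eq_abs]
    refine (mul_le_mul_of_nonneg_left (h E hE L k) hE.le).trans_eq ?_
    field_simp
  simpa using h3.add h1

end

end ECDCircuit

theorem theorem1 (T : ECDCircuit.Target) :
    -- the gradient exists, is square integrable and has zero mean
    (∀ E : ℝ, 0 < E → ∀ (L : ℕ) (k : Fin L),
      (∀ x : ECDCircuit.Params L,
        DifferentiableAt ℝ (ECDCircuit.costAlong T k x) (x.2.1 k)) ∧
      MemLp (ECDCircuit.gradient T k) 2 (ECDCircuit.ensemble E L) ∧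
      ∫ x, ECDCircuit.gradient T k x ∂(ECDCircuit.ensemble E L) = 0) ∧
    -- the closed form is the correlator `C₁ = 𝔼 |⟨ψ|α⟩|⁴`
    (∀ E : ℝ, 0 < E →
      Integrable (fun α => ‖ECDCircuit.braket T.ket (ECDCircuit.coherent α)‖ ^ 4)
        (ECDCircuit.complexGaussian E) ∧
      T.C₁ E = ∫ α, ‖ECDCircuit.braket T.ket (ECDCircuit.coherent α)‖ ^ 4
        ∂(ECDCircuit.complexGaussian E)) ∧
    -- the variance for shallow depth, uniformly in the depth and in the angle
    (∀ ℓc : ℝ → ℝ, ℓc =O[atTop] Real.log →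
      ∃ A E₀ : ℝ, ∀ E : ℝ, E₀ ≤ E → ∀ (L : ℕ) (k : Fin L), (L : ℝ) ≤ ℓc E →
        |variance (ECDCircuit.gradient T k) (ECDCircuit.ensemble E L)
            - 1 / 6 * (3 / 4 : ℝ) ^ L * T.C₁ E| ≤ A / E ^ 2) ∧
    -- the variance scales as `1 / E`
    (∀ (L : ℕ) (k : Fin L), ∃ c : ℝ, 0 < c ∧
      Tendsto (fun E : ℝ => E * variance (ECDCircuit.gradient T k) (ECDCircuit.ensemble E L))
        atTop (𝓝 c)) := by
  refine ⟨fun E _ L k => ⟨fun x => ?_, ?_, ?_⟩, fun E hE => ?_, fun ℓc hℓ => ?_, fun L k => ?_⟩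
  · exact (ECDCircuit.hasDerivAt_costAlong T k x _).differentiableAt
  -- `ensemble E L` unfolds to `ens (E / L) L`, so statements for an arbitrary variance per layer
  -- apply directly.
  · exact ECDCircuit.memLp_gradient T (E / L) k
  · exact ECDCircuit.integral_gradient T (E / L) k
  · simp only [ECDCircuit.braket_coherent]
    exact ⟨ECDCircuit.integrable_norm_overlap_pow T E, ECDCircuit.C₁_eq_integral T hE⟩
  · exact ECDCircuit.exists_variance_gradient_shallow T ℓc hℓ
  · exact ECDCircuit.exists_tendsto_mul_variance_gradient T k
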